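/- There is a constant $C_0>0$ such that for every real $C\ge C_0$, every $C$-expander is Hamiltonian, i.e. contains a cycle passing through all of its vertices. Here a finite simple graph $G$ with $n\ge 3$ vertices is called a $C$-expander if (a) $|N(X)|\ge C|X|$ for every vertex set $X\subseteq V(G)$ with $|X|<\frac{n}{2C}$, where $N(X)$ is the set of vertices outside $X$ that are adjacent to at least one vertex of $X$; and (b) there is an edge between any two disjoint vertex sets $X,Y\subseteq V(G)$ with $|X|,|Y|\ge \frac{n}{2C}$. -/

import Mathlib

namespace SimpleGraph

variable {V : Type*} [Fintype V]

open Classical in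
/-- The outer neighbourhood `N(X)`: the vertices outside `X` adjacent to at least one vertex
of `X`. -/
noncomputable def outerNbhd (G : SimpleGraph V) (X : Finset V) : Finset V :=
  Finset.univ.filter fun v => v ∉ X ∧ ∃ x ∈ X, G.Adj x v

/-- `G` is a `C`-expander: it has `n ≥ 3` vertices, every vertex set `X` with `|X| < n / (2C)`
satisfies `|N(X)| ≥ C |X|`, and there is an edge between any two disjoint vertex sets of size
at least `n / (2C)`. -/
structure IsExpander (G : SimpleGraph V) (C : ℝ) : Prop where
  three_le_card : 3 ≤ Fintype.card V
  expand : ∀ X : Finset V, (X.card : ℝ) < (Fintype.card V : ℝ) / (2 * C) →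
    C * (X.card : ℝ) ≤ ((G.outerNbhd X).card : ℝ)
  joined : ∀ X Y : Finset V, Disjoint X Y →
    (Fintype.card V : ℝ) / (2 * C) ≤ (X.card : ℝ) →
    (Fintype.card V : ℝ) / (2 * C) ≤ (Y.card : ℝ) →
    ∃ x ∈ X, ∃ y ∈ Y, G.Adj x y

end SimpleGraph

/-! A connected 2-regular spanning subgraph is a Hamilton cycle (`isHamiltonian_of_dg_eq_two`). So
it suffices to find a spanning linear forest and to join up its ends so that a single cycle results.
In a sparse expander two given ends are rarely adjacent, and there is no control over which ends the
forest pairs up. Both difficulties are met by a frame reserved in advance. Write n for the number of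
vertices, let m be about n/1000 and let K be about log m.

The frame occupies less than a third of the graph and is embedded by `Extendable.exists_layout`. It
consists of long paths (pieces), spare vertices z, gadgets, columns, and wires joining prescribed
pairs of these. The embedding is of Friedman–Pippenger type with pruning: `Extendable.exists_insert`
adds a vertex while preserving expansion, `Extendable.sdiff` gives vertices back, and
`Extendable.exists_link` joins two points by growing a binary tree from each, using an edge between
their leaves and discarding all but one branch on each side. Afterwards every set of at most 2m
vertices still expands by a factor 12 outside the frame.

The rest of the graph is almost covered by a linear forest with few ends (`exists_linForest`). In a
largest subgraph of maximum degree two without short cycles, free ends are moved by rotations. The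
vertices are cut into small blocks. Rotations inside a set of blocks and inside the complementary
set do not interfere, so they cannot both reach m ends, since an edge between these would enlarge
the subgraph. The sets of blocks reaching fewer than m ends thus form a decreasing family of at
least half the cube. Its average edge boundary is of order √n (`upBoundary_le`). Flipping one block
then shows that neighbours in inactive blocks hardly outnumber those in active ones on average, and
with expansion this bounds the number of free ends (`card_free_le`).

The missing degrees are repaired one at a time (`Reservoir.absorb`). The ends reachable by rotation
from the free vertices outside number at least m. So do the ends reachable from the spare vertices z
by about log m rounds of rotation through the pieces. An edge between the two sets removes one
defect, and it damages only few components of the reservoir.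

Now every end lies in a gadget, in a column, or is an unused z. A parity count shows that the unused
z are even in number, so that they can be matched together with the columns
(`exists_column_matching`). A gadget has two perfect matchings, and whatever the pairing of ends
outside, one of them puts the whole gadget into one component (`Gadget.exists_mode`). The choices
can be made one after another (`exists_modes`). Wires chain the gadgets together and tie every other
end to a gadget, so the resulting 2-regular graph is connected (`exists_factor_of_gadgets`). -/

open Finset
open scoped Classical
set_option linter.unusedSectionVars false
set_option linter.unusedVariables false

namespace SimpleGraph

/-! ### Edge modifications, graphs without short cycles, and gluing of local changes. -/

section LinearForests

variable {V : Type*} [Fintype V]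

/-- The degree of `v` in `S`, with classical decidability. -/
noncomputable def dg (S : SimpleGraph V) (v : V) : ℕ := (univ.filter (S.Adj v)).card

/-- Every cycle of `S` has length at least `ℓ`. -/
def NoShort (ℓ : ℕ) (S : SimpleGraph V) : Prop :=
  ∀ a b, S.Adj a b → ∀ p : (S.deleteEdges {s(a, b)}).Walk a b, ℓ ≤ p.length + 1

/-- `S` with the edge `ab` added. -/
def addE (S : SimpleGraph V) (a b : V) : SimpleGraph V := S ⊔ edge a b

/-- `S` with the edge `ab` removed. -/
def delE (S : SimpleGraph V) (a b : V) : SimpleGraph V := S.deleteEdges {s(a, b)}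

theorem addE_adj {S : SimpleGraph V} {a b u v : V} :
    (S.addE a b).Adj u v ↔ S.Adj u v ∨ (u ≠ v ∧ ((u = a ∧ v = b) ∨ (u = b ∧ v = a))) := by
  unfold addE; rw [sup_adj, edge_adj]; grind

theorem delE_adj {S : SimpleGraph V} {a b u v : V} :
    (S.delE a b).Adj u v ↔ S.Adj u v ∧ ¬ ((u = a ∧ v = b) ∨ (u = b ∧ v = a)) := by
  unfold delE; simp

theorem delE_le {S : SimpleGraph V} {a b : V} : S.delE a b ≤ S := fun u v h => (delE_adj.1 h).1

theorem dg_mono {S T : SimpleGraph V} (h : S ≤ T) (v : V) : S.dg v ≤ T.dg v :=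
  card_le_card fun w hw => by simp only [mem_filter, mem_univ, true_and] at hw ⊢; exact h hw

theorem dg_pos {S : SimpleGraph V} {v : V} : 0 < S.dg v ↔ ∃ w, S.Adj v w := by
  simp [dg, card_pos, Finset.Nonempty]

theorem dg_congr {S T : SimpleGraph V} {v : V} (h : ∀ w, S.Adj v w ↔ T.Adj v w) :
    S.dg v = T.dg v := by
  unfold dg; congr 1; ext w; simp [h w]

theorem dg_addE {S : SimpleGraph V} {a b : V} (hab : a ≠ b) (h : ¬ S.Adj a b) (w : V) :
    (S.addE a b).dg w = S.dg w + (if w = a then 1 else 0) + (if w = b then 1 else 0) := by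
  have hba : ¬ S.Adj b a := fun h' => h h'.symm
  have key : ∀ a b : V, a ≠ b → ¬ S.Adj a b →
      univ.filter ((S.addE a b).Adj a) = insert b (univ.filter (S.Adj a)) := by
    intro a b hab h; ext v; simp only [mem_filter, mem_univ, true_and, mem_insert, addE_adj]; grind
  have hsymm : S.addE a b = S.addE b a := by ext u v; simp only [addE_adj]; grind
  by_cases ha : w = a
  · subst ha
    rw [if_pos rfl, if_neg hab]
    unfold dg; rw [key w b hab h, card_insert_of_notMem (by simpa using h)]
  · by_cases hb : w = b
    · subst hb
      rw [if_pos rfl, if_neg ha, hsymm]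
      unfold dg; rw [key w a hab.symm hba, card_insert_of_notMem (by simpa using hba)]
    · rw [if_neg ha, if_neg hb]
      simp only [add_zero]
      exact dg_congr fun v => by rw [addE_adj]; grind

theorem dg_delE {S : SimpleGraph V} {a b : V} (h : S.Adj a b) (w : V) :
    (S.delE a b).dg w + (if w = a then 1 else 0) + (if w = b then 1 else 0) = S.dg w := by
  have h1 : (S.delE a b).addE a b = S := by
    ext u v; simp only [addE_adj, delE_adj]
    have := S.ne_of_adj h
    constructor
    · rintro (h' | ⟨_, ⟨rfl, rfl⟩ | ⟨rfl, rfl⟩⟩)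
      exacts [h'.1, h, h.symm]
    · intro h'; have := S.ne_of_adj h'; grind
  rw [← dg_addE (S.ne_of_adj h) (by rw [delE_adj]; tauto), h1]

theorem NoShort.mono {ℓ : ℕ} {S T : SimpleGraph V} (h : T.NoShort ℓ) (hST : S ≤ T) :
    S.NoShort ℓ := by
  intro a b hab p
  have := h a b (hST hab) (p.mapLe (deleteEdges_mono hST))
  simpa using this

/-- A walk in `T + st` either avoids `st` or decomposes around it. -/
theorem walk_addE_split {T : SimpleGraph V} {s t a b : V} (p : (T.addE s t).Walk a b) :
    (∃ q : T.Walk a b, q.length ≤ p.length) ∨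
    (∃ (q : T.Walk a s) (r : T.Walk t b), q.length + r.length + 1 ≤ p.length) ∨
    (∃ (q : T.Walk a t) (r : T.Walk s b), q.length + r.length + 1 ≤ p.length) := by
  induction p with
  | nil => exact .inl ⟨.nil, le_rfl⟩
  | @cons u v w h p ih =>
    rcases addE_adj.1 h with h' | ⟨hne, ⟨rfl, rfl⟩ | ⟨rfl, rfl⟩⟩
    · rcases ih with ⟨q, hq⟩ | ⟨q, r, hq⟩ | ⟨q, r, hq⟩
      · exact .inl ⟨.cons h' q, by simp; omega⟩
      · exact .inr (.inl ⟨.cons h' q, r, by simp; omega⟩)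
      · exact .inr (.inr ⟨.cons h' q, r, by simp; omega⟩)
    · rcases ih with ⟨q, hq⟩ | ⟨q, r, hq⟩ | ⟨q, r, hq⟩
      · exact .inr (.inl ⟨.nil, q, by simp; omega⟩)
      · exact .inr (.inl ⟨.nil, r, by simp; omega⟩)
      · exact .inl ⟨r, by simp; omega⟩
    · rcases ih with ⟨q, hq⟩ | ⟨q, r, hq⟩ | ⟨q, r, hq⟩
      · exact .inr (.inr ⟨.nil, q, by simp; omega⟩)
      · exact .inl ⟨r, by simp; omega⟩
      · exact .inr (.inr ⟨.nil, r, by simp; omega⟩)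

/-- A new cycle consists of the edge `st` and a walk of `T` from `s` to `t`, so only the distance of
`s` and `t` in `T` matters. For an old edge `ab`, a closing walk that uses `st` is rearranged into a
walk from `s` to `t` through `ab`. -/
theorem NoShort.addE {ℓ : ℕ} {T : SimpleGraph V} {s t : V} (h : T.NoShort ℓ)
    (hst : ∀ p : T.Walk s t, ℓ ≤ p.length) : (T.addE s t).NoShort ℓ := by
  intro a b hab p
  by_cases hT : T.Adj a b
  · have hle : (T.addE s t).deleteEdges {s(a, b)} ≤ (T.delE a b).addE s t := by
      intro u v huv
      simp only [deleteEdges_adj, addE_adj, delE_adj] at huv ⊢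
      simp at huv; grind
    have hd : T.delE a b ≤ T := delE_le
    rcases walk_addE_split (p.mapLe hle) with ⟨q, hq⟩ | ⟨q, r, hq⟩ | ⟨q, r, hq⟩
    · have : ℓ ≤ q.length + 1 := h a b hT q
      simp at hq; omega
    · have := hst (((q.mapLe hd).reverse.concat hT).append (r.mapLe hd).reverse)
      simp at hq this; omega
    · have := hst (((r.mapLe hd).concat hT.symm).append (q.mapLe hd))
      simp at hq this; omega
  · have hle : (T.addE s t).deleteEdges {s(a, b)} ≤ T := by
      intro u v huv
      simp only [deleteEdges_adj, addE_adj] at huv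
      rw [addE_adj] at hab
      simp at huv; grind
    rcases addE_adj.1 hab with h' | ⟨hne, ⟨rfl, rfl⟩ | ⟨rfl, rfl⟩⟩
    · exact absurd h' hT
    · have := hst (p.mapLe hle); simp at this; omega
    · have := hst (p.mapLe hle).reverse; simp at this; omega

theorem IsAcyclic.noShort {S : SimpleGraph V} (h : S.IsAcyclic) (ℓ : ℕ) : S.NoShort ℓ := by
  intro a b hab p
  exact absurd p.reachable (isBridge_iff.1 (isAcyclic_iff_forall_adj_isBridge.1 h hab))

/-- A closing walk shortens to a path, which has fewer than |V| edges. Acyclicity is thus an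
instance of `NoShort`, so that one joining lemma serves both the almost-spanning phase and the
absorption. -/
theorem NoShort.isAcyclic {S : SimpleGraph V} {ℓ : ℕ} (h : S.NoShort ℓ)
    (hℓ : Fintype.card V < ℓ) : S.IsAcyclic := by
  rw [isAcyclic_iff_forall_adj_isBridge]
  intro a b hab
  rw [isBridge_iff]
  rintro ⟨p⟩
  have h1 := h a b hab p.bypass
  have h2 := (p.bypass_isPath).length_lt
  omega

/-- The graph that agrees with `S₁` inside `R₁`, with `S₂` inside `R₂` and with `S` elsewhere. -/
def combine (S S₁ S₂ : SimpleGraph V) (R₁ R₂ : V → Prop) : SimpleGraph V where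
  Adj u v := (R₁ u ∧ R₁ v ∧ S₁.Adj u v) ∨ (R₂ u ∧ R₂ v ∧ S₂.Adj u v) ∨
    (¬ (R₁ u ∧ R₁ v) ∧ ¬ (R₂ u ∧ R₂ v) ∧ S.Adj u v)
  symm := ⟨by
    intro u v h
    have h1 := S.adj_comm u v; have h2 := S₁.adj_comm u v; have h3 := S₂.adj_comm u v
    grind⟩
  loopless := ⟨by intro u h; simp at h⟩

section Glue

variable {S S₁ S₂ : SimpleGraph V} {R₁ R₂ : V → Prop} {ℓ : ℕ}

theorem combine_symm : combine S S₁ S₂ R₁ R₂ = combine S S₂ S₁ R₂ R₁ := by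
  ext u v; simp only [combine]; tauto

/-- A walk of the combined graph ending in `R₂` yields a walk of `S` to `R₂`. -/
theorem combine_walk_aux {u w : V} (p : (combine S S₁ S₂ R₁ R₂).Walk u w) (hw : R₂ w) :
    (∃ a b, ∃ q : S.Walk a b, (R₁ a ∨ a = u) ∧ R₂ b ∧ q.length ≤ p.length) := by
  induction p with
  | nil => exact ⟨_, _, .nil, .inr rfl, hw, le_rfl⟩
  | @cons u v w h p ih =>
    obtain ⟨a, b, q, ha, hb, hq⟩ := ih hw
    by_cases h1 : R₁ a
    · exact ⟨a, b, q, .inl h1, hb, by rw [Walk.length_cons]; omega⟩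
    · have : a = v := ha.resolve_left h1
      subst this
      rcases h with h | h | h
      · exact absurd h.2.1 h1
      · exact ⟨u, u, .nil, .inr rfl, h.1, by simp⟩
      · exact ⟨u, b, .cons h.2.2 q, .inr rfl, hb, Nat.succ_le_succ hq⟩

/-- Between leaving `R₁` and first entering `R₂` only edges of `S` are used. -/
theorem combine_walk {u w : V} (hfar : ∀ a b, R₁ a → R₂ b → ∀ p : S.Walk a b, ℓ ≤ p.length)
    (p : (combine S S₁ S₂ R₁ R₂).Walk u w) (hu : R₁ u) (hw : R₂ w) : ℓ ≤ p.length := by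
  obtain ⟨a, b, q, ha, hb, hq⟩ := combine_walk_aux p hw
  have : R₁ a := by rcases ha with ha | rfl <;> assumption
  exact (hfar a b this hb q).trans hq

/-- If a walk in the combined graph does not visit `R₂`, it is a walk in `S₁`. -/
theorem combine_transfer {D : Set (Sym2 V)}
    (h1 : ∀ u v, ¬ (R₁ u ∧ R₁ v) → (S₁.Adj u v ↔ S.Adj u v)) {u w : V}
    (p : ((combine S S₁ S₂ R₁ R₂).deleteEdges D).Walk u w) (hp : ∀ x ∈ p.support, ¬ R₂ x) :
    ∃ q : (S₁.deleteEdges D).Walk u w, q.length = p.length := by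
  induction p with
  | nil => exact ⟨.nil, rfl⟩
  | @cons u v w h p ih =>
    obtain ⟨q, hq⟩ := ih fun x hx => hp x (by simp [hx])
    have hu : ¬ R₂ u := hp u (by simp)
    rw [deleteEdges_adj] at h
    have : S₁.Adj u v := by
      rcases h.1 with h' | h' | h'
      · exact h'.2.2
      · exact absurd h'.1 hu
      · exact (h1 u v h'.1).2 h'.2.2
    exact ⟨.cons (deleteEdges_adj.2 ⟨this, h.2⟩) q, by simp [hq]⟩

theorem exists_subwalk {G : SimpleGraph V} {u w x y : V} (p : G.Walk u w) (hx : x ∈ p.support)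
    (hy : y ∈ p.support) : ∃ q : G.Walk x y, q.length ≤ p.length := by
  have key : ∀ {x y : V}, x ∈ p.support → (h : x ∈ p.support) → y ∈ (p.dropUntil x h).support →
      ∃ q : G.Walk x y, q.length ≤ p.length := by
    intro x y _ h hy
    refine ⟨(p.dropUntil x h).takeUntil y hy, ?_⟩
    exact ((p.dropUntil x h).length_takeUntil_le_length hy).trans (p.length_dropUntil_le_length h)
  have hsplit := congrArg Walk.support (p.take_spec hx)
  rw [Walk.support_append] at hsplit
  rw [← hsplit, List.mem_append] at hy
  rcases hy with hy | hy
  · refine ⟨((p.takeUntil x hx).dropUntil y hy).reverse, ?_⟩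
    rw [Walk.length_reverse]
    exact ((p.takeUntil x hx).length_dropUntil_le_length hy).trans (p.length_takeUntil_le_length hx)
  · exact key hx hx (List.mem_of_mem_tail hy)

/-- A cycle missing `R₂` lies in `S₁`, a cycle missing `R₁` lies in `S₂`, and a cycle meeting both
contains a walk between them, which is long by `hfar`. -/
theorem NoShort.combine (n1 : S₁.NoShort ℓ) (n2 : S₂.NoShort ℓ)
    (h1 : ∀ u v, ¬ (R₁ u ∧ R₁ v) → (S₁.Adj u v ↔ S.Adj u v))
    (h2 : ∀ u v, ¬ (R₂ u ∧ R₂ v) → (S₂.Adj u v ↔ S.Adj u v))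
    (hfar : ∀ a b, R₁ a → R₂ b → ∀ p : S.Walk a b, ℓ ≤ p.length) :
    (combine S S₁ S₂ R₁ R₂).NoShort ℓ := by
  intro a b hab p
  by_contra hlt
  by_cases hp : (∀ x ∈ p.support, ¬ R₂ x)
  · have hS : S₁.Adj a b := by
      have ha := hp a (by simp)
      rcases hab with h' | h' | h'
      exacts [h'.2.2, absurd h'.1 ha, (h1 a b h'.1).2 h'.2.2]
    obtain ⟨q, hq⟩ := combine_transfer h1 p hp
    have := n1 a b hS q; omega
  by_cases hp' : (∀ x ∈ p.support, ¬ R₁ x)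
  · have hS : S₂.Adj a b := by
      have ha := hp' a (by simp)
      rcases hab with h' | h' | h'
      exacts [absurd h'.1 ha, h'.2.2, (h2 a b h'.2.1).2 h'.2.2]
    have : ∃ q : (S₂.deleteEdges {s(a, b)}).Walk a b, q.length = p.length := by
      clear hlt hp
      revert p
      rw [combine_symm]
      exact fun p hp' => combine_transfer h2 p hp'
    obtain ⟨q, hq⟩ := this
    have := n2 a b hS q; omega
  push Not at hp hp'
  obtain ⟨x, hx, hx2⟩ := hp
  obtain ⟨y, hy, hy1⟩ := hp'
  obtain ⟨q, hq⟩ := exists_subwalk p hy hx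
  have := combine_walk hfar (q.mapLe (deleteEdges_le _)) hy1 hx2
  simp at this; omega

theorem dg_combine (h1 : ∀ u v, ¬ (R₁ u ∧ R₁ v) → (S₁.Adj u v ↔ S.Adj u v))
    (h2 : ∀ u v, ¬ (R₂ u ∧ R₂ v) → (S₂.Adj u v ↔ S.Adj u v)) (hd : ∀ v, ¬ (R₁ v ∧ R₂ v)) (w : V) :
    (R₁ w → (combine S S₁ S₂ R₁ R₂).dg w = S₁.dg w) ∧
    (R₂ w → (combine S S₁ S₂ R₁ R₂).dg w = S₂.dg w) ∧
    (¬ R₁ w → ¬ R₂ w → (combine S S₁ S₂ R₁ R₂).dg w = S.dg w) := by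
  refine ⟨fun h => dg_congr fun v => ?_, fun h => dg_congr fun v => ?_,
    fun h h' => dg_congr fun v => ?_⟩
  · have := h1 w v; have := hd w; have := hd v; simp only [SimpleGraph.combine]; tauto
  · have := h2 w v; have := hd w; have := hd v; simp only [SimpleGraph.combine]; tauto
  · simp only [SimpleGraph.combine]; tauto

end Glue

end LinearForests

/-! ### Components of graphs of maximum degree two and their ends. -/

section Components

variable {V : Type*} [Fintype V]

theorem degree_eq_dg (S : SimpleGraph V) (v : V) : S.degree v = S.dg v := by
  unfold dg; rw [← card_neighborFinset_eq_degree]; congr 1; ext w; simp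

theorem degree_toSimpleGraph {S : SimpleGraph V} (C : S.ConnectedComponent) (v : C) :
    C.toSimpleGraph.degree v = S.dg v := by
  unfold dg
  rw [← card_neighborFinset_eq_degree, ← card_map (Function.Embedding.subtype _)]
  congr 1
  ext w
  simp only [mem_map, mem_neighborFinset, Function.Embedding.subtype_apply, mem_filter, mem_univ,
    true_and]
  constructor
  · rintro ⟨a, ha, rfl⟩; exact ha
  · intro h
    have hv : (v : V) ∈ C.supp := v.2
    exact ⟨⟨w, (C.mem_supp_congr_adj h).1 hv⟩, h, rfl⟩

theorem sum_dg_component {S : SimpleGraph V} (C : S.ConnectedComponent) :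
    ∑ v : C, S.dg v = 2 * Nat.card C.toSimpleGraph.edgeSet := by
  rw [Nat.card_eq_fintype_card, ← edgeFinset_card, ← sum_degrees_eq_twice_card_edges]
  exact sum_congr rfl fun v _ => (degree_toSimpleGraph C v).symm

/-- In a graph of maximum degree two a component has at most two vertices of degree at most one. -/
theorem not_three_ends {S : SimpleGraph V} (hS : ∀ v, S.dg v ≤ 2) {a b c : V}
    (hab : a ≠ b) (hac : a ≠ c) (hbc : b ≠ c) (ha : S.dg a ≤ 1) (hb : S.dg b ≤ 1)
    (hc : S.dg c ≤ 1) (rab : S.Reachable a b) (rac : S.Reachable a c) : False := by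
  set C := S.connectedComponentMk a with hC
  have ma : a ∈ C.supp := rfl
  have mb : b ∈ C.supp := ConnectedComponent.sound rab.symm
  have mc : c ∈ C.supp := ConnectedComponent.sound rac.symm
  -- Connectedness gives |C| ≤ e + 1, whereas three vertices of degree at most one force 2e ≤ 2|C| -
  -- 3.
  have h1 := C.connected_toSimpleGraph.card_vert_le_card_edgeSet_add_one
  have h2 := sum_dg_component C
  let f : C → ℕ := fun v => (if (v : V) = a then 1 else 0) + (if (v : V) = b then 1 else 0) +
    (if (v : V) = c then 1 else 0)
  have h3 : ∑ v : C, (S.dg v + f v) ≤ ∑ v : C, 2 := by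
    refine sum_le_sum fun v _ => ?_
    have := hS v
    simp only [f]
    split_ifs <;> grind
  have h4 : ∀ d : V, d ∈ C.supp → ∑ v : C, (if (v : V) = d then 1 else 0) = 1 := by
    intro d hd
    rw [sum_eq_single (⟨d, hd⟩ : C)]
    · simp
    · intro v _ hv
      rw [if_neg]; intro h; exact hv (Subtype.ext h)
    · simp
  have h5 : ∑ v : C, f v = 3 := by
    simp only [f, sum_add_distrib]
    rw [h4 a ma, h4 b mb, h4 c mc]
  rw [sum_add_distrib, h5, h2, sum_const, card_univ, ← Nat.card_eq_fintype_card] at h3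
  simp only [smul_eq_mul] at h3
  omega

/-- If all degrees in a component are at least two, it has at least as many edges as vertices and is
not a tree. -/
theorem exists_reachable_dg_le_one {S : SimpleGraph V} (hS : S.IsAcyclic) (u : V) :
    ∃ w, S.Reachable u w ∧ S.dg w ≤ 1 := by
  by_contra! hcon
  set C := S.connectedComponentMk u with hC
  have hT : C.toSimpleGraph.IsTree := ⟨C.connected_toSimpleGraph, hS.induce _⟩
  have h1 := (isTree_iff_connected_and_card.1 hT).2
  have h2 := sum_dg_component C
  have h3 : ∑ v : C, 2 ≤ ∑ v : C, S.dg v := by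
    refine sum_le_sum fun v _ => ?_
    exact hcon v (ConnectedComponent.exact (show S.connectedComponentMk u = _ from v.2.symm))
  rw [h2, sum_const, card_univ, ← Nat.card_eq_fintype_card] at h3
  simp only [smul_eq_mul] at h3
  omega

/-- The handshake lemma inside the component of `u`. -/
theorem exists_reachable_odd {S : SimpleGraph V} {u : V} (hu : Odd (S.dg u)) :
    ∃ w, w ≠ u ∧ S.Reachable u w ∧ Odd (S.dg w) := by
  set C := S.connectedComponentMk u with hC
  obtain ⟨w, hw, ho⟩ := C.toSimpleGraph.exists_ne_odd_degree_of_exists_odd_degree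
    ⟨u, rfl⟩ (by rw [degree_toSimpleGraph]; exact hu)
  rw [degree_toSimpleGraph] at ho
  exact ⟨w, fun h => hw (Subtype.ext h),
    ConnectedComponent.exact (show S.connectedComponentMk u = _ from w.2.symm), ho⟩

theorem even_card_odd_dg (S : SimpleGraph V) : Even (univ.filter fun v => Odd (S.dg v)).card := by
  have := S.even_card_odd_degree_vertices
  simpa only [degree_eq_dg] using this

/-- A vertex `x` has an edge `xy` separating it from the free vertex `s`. -/
theorem exists_separating_edge {S : SimpleGraph V} (hS : ∀ v, S.dg v ≤ 2) {s x : V} (hsx : s ≠ x)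
    (hs : S.dg s ≤ 1) (hx : 0 < S.dg x) : ∃ y, S.Adj x y ∧ ¬ (S.delE x y).Reachable s x := by
  by_contra! hcon
  obtain ⟨y, hy⟩ := dg_pos.1 hx
  have hxy := S.ne_of_adj hy
  have hd := dg_delE hy
  have hmax : ∀ v, (S.delE x y).dg v ≤ 2 := fun v => (dg_mono delE_le v).trans (hS v)
  have hr := hcon y hy
  have dx := hd x; have dy := hd y; have ds := hd s
  have sx := hS x; have sy := hS y
  simp only [if_true, if_neg hxy, if_neg hxy.symm] at dx dy
  have hys : y ≠ s := by
    rintro rfl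
    have : (S.delE x y).dg y = 0 := by omega
    obtain ⟨p⟩ := hr
    cases p with
    | nil => exact hsx rfl
    | cons h _ => have := dg_pos.2 ⟨_, h⟩; omega
  -- Suppose `s` reaches `x` but not `y` once `xy` is gone. Then it arrives through another edge
  -- `zx`. With that edge deleted instead, a walk from `s` must enter `x` from `y`, since `x` has no
  -- third neighbour, and so `s` reaches `y` after all.
  have hry : (S.delE x y).Reachable s y := by
    by_contra hny
    obtain ⟨p⟩ := hr.symm
    cases p with
    | nil => exact absurd rfl hsx
    | @cons _ z _ h q =>
      have hz : S.Adj x z := delE_le h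
      have hzy : z ≠ y := by rintro rfl; exact (delE_adj.1 h).2 (.inl ⟨rfl, rfl⟩)
      obtain ⟨r⟩ := hcon z hz
      have hr' : ∀ {a b : V} (r : (S.delE x z).Walk a b), b = x → (S.delE x y).Reachable s a →
          a ≠ x → False := by
        intro a b r
        induction r with
        | nil => intro h1 _ h2; exact h2 h1
        | @cons a a' b h r ih =>
          intro hb ha hax
          by_cases h' : a' = x
          · subst h'
            have haS := delE_adj.1 h
            have : a ≠ z := by rintro rfl; exact haS.2 (.inr ⟨rfl, rfl⟩)
            have haz : a ≠ y := by rintro rfl; exact hny ha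
            have : 3 ≤ S.dg a' := by
              unfold dg
              calc 3 = ({a, z, y} : Finset V).card := by
                    rw [card_insert_of_notMem, card_insert_of_notMem] <;> simp <;> grind
                _ ≤ _ := card_le_card (by
                    intro t ht; simp at ht ⊢
                    rcases ht with rfl | rfl | rfl
                    exacts [haS.1.symm, hz, hy])
            have := hS a'; omega
          · refine ih hb (ha.trans (Adj.reachable ?_)) h'
            rw [delE_adj]; exact ⟨delE_le h, by grind⟩
      exact hr' r rfl (Reachable.refl _) hsx
  have hxs : (S.delE x y).dg s ≤ 1 := (dg_mono delE_le s).trans hs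
  -- Without `xy` the three vertices `s`, `x`, `y` have degree at most one and share a component.
  exact not_three_ends hmax hsx (Ne.symm hys) hxy hxs (by omega) (by omega) hr hry

end Components

/-! ### Rotations and the expansion of the set of reachable ends. -/

section Rotations

variable {V : Type*} [Fintype V]

/-- `Rot G S A E i S' s v`: the graph `S'` with free end `s` is obtained from `S` with free end
`v ∈ A` by `i` rotations along edges of `G`, each deleting an edge `xy` of `S` with `E x y` that
separates `x` from the current end. -/
inductive Rot (G S : SimpleGraph V) (A : V → Prop) (E : V → V → Prop) :
    ℕ → SimpleGraph V → V → V → Prop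
  | base (v : V) (hv : A v) : Rot G S A E 0 S v v
  | step {i : ℕ} {S' : SimpleGraph V} {s v x y : V} (h : Rot G S A E i S' s v) (hsx : G.Adj s x)
      (hxy : S.Adj x y) (hxy' : S'.Adj x y) (hE : E x y) (hsep : ¬ (S'.delE x y).Reachable s x) :
      Rot G S A E (i + 1) ((S'.delE x y).addE s x) y v

variable {G S : SimpleGraph V} {A : V → Prop} {E : V → V → Prop}

theorem Rot.mono {A' : V → Prop} {E' : V → V → Prop} (hA : ∀ v, A v → A' v)
    (hE : ∀ x y, E x y → E' x y) {i : ℕ} {S' : SimpleGraph V} {s v : V}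
    (h : Rot G S A E i S' s v) : Rot G S A' E' i S' s v := by
  induction h with
  | base v hv => exact .base v (hA v hv)
  | step h hsx hxy hxy' h' hsep ih => exact .step ih hsx hxy hxy' (hE _ _ h') hsep

theorem Rot.root {i : ℕ} {S' : SimpleGraph V} {s v : V} (h : Rot G S A E i S' s v) : A v := by
  induction h <;> assumption

theorem Rot.le {i : ℕ} {S' : SimpleGraph V} {s v : V} (h : Rot G S A E i S' s v) (hS : S ≤ G) :
    S' ≤ G := by
  induction h with
  | base v hv => exact hS
  | step h hsx hxy hxy' h' hsep ih =>
    intro a b hab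
    rcases addE_adj.1 hab with h1 | ⟨_, ⟨rfl, rfl⟩ | ⟨rfl, rfl⟩⟩
    exacts [ih (delE_le h1), hsx, hsx.symm]

/-- The added edge joins two components of the graph left after the deletion, so it closes no cycle.
-/
theorem Rot.noShort {ℓ i : ℕ} {S' : SimpleGraph V} {s v : V} (h : Rot G S A E i S' s v)
    (hS : S.NoShort ℓ) : S'.NoShort ℓ := by
  induction h with
  | base v hv => exact hS
  | step h hsx hxy hxy' h' hsep ih =>
    exact (ih.mono delE_le).addE fun p => absurd p.reachable hsep

/-- Rotations only transport one unit of missing degree, from `v` to the current end `s`. -/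
theorem Rot.dg_eq {i : ℕ} {S' : SimpleGraph V} {s v : V} (h : Rot G S A E i S' s v) (w : V) :
    S'.dg w + (if w = s then 1 else 0) = S.dg w + (if w = v then 1 else 0) := by
  induction h with
  | base v hv => rfl
  | @step i S' s v x y h hsx hxy hxy' h' hsep ih =>
    rw [← ih]
    have h1 := dg_delE hxy' w
    have h2 := dg_addE (S := S'.delE x y) (G.ne_of_adj hsx)
      (fun h => hsep h.reachable) w
    omega

theorem Rot.dg_le {i : ℕ} {S' : SimpleGraph V} {s v : V} (h : Rot G S A E i S' s v)
    (hS : ∀ w, S.dg w ≤ 2) (hA : ∀ w, A w → S.dg w ≤ 1) :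
    (∀ w, S'.dg w ≤ 2) ∧ S'.dg s ≤ 1 := by
  have hv := hA v h.root
  constructor
  · intro w
    have h1 := h.dg_eq w; have h2 := hS w
    by_cases hw : w = v
    · subst hw; rw [if_pos rfl] at h1; omega
    · rw [if_neg hw] at h1; omega
  · have h1 := h.dg_eq s; have h2 := hS s
    rw [if_pos rfl] at h1
    by_cases hw : s = v
    · subst hw; rw [if_pos rfl] at h1; omega
    · rw [if_neg hw] at h1; omega

/-- All changes made by `i` rotations take place inside a set of at most `2 * i + 1` vertices. -/
theorem Rot.local {i : ℕ} {S' : SimpleGraph V} {s v : V} (h : Rot G S A E i S' s v)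
    {R : V → Prop} (hA : ∀ w, A w → R w) (hE : ∀ x y, E x y → R x ∧ R y) :
    ∃ K : Finset V, K.card ≤ 2 * i + 1 ∧ v ∈ K ∧ s ∈ K ∧
      (∀ u ∈ K, u = v ∨ ∃ w, E u w ∨ E w u) ∧ (∀ u ∈ K, R u) ∧
      ∀ a b, ¬ (a ∈ K ∧ b ∈ K) → (S'.Adj a b ↔ S.Adj a b) := by
  induction h with
  | base v hv => exact ⟨{v}, by simp, by simp, by simp, by simp, by simpa using hA v hv, by simp⟩
  | @step i S' s v x y h hsx hxy hxy' h' hsep ih =>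
    obtain ⟨K, hK, hv, hs, hKE, hR, hadj⟩ := ih
    refine ⟨insert x (insert y K), ?_, by simp [hv], by simp, ?_, ?_, ?_⟩
    · have := card_insert_le x (insert y K); have := card_insert_le y K; omega
    · intro u hu
      rcases mem_insert.1 hu with rfl | hu
      · exact .inr ⟨y, .inl h'⟩
      · rcases mem_insert.1 hu with rfl | hu
        · exact .inr ⟨x, .inr h'⟩
        · exact hKE u hu
    · intro u hu
      rcases mem_insert.1 hu with rfl | hu
      · exact (hE _ _ h').1
      · rcases mem_insert.1 hu with rfl | hu
        · exact (hE _ _ h').2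
        · exact hR u hu
    · intro a b hab
      rw [← hadj a b (fun h => hab ⟨by simp [h.1], by simp [h.2]⟩), addE_adj, delE_adj]
      simp only [mem_insert] at hab
      grind

/-- The ends reachable by at most `i` rotations. -/
noncomputable def rotEnds (G S : SimpleGraph V) (A : V → Prop) (E : V → V → Prop) (i : ℕ) :
    Finset V := univ.filter fun s => ∃ j ≤ i, ∃ S' v, Rot G S A E j S' s v

/-- The ends reachable by rotations. -/
noncomputable def allEnds (G S : SimpleGraph V) (A : V → Prop) (E : V → V → Prop) :
    Finset V := univ.filter fun s => ∃ j, ∃ S' v, Rot G S A E j S' s v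

theorem mem_rotEnds {i : ℕ} {s : V} :
    s ∈ rotEnds G S A E i ↔ ∃ j ≤ i, ∃ S' v, Rot G S A E j S' s v := by simp [rotEnds]

theorem mem_allEnds {s : V} : s ∈ allEnds G S A E ↔ ∃ j, ∃ S' v, Rot G S A E j S' s v := by
  simp [allEnds]

theorem allEnds_mono {A' : V → Prop} {E' : V → V → Prop} (hA : ∀ v, A v → A' v)
    (hE : ∀ x y, E x y → E' x y) : allEnds G S A E ⊆ allEnds G S A' E' := by
  intro s hs
  obtain ⟨j, S', v, h⟩ := mem_allEnds.1 hs
  exact mem_allEnds.2 ⟨j, S', v, h.mono hA hE⟩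

theorem rotEnds_subset {i : ℕ} : rotEnds G S A E i ⊆ rotEnds G S A E (i + 1) := by
  intro s hs
  obtain ⟨j, hj, h⟩ := mem_rotEnds.1 hs
  exact mem_rotEnds.2 ⟨j, by omega, h⟩

/-- A rotation changes edges only at the old end, the new end and the pivot. The pivot is an
`S`-neighbour of the new end because deleted edges are required to belong to the original `S`. -/
theorem Rot.adj_iff_of_far {i : ℕ} {S' : SimpleGraph V} {s v x : V} (h : Rot G S A E i S' s v)
    (hx : ∀ t ∈ rotEnds G S A E i, x ≠ t ∧ ¬ S.Adj x t) (w : V) :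
    S'.Adj x w ↔ S.Adj x w := by
  induction h with
  | base v hv => rfl
  | @step i S' s v x' y h hsx hxy hxy' h' hsep ih =>
    rw [← ih fun t ht => hx t (rotEnds_subset ht)]
    have h1 := hx s (mem_rotEnds.2 ⟨i, by omega, S', v, h⟩)
    have h2 := hx y (mem_rotEnds.2 ⟨i + 1, le_rfl, _, v, h.step hsx hxy hxy' h' hsep⟩)
    have h3 : x ≠ x' := by rintro rfl; exact h2.2 hxy
    rw [addE_adj, delE_adj]
    grind

/-- The vertices at distance at most one from `Z` in a graph of maximum degree two. -/
noncomputable def nearS (S : SimpleGraph V) (Z : Finset V) : Finset V :=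
  Z ∪ univ.filter fun x => ∃ t ∈ Z, S.Adj t x

theorem card_nearS_le (hS : ∀ v, S.dg v ≤ 2) (Z : Finset V) : (nearS S Z).card ≤ 3 * Z.card := by
  have h1 : (univ.filter fun x => ∃ t ∈ Z, S.Adj t x) = Z.biUnion fun t => univ.filter (S.Adj t) := by
    ext x; simp
  have h2 : (Z.biUnion fun t => univ.filter (S.Adj t)).card ≤ Z.card * 2 :=
    card_biUnion_le_card_mul _ _ _ fun t _ => hS t
  unfold nearS
  rw [h1]
  have := card_union_le Z (Z.biUnion fun t => univ.filter (S.Adj t))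
  omega

/-- A pivot all of whose edges may be deleted is close to a new end. -/
theorem mem_nearS_rotEnds (hS : ∀ v, S.dg v ≤ 2) (hA : ∀ w, A w → S.dg w ≤ 1) {i : ℕ} {s x : V}
    (hs : s ∈ rotEnds G S A E i) (hsx : G.Adj s x) (hx : 0 < S.dg x)
    (hE : ∀ y, S.Adj x y → E x y) : x ∈ nearS S (rotEnds G S A E (i + 1)) := by
  by_contra hcon
  have hfar : ∀ t ∈ rotEnds G S A E (i + 1), x ≠ t ∧ ¬ S.Adj x t := by
    intro t ht
    constructor
    · rintro rfl; exact hcon (mem_union_left _ ht)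
    · intro h; exact hcon (mem_union_right _ (by simp; exact ⟨t, ht, h.symm⟩))
  obtain ⟨j, hj, S', v, h⟩ := mem_rotEnds.1 hs
  -- Far from all ends, `x` still has its original edges, so a rotation with pivot `x` turns one of
  -- its `S`-neighbours into a new end. Then `x` was not far.
  have hadj := h.adj_iff_of_far (x := x) fun t ht => hfar t (by
    obtain ⟨j', hj', h'⟩ := mem_rotEnds.1 ht
    exact mem_rotEnds.2 ⟨j', by omega, h'⟩)
  obtain ⟨d1, d2⟩ := h.dg_le hS hA
  obtain ⟨y, hy, hsep⟩ := exists_separating_edge d1 (G.ne_of_adj hsx) d2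
    (by rw [dg_congr hadj]; exact hx)
  have hy' := (hadj y).1 hy
  have h' := h.step hsx hy' hy (hE y hy') hsep
  exact (hfar y (mem_rotEnds.2 ⟨j + 1, by omega, _, v, h'⟩)).2 hy'

theorem mem_nearS_allEnds (hS : ∀ v, S.dg v ≤ 2) (hA : ∀ w, A w → S.dg w ≤ 1) {s x : V}
    (hs : s ∈ allEnds G S A E) (hsx : G.Adj s x) (hx : 0 < S.dg x)
    (hE : ∀ y, S.Adj x y → E x y) : x ∈ nearS S (allEnds G S A E) := by
  obtain ⟨j, h⟩ := mem_allEnds.1 hs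
  have := mem_nearS_rotEnds hS hA (mem_rotEnds.2 ⟨j, le_rfl, h⟩) hsx hx hE
  have hsub : rotEnds G S A E (j + 1) ⊆ allEnds G S A E := by
    intro s hs
    obtain ⟨j, hj, h⟩ := mem_rotEnds.1 hs
    exact mem_allEnds.2 ⟨j, h⟩
  simp only [nearS, mem_union, mem_filter, mem_univ, true_and] at this ⊢
  rcases this with h | ⟨t, ht, h⟩
  · exact .inl (hsub h)
  · exact .inr ⟨t, hsub ht, h⟩

/-- Two rotated graphs with distant supports can be joined through an edge between their ends. -/
theorem exists_join {ℓ : ℕ} (hS : S ≤ G) (hn : S.NoShort ℓ) (hℓ : 2 ≤ ℓ) {R₁ R₂ : V → Prop}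
    {S₁ S₂ : SimpleGraph V} {i₁ i₂ : ℕ} {A₁ A₂ : V → Prop} {E₁ E₂ : V → V → Prop} {s₁ v₁ s₂ v₂ : V}
    (r₁ : Rot G S A₁ E₁ i₁ S₁ s₁ v₁) (r₂ : Rot G S A₂ E₂ i₂ S₂ s₂ v₂)
    (k₁ : R₁ s₁) (k₂ : R₂ s₂) (w₁ : R₁ v₁) (w₂ : R₂ v₂)
    (h1 : ∀ u v, ¬ (R₁ u ∧ R₁ v) → (S₁.Adj u v ↔ S.Adj u v))
    (h2 : ∀ u v, ¬ (R₂ u ∧ R₂ v) → (S₂.Adj u v ↔ S.Adj u v))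
    (hfar : ∀ a b, R₁ a → R₂ b → ∀ p : S.Walk a b, ℓ ≤ p.length) (hadj : G.Adj s₁ s₂) :
    ∃ T : SimpleGraph V, T ≤ G ∧ T.NoShort ℓ ∧
      (∀ w, T.dg w = S.dg w + (if w = v₁ then 1 else 0) + (if w = v₂ then 1 else 0)) ∧
      ∀ a b, ¬ ((R₁ a ∨ R₂ a) ∧ (R₁ b ∨ R₂ b)) → (T.Adj a b ↔ S.Adj a b) := by
  have hd : ∀ v, ¬ (R₁ v ∧ R₂ v) := fun v hv => by
    have := hfar v v hv.1 hv.2 .nil; simp at this; omega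
  have hc := (r₁.noShort hn).combine (r₂.noShort hn) h1 h2 hfar
  have hna : ¬ (combine S S₁ S₂ R₁ R₂).Adj s₁ s₂ := by
    rintro (h | h | h)
    · exact hd s₂ ⟨h.2.1, k₂⟩
    · exact hd s₁ ⟨k₁, h.1⟩
    · have h3 := hfar s₁ s₂ k₁ k₂ (.cons h.2.2 .nil)
      simp at h3; omega
  refine ⟨(combine S S₁ S₂ R₁ R₂).addE s₁ s₂, ?_, ?_, ?_, ?_⟩
  · intro a b hab
    rcases addE_adj.1 hab with (h | h | h) | ⟨_, ⟨rfl, rfl⟩ | ⟨rfl, rfl⟩⟩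
    exacts [r₁.le hS h.2.2, r₂.le hS h.2.2, hS h.2.2, hadj, hadj.symm]
  · exact hc.addE fun p => combine_walk hfar p k₁ k₂
  · intro w
    rw [dg_addE (G.ne_of_adj hadj) hna]
    obtain ⟨e1, e2, e3⟩ := dg_combine h1 h2 hd w
    have q1 := r₁.dg_eq w; have q2 := r₂.dg_eq w
    by_cases c1 : R₁ w
    · have : w ≠ s₂ := fun h => hd w ⟨c1, h ▸ k₂⟩
      have : w ≠ v₂ := fun h => hd w ⟨c1, h ▸ w₂⟩
      rw [e1 c1, q1, if_neg ‹w ≠ s₂›, if_neg ‹w ≠ v₂›]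
    · have : w ≠ s₁ := fun h => c1 (h ▸ k₁)
      have : w ≠ v₁ := fun h => c1 (h ▸ w₁)
      by_cases c2 : R₂ w
      · rw [e2 c2]; simp only [*, if_false] at *; omega
      · have : w ≠ s₂ := fun h => c2 (h ▸ k₂)
        have : w ≠ v₂ := fun h => c2 (h ▸ w₂)
        rw [e3 c1 c2]; simp [*]
  · intro a b hab
    rw [addE_adj]
    have n1 : ¬ (R₁ a ∧ R₁ b) := by tauto
    have n2 : ¬ (R₂ a ∧ R₂ b) := by tauto
    have hc : (combine S S₁ S₂ R₁ R₂).Adj a b ↔ S.Adj a b := by simp only [combine]; tauto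
    rw [hc]
    constructor
    · rintro (h | ⟨_, ⟨rfl, rfl⟩ | ⟨rfl, rfl⟩⟩)
      · exact h
      · exact absurd ⟨.inl k₁, .inr k₂⟩ hab
      · exact absurd ⟨.inr k₂, .inl k₁⟩ hab
    · exact .inl

end Rotations

/-! ### Edge boundary of decreasing families in the cube. -/

section Influence

variable {V : Type*} [Fintype V]

/-- For `x = 0` this is the second moment of |s| - 2|χ| over the cube. The shift `x` carries the
induction: a new element changes it by +1 or by -1. -/
theorem sum_powerset_sq (s : Finset V) (x : ℤ) :
    ∑ χ ∈ s.powerset, (x + s.card - 2 * χ.card) ^ 2 = 2 ^ s.card * (x ^ 2 + s.card) := by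
  induction s using Finset.induction_on generalizing x with
  | empty => simp
  | insert a s ha ih =>
    rw [sum_powerset_insert ha]
    have h1 := ih (x + 1)
    have h2 := ih (x - 1)
    have e1 : ∑ χ ∈ s.powerset, (x + (insert a s).card - 2 * χ.card) ^ 2 =
        ∑ χ ∈ s.powerset, (x + 1 + s.card - 2 * χ.card) ^ 2 := by
      refine sum_congr rfl fun χ _ => ?_
      rw [card_insert_of_notMem ha]; push_cast; ring
    have e2 : ∑ χ ∈ s.powerset, (x + (insert a s).card - 2 * (insert a χ).card) ^ 2 =
        ∑ χ ∈ s.powerset, (x - 1 + s.card - 2 * χ.card) ^ 2 := by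
      refine sum_congr rfl fun χ hχ => ?_
      rw [card_insert_of_notMem ha, card_insert_of_notMem fun h => ha (mem_powerset.1 hχ h)]
      push_cast; ring
    rw [e1, e2, h1, h2, card_insert_of_notMem ha]
    push_cast; ring

/-- The number of edges of the cube leaving the family `D` upwards. -/
noncomputable def upBoundary (D : Finset (Finset V)) : ℕ :=
  ∑ χ ∈ D, (univ.filter fun β => β ∉ χ ∧ insert β χ ∉ D).card

/-- Flipping the label of a vertex: the elements of `F χ` with label outside `χ` are, up to the
boundary of `D`, no more numerous on average than those with label in `χ`. -/
theorem sum_flip_le {D : Finset (Finset V)} {F : Finset V → Finset V}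
    (hF : ∀ χ χ', χ ⊆ χ' → F χ ⊆ F χ') {b : V → V} {L : ℕ}
    (hb : ∀ β, (univ.filter fun x => b x = β).card ≤ L) :
    ∑ χ ∈ D, ((F χ).filter fun x => b x ∉ χ).card ≤
      ∑ χ ∈ D, ((F χ).filter fun x => b x ∈ χ).card + L * upBoundary D := by
  have h1 : ∑ χ ∈ D, ((F χ).filter fun x => b x ∉ χ ∧ insert (b x) χ ∈ D).card ≤
      ∑ χ ∈ D, ((F χ).filter fun x => b x ∈ χ).card := by
    rw [← card_sigma, ← card_sigma]
    -- Inserting the label of `x` keeps `x` in `F` by monotonicity. The map is injective because the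
    -- label was absent before.
    refine card_le_card_of_injOn (fun p => ⟨insert (b p.2) p.1, p.2⟩) ?_ ?_
    · rintro ⟨χ, x⟩ h
      simp only [coe_sigma, Set.mem_sigma_iff, mem_coe, mem_filter] at h ⊢
      exact ⟨h.2.2.2, hF _ _ (subset_insert _ _) h.2.1, mem_insert_self _ _⟩
    · rintro ⟨χ, x⟩ h ⟨χ', x'⟩ h' heq
      simp only [coe_sigma, Set.mem_sigma_iff, mem_coe, mem_filter] at h h'
      simp only [Sigma.mk.injEq, heq_eq_eq] at heq
      obtain ⟨h1, rfl⟩ := heq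
      have : χ = χ' := by
        rw [← erase_insert h.2.2.1, ← erase_insert h'.2.2.1, h1]
      rw [this]
  have h2 : ∀ χ ∈ D, ((F χ).filter fun x => b x ∉ χ ∧ insert (b x) χ ∉ D).card ≤
      L * (univ.filter fun β => β ∉ χ ∧ insert β χ ∉ D).card := by
    intro χ _
    refine card_le_mul_card_image_of_maps_to (f := b) ?_ L ?_
    · intro x hx; simp only [mem_filter, mem_univ, true_and] at hx ⊢; exact hx.2
    · intro β _
      exact (card_le_card (filter_subset_filter _ (subset_univ _))).trans (hb β)
  have h3 : ∀ χ ∈ D, ((F χ).filter fun x => b x ∉ χ).card ≤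
      ((F χ).filter fun x => b x ∉ χ ∧ insert (b x) χ ∈ D).card +
      ((F χ).filter fun x => b x ∉ χ ∧ insert (b x) χ ∉ D).card := by
    intro χ _
    rw [← card_union_of_disjoint]
    · refine card_le_card fun x hx => ?_
      simp only [mem_filter, mem_union] at hx ⊢; tauto
    · rw [Finset.disjoint_left]; intro x hx hx'
      simp only [mem_filter] at hx hx'; tauto
  calc _ ≤ _ := sum_le_sum h3
    _ ≤ _ := by
      rw [sum_add_distrib]
      refine add_le_add h1 ?_
      unfold upBoundary
      rw [mul_sum]
      exact sum_le_sum h2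

/-- A downward edge of the cube from a member of `D` stays in `D`, and read upwards it is an inner
edge. Subtracting the inner edges from all upward edges bounds the boundary by the sum of n - 2|χ|
over `D`. -/
theorem upBoundary_add_le {D : Finset (Finset V)} (hD : ∀ χ ∈ D, ∀ χ' ⊆ χ, χ' ∈ D) :
    upBoundary D + ∑ χ ∈ D, χ.card ≤ ∑ χ ∈ D, (univ \ χ).card := by
  have h1 : ∑ χ ∈ D, χ.card ≤ ∑ χ ∈ D, (univ.filter fun β => β ∉ χ ∧ insert β χ ∈ D).card := by
    rw [← card_sigma, ← card_sigma]
    refine card_le_card_of_injOn (fun p => ⟨p.1.erase p.2, p.2⟩) ?_ ?_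
    · rintro ⟨χ, x⟩ h
      simp only [coe_sigma, Set.mem_sigma_iff, mem_coe, mem_filter, mem_univ, true_and] at h ⊢
      refine ⟨hD χ h.1 _ (erase_subset _ _), notMem_erase _ _, ?_⟩
      rw [insert_erase h.2]; exact h.1
    · rintro ⟨χ, x⟩ h ⟨χ', x'⟩ h' heq
      simp only [coe_sigma, Set.mem_sigma_iff, mem_coe] at h h'
      simp only [Sigma.mk.injEq, heq_eq_eq] at heq
      obtain ⟨h1, rfl⟩ := heq
      have : χ = χ' := by rw [← insert_erase h.2, ← insert_erase h'.2, h1]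
      rw [this]
  calc _ ≤ upBoundary D + ∑ χ ∈ D, (univ.filter fun β => β ∉ χ ∧ insert β χ ∈ D).card := by omega
    _ ≤ _ := by
      unfold upBoundary
      rw [← sum_add_distrib]
      refine sum_le_sum fun χ _ => ?_
      rw [← card_union_of_disjoint]
      · refine card_le_card fun x hx => ?_
        simp only [mem_filter, mem_union, mem_sdiff, mem_univ, true_and] at hx ⊢; tauto
      · rw [Finset.disjoint_left]; intro x hx hx'
        simp only [mem_filter] at hx hx'; tauto

/-- The boundary of a decreasing family of at least half of all sets. -/
theorem upBoundary_le {D : Finset (Finset V)} (hD : ∀ χ ∈ D, ∀ χ' ⊆ χ, χ' ∈ D) {r : ℕ}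
    (hr : 2 * Fintype.card V ≤ r ^ 2) (hhalf : 2 ^ Fintype.card V ≤ 2 * D.card) :
    upBoundary D ≤ r * D.card := by
  set n := Fintype.card V with hn
  have h1 := upBoundary_add_le hD
  have h2 : (upBoundary D : ℤ) ≤ ∑ χ ∈ D, ((n : ℤ) - 2 * χ.card) := by
    have e : ∑ χ ∈ D, ((n : ℤ) - 2 * χ.card) =
        ((∑ χ ∈ D, (univ \ χ).card : ℕ) : ℤ) - ((∑ χ ∈ D, χ.card : ℕ) : ℤ) := by
      push_cast
      rw [← sum_sub_distrib]
      refine sum_congr rfl fun χ _ => ?_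
      have := card_sdiff_add_card_eq_card (subset_univ χ)
      rw [card_univ] at this
      omega
    rw [e]; omega
  -- Cauchy–Schwarz over `D`, after which the sum of squares is enlarged to the whole cube.
  have h3 : (∑ χ ∈ D, ((n : ℤ) - 2 * χ.card)) ^ 2 ≤ D.card * (2 ^ n * n) := by
    refine sq_sum_le_card_mul_sum_sq.trans (mul_le_mul_of_nonneg_left ?_ (by positivity))
    have := sum_powerset_sq (univ : Finset V) 0
    simp only [zero_add, card_univ, ← hn] at this
    calc _ ≤ ∑ χ ∈ (univ : Finset V).powerset, ((n : ℤ) - 2 * χ.card) ^ 2 :=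
          sum_le_sum_of_subset_of_nonneg (fun χ _ => by simp) fun _ _ _ => sq_nonneg _
      _ = _ := by rw [this]; ring
  have h4 : (upBoundary D : ℤ) ^ 2 ≤ ((r * D.card : ℕ) : ℤ) ^ 2 := by
    have h5 : ((2 : ℤ) ^ n) ≤ 2 * D.card := by exact_mod_cast hhalf
    have h6 : (2 * (n : ℤ)) ≤ (r : ℤ) ^ 2 := by exact_mod_cast hr
    calc (upBoundary D : ℤ) ^ 2 ≤ (∑ χ ∈ D, ((n : ℤ) - 2 * χ.card)) ^ 2 :=
          pow_le_pow_left₀ (by positivity) h2 2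
      _ ≤ D.card * (2 ^ n * n) := h3
      _ ≤ D.card * ((2 * D.card) * n) := by gcongr
      _ = (D.card : ℤ) ^ 2 * (2 * n) := by ring
      _ ≤ (D.card : ℤ) ^ 2 * r ^ 2 := by gcongr
      _ = _ := by push_cast; ring
  have := (pow_le_pow_iff_left₀ (by positivity) (by positivity) two_ne_zero).1 h4
  exact_mod_cast this

end Influence

/-! ### Cutting a graph of maximum degree two into small blocks. -/

section Blocks

variable {V : Type*} [Fintype V]

/-- The ball of radius `r` around `w` in the subgraph of `S` induced on `W`. -/
noncomputable def ballIn (S : SimpleGraph V) (W : Finset V) (w : V) : ℕ → Finset V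
  | 0 => {w}
  | r + 1 => ballIn S W w r ∪ W.filter fun x => ∃ t ∈ ballIn S W w r, S.Adj t x

variable {S : SimpleGraph V} {W : Finset V} {w : V}

theorem ballIn_mono {r r' : ℕ} (h : r ≤ r') : ballIn S W w r ⊆ ballIn S W w r' := by
  induction h with
  | refl => exact subset_rfl
  | step _ ih => exact ih.trans subset_union_left

theorem ballIn_subset (hw : w ∈ W) (r : ℕ) : ballIn S W w r ⊆ W := by
  induction r with
  | zero => simpa [ballIn] using hw
  | succ r ih => exact union_subset ih (filter_subset _ _)

/-- A vertex of a later layer has a neighbour in the ball before it, which leaves at most one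
neighbour for the next layer. -/
theorem card_layer_le (hS : ∀ v, S.dg v ≤ 2) (r : ℕ) :
    (ballIn S W w (r + 1) \ ballIn S W w r).card ≤ 2 := by
  induction r with
  | zero =>
    refine le_trans (card_le_card (t := univ.filter (S.Adj w)) ?_) (hS w)
    intro x; simp [ballIn]; grind
  | succ r ih =>
    refine le_trans ?_ ih
    set L := ballIn S W w (r + 1) \ ballIn S W w r with hL
    have hsub : ballIn S W w (r + 2) \ ballIn S W w (r + 1) ⊆
        L.biUnion fun t => (univ.filter (S.Adj t)) \ ballIn S W w (r + 1) := by
      intro x hx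
      rw [mem_sdiff] at hx
      have hx1 := hx.1
      rw [ballIn, mem_union, mem_filter] at hx1
      rcases hx1 with h | ⟨hxW, t, ht, hadj⟩
      · exact absurd h hx.2
      · rw [mem_biUnion]
        refine ⟨t, mem_sdiff.2 ⟨ht, fun h => hx.2 ?_⟩, by simp [hadj, hx.2]⟩
        rw [ballIn, mem_union, mem_filter]
        exact .inr ⟨hxW, t, h, hadj⟩
    refine (card_le_card hsub).trans ((card_biUnion_le_card_mul _ _ 1 fun t ht => ?_).trans (by simp))
    rw [hL, mem_sdiff] at ht
    have ht1 := ht.1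
    rw [ballIn, mem_union, mem_filter] at ht1
    rcases ht1 with h | ⟨_, t', ht', hadj⟩
    · exact absurd h ht.2
    · have h1 := hS t
      have h2 : (univ.filter (S.Adj t)) \ ballIn S W w (r + 1) ⊆ (univ.filter (S.Adj t)).erase t' := by
        intro x hx
        rw [mem_sdiff] at hx
        refine mem_erase.2 ⟨?_, hx.1⟩
        rintro rfl
        exact hx.2 (ballIn_mono (Nat.le_succ r) ht')
      have h3 := card_le_card h2
      rw [card_erase_of_mem (by simpa using hadj.symm)] at h3
      unfold dg at h1; omega

theorem card_ballIn_diff_le (hS : ∀ v, S.dg v ≤ 2) (r d : ℕ) :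
    (ballIn S W w (r + d) \ ballIn S W w r).card ≤ 2 * d := by
  induction d with
  | zero => simp
  | succ d ih =>
    have h1 := card_layer_le (W := W) (w := w) hS (r + d)
    have : ballIn S W w (r + (d + 1)) \ ballIn S W w r ⊆
        (ballIn S W w (r + d + 1) \ ballIn S W w (r + d)) ∪ (ballIn S W w (r + d) \ ballIn S W w r) := by
      intro x; simp only [mem_sdiff, mem_union, ← add_assoc]; tauto
    have := (card_le_card this).trans (card_union_le _ _)
    omega

theorem card_ballIn_le (hS : ∀ v, S.dg v ≤ 2) (r : ℕ) : (ballIn S W w r).card ≤ 2 * r + 1 := by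
  have h := card_ballIn_diff_le (W := W) (w := w) hS 0 r
  rw [zero_add] at h
  have : ballIn S W w r ⊆ (ballIn S W w r \ ballIn S W w 0) ∪ {w} := by
    intro x; simp [ballIn]; tauto
  have := (card_le_card this).trans (card_union_le _ _)
  simp at this; omega

/-- A ball that is still growing has gained a vertex at every earlier radius. -/
theorem le_card_ballIn {r : ℕ} (h : ballIn S W w (r + 1) ≠ ballIn S W w r) :
    r + 1 ≤ (ballIn S W w r).card := by
  induction r with
  | zero => simp [ballIn]
  | succ r ih =>
    have hne : ballIn S W w (r + 1) ≠ ballIn S W w r := by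
      intro heq
      apply h
      rw [ballIn, heq]; exact heq
    have h1 := ih hne
    have h2 := card_lt_card (lt_of_le_of_ne (ballIn_mono (Nat.le_succ r)) hne.symm)
    simp only [Nat.succ_eq_add_one] at h2
    omega

theorem ballIn_stable {r d : ℕ} (h : ballIn S W w (r + 1) = ballIn S W w r) :
    ballIn S W w (r + d) = ballIn S W w r := by
  induction d with
  | zero => rfl
  | succ d ih => rw [← add_assoc, ballIn, ih]; exact h

theorem mem_ballIn_of_walk {x y : V} (p : S.Walk x y) (hp : ∀ z ∈ p.support, z ∈ W) {r : ℕ}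
    (hx : x ∈ ballIn S W w r) : y ∈ ballIn S W w (r + p.length) := by
  induction p generalizing r with
  | nil => simpa using hx
  | @cons u v y h p ih =>
    have hv : v ∈ ballIn S W w (r + 1) := by
      rw [ballIn, mem_union, mem_filter]
      exact .inr ⟨hp v (by simp), u, hx, h⟩
    have := ih (fun z hz => hp z (by simp [hz])) hv
    rw [Walk.length_cons, show r + (p.length + 1) = r + 1 + p.length by ring]
    exact this

/-- A partition of the vertices of a graph of maximum degree two into small blocks such that, up to
a small exceptional set `J`, vertices at distance less than `ℓ` lie in the same block. -/
theorem exists_blocks_aux (hS : ∀ v, S.dg v ≤ 2) (ℓ k : ℕ) (W : Finset V) :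
    ∃ (b : V → V) (J : Finset V), J ⊆ W ∧ (∀ x ∈ W, b x ∈ W) ∧ k * J.card ≤ 2 * W.card ∧
      (∀ β, (W.filter fun x => b x = β).card ≤ 2 * (k * ℓ) + 1) ∧
      ∀ p q, p ∉ J → q ∉ J → ∀ c : S.Walk p q, (∀ z ∈ c.support, z ∈ W) → c.length < ℓ →
        b p = b q := by
  induction hN : W.card using Nat.strong_induction_on generalizing W with
  | _ N ih =>
    rcases W.eq_empty_or_nonempty with rfl | ⟨w, hw⟩
    · refine ⟨id, ∅, by simp, by simp, by simp, by simp, ?_⟩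
      intro p q _ _ c hc _
      exact absurd (hc p (by simp)) (by simp)
    set B := ballIn S W w (k * ℓ) with hB
    -- A walk in `W` of length below `ℓ` that starts in `B` and ends outside it ends in this
    -- annulus. The annulus becomes exceptional but stays available for later blocks; only `B` is
    -- cut off.
    set Ann := ballIn S W w (k * ℓ + ℓ) \ B with hAnn
    have hBW : B ⊆ W := ballIn_subset hw _
    have hwB : w ∈ B := ballIn_mono (Nat.zero_le _) (by simp [ballIn])
    have hcard : (W \ B).card + B.card = W.card := card_sdiff_add_card_eq_card hBW
    have hBpos : 0 < B.card := card_pos.2 ⟨w, hwB⟩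
    obtain ⟨b, J, hJW, hbW, hJ, hfib, hwalk⟩ := ih (W \ B).card (by omega) (W \ B) rfl
    have hAnnW : Ann ⊆ W := sdiff_subset.trans (ballIn_subset hw _)
    -- Either the ball has stopped growing and the annulus is empty, or the ball has more than kℓ
    -- vertices against at most 2ℓ in the annulus.
    have hann : k * Ann.card ≤ 2 * B.card := by
      by_cases hst : ballIn S W w (k * ℓ + 1) = ballIn S W w (k * ℓ)
      · have : Ann = ∅ := by rw [hAnn, ballIn_stable hst]; simp [hB]
        simp [this]
      · have h1 := le_card_ballIn hst
        have h2 : Ann.card ≤ 2 * ℓ := card_ballIn_diff_le hS _ _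
        calc k * Ann.card ≤ k * (2 * ℓ) := Nat.mul_le_mul_left _ h2
          _ = 2 * (k * ℓ) := by ring
          _ ≤ 2 * B.card := by rw [hB]; omega
    refine ⟨fun x => if x ∈ B then w else b x, J ∪ Ann, ?_, ?_, ?_, ?_, ?_⟩
    · exact union_subset (hJW.trans sdiff_subset) hAnnW
    · intro x hx
      by_cases h : x ∈ B
      · simp [h, hw]
      · simp only [h, if_false]
        exact (mem_sdiff.1 (hbW x (mem_sdiff.2 ⟨hx, h⟩))).1
    · have := card_union_le J Ann
      calc k * (J ∪ Ann).card ≤ k * (J.card + Ann.card) := Nat.mul_le_mul_left _ this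
        _ = k * J.card + k * Ann.card := by ring
        _ ≤ _ := by omega
    · intro β
      by_cases hβ : β = w
      · refine le_trans (card_le_card (t := B) fun x hx => ?_) (card_ballIn_le hS _)
        simp only [mem_filter] at hx
        by_contra hxB
        rw [if_neg hxB, hβ] at hx
        have := hbW x (mem_sdiff.2 ⟨hx.1, hxB⟩)
        rw [hx.2] at this
        exact (mem_sdiff.1 this).2 hwB
      · refine le_trans (card_le_card fun x hx => ?_) (hfib β)
        simp only [mem_filter] at hx ⊢
        by_cases hxB : x ∈ B
        · rw [if_pos hxB] at hx; exact absurd hx.2.symm hβ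
        · rw [if_neg hxB] at hx; exact ⟨mem_sdiff.2 ⟨hx.1, hxB⟩, hx.2⟩
    · intro p q hp hq c hc hlen
      rw [mem_union, not_or] at hp hq
      have key : ∀ {x y : V} (c : S.Walk x y), (∀ z ∈ c.support, z ∈ W) → c.length < ℓ →
          x ∈ B → y ∉ Ann → y ∈ B := by
        intro x y c hc hl hx hy
        by_contra hyB
        refine hy (mem_sdiff.2 ⟨ballIn_mono ?_ (mem_ballIn_of_walk c hc hx), hyB⟩)
        omega
      by_cases hpB : p ∈ B
      · have := key c hc hlen hpB hq.2
        simp [hpB, this]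
      · have hqB : q ∉ B := fun h => hpB
          (key c.reverse (by simpa using hc) (by simpa using hlen) h hp.2)
        simp only [hpB, hqB, if_false]
        refine hwalk p q hp.1 hq.1 c (fun z hz => mem_sdiff.2 ⟨hc z hz, fun hzB => ?_⟩) hlen
        refine hpB (key (c.takeUntil z hz).reverse ?_ ?_ hzB hp.2)
        · intro t ht
          rw [Walk.support_reverse, List.mem_reverse] at ht
          exact hc t (Walk.support_takeUntil_subset_support _ _ ht)
        · rw [Walk.length_reverse]
          exact lt_of_le_of_lt (c.length_takeUntil_le_length hz) hlen

theorem exists_blocks (hS : ∀ v, S.dg v ≤ 2) (ℓ k : ℕ) :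
    ∃ (b : V → V) (J : Finset V), k * J.card ≤ 2 * Fintype.card V ∧
      (∀ β, (univ.filter fun x => b x = β).card ≤ 2 * (k * ℓ) + 1) ∧
      ∀ p q, p ∉ J → q ∉ J → ∀ c : S.Walk p q, c.length < ℓ → b p = b q := by
  obtain ⟨b, J, _, _, h1, h2, h3⟩ := exists_blocks_aux hS ℓ k univ
  exact ⟨b, J, by simpa using h1, h2, fun p q hp hq c hc => h3 p q hp hq c (by simp) hc⟩

end Blocks

/-! ### Almost spanning linear forests. -/

section LongCycles

variable {V : Type*} [Fintype V]

/-- The set of all neighbours of vertices in `U`. -/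
noncomputable def nbr (G : SimpleGraph V) (U : Finset V) : Finset V :=
  univ.filter fun x => ∃ u ∈ U, G.Adj u x

theorem mem_nbr {G : SimpleGraph V} {U : Finset V} {x : V} :
    x ∈ nbr G U ↔ ∃ u ∈ U, G.Adj u x := by simp [nbr]

theorem nbr_mono {G : SimpleGraph V} {U W : Finset V} (h : U ⊆ W) : nbr G U ⊆ nbr G W := by
  intro x hx
  obtain ⟨u, hu, hx⟩ := mem_nbr.1 hx
  exact mem_nbr.2 ⟨u, h hu, hx⟩

variable {G : SimpleGraph V} {Y : Finset V} {m ℓ k r : ℕ}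

/-- The subgraphs of maximum degree two without short cycles. -/
def LinForest (G : SimpleGraph V) (Y : Finset V) (ℓ : ℕ) (S : SimpleGraph V) : Prop :=
  S ≤ G ∧ (∀ u v, S.Adj u v → u ∈ Y) ∧ (∀ v, S.dg v ≤ 2) ∧ S.NoShort ℓ

theorem exists_max_linForest (G : SimpleGraph V) (Y : Finset V) (ℓ : ℕ) :
    ∃ S, LinForest G Y ℓ S ∧ ∀ T, LinForest G Y ℓ T → ∑ v, T.dg v ≤ ∑ v, S.dg v := by
  obtain ⟨S, hS, hmax⟩ := Set.exists_max_image {S | LinForest G Y ℓ S} (fun S => ∑ v, S.dg v)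
    (Set.toFinite _) ⟨⊥, bot_le, by simp, by simp [dg], by intro a b h; simp at h⟩
  exact ⟨S, hS, hmax⟩

/-- For a set χ of block labels let `Z χ` be the ends reachable by rotations inside these blocks. If
both `Z χ` and `Z χᶜ` had `m` elements, an edge between them would give a subgraph with larger
degree sum, contradicting `hmax`. So the family `D` of all χ with |Z χ| < m is decreasing and
contains one of any two complementary sets. For χ in `D` the neighbours of `Z χ` with label in χ lie
near `Z χ` and number at most 3|Z χ|. By `sum_flip_le` those with label outside χ are on average no
more numerous, up to the boundary of `D`. Expansion by 12 against 3 + 3 makes `Z χ` small on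
average. A second flip shows that, up to the same error, at least half of the unexceptional free
vertices lie in `Z χ` on average. -/
theorem card_free_le (hℓ : 2 ≤ ℓ) (hexp : ∀ U : Finset V, U.card ≤ m → 12 * U.card ≤ (nbr G U ∩ Y).card)
    (hjoin : ∀ U W : Finset V, Disjoint U W → m ≤ U.card → m ≤ W.card →
      ∃ u ∈ U, ∃ w ∈ W, G.Adj u w) (hr : 2 * Fintype.card V ≤ r ^ 2) {S : SimpleGraph V}
    (hS : LinForest G Y ℓ S) (hmax : ∀ T, LinForest G Y ℓ T → ∑ v, T.dg v ≤ ∑ v, S.dg v) :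
    3 * k * (Y.filter fun v => S.dg v ≤ 1).card ≤
      12 * Fintype.card V + 4 * k * (2 * (k * ℓ) + 1) * r := by
  obtain ⟨hSG, hSY, hS2, hSn⟩ := hS
  obtain ⟨b, J, hJ, hfib, hwalk⟩ := exists_blocks hS2 ℓ k
  set L := 2 * (k * ℓ) + 1 with hL
  -- A pivot outside `J'` has all its `S`-neighbours outside `J`, so the pivot and the new end lie
  -- in the same block.
  set J' := nearS S J with hJ'
  have hJ'card : J'.card ≤ 3 * J.card := card_nearS_le hS2 J
  have hJJ' : ∀ x, x ∉ J' → x ∉ J := fun x hx h => hx (mem_union_left _ h)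
  have hJnb : ∀ x y, x ∉ J' → S.Adj x y → y ∉ J := fun x y hx h hy =>
    hx (mem_union_right _ (by simp; exact ⟨y, hy, h.symm⟩))
  have hbadj : ∀ x y, x ∉ J' → S.Adj x y → b x = b y := fun x y hx h =>
    hwalk x y (hJJ' x hx) (hJnb x y hx h) (.cons h .nil) (by simp; omega)
  set E₀ := (Y.filter fun v => S.dg v ≤ 1) \ J with hE₀
  let A : Finset V → V → Prop := fun χ v => v ∈ E₀ ∧ b v ∈ χ
  let E : Finset V → V → V → Prop := fun χ x y => S.Adj x y ∧ x ∉ J' ∧ b x ∈ χ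
  let Z : Finset V → Finset V := fun χ => allEnds G S (A χ) (E χ)
  let R : Finset V → V → Prop := fun χ v => v ∉ J ∧ b v ∈ χ
  have hAR : ∀ χ v, A χ v → R χ v := fun χ v h => ⟨(mem_sdiff.1 h.1).2, h.2⟩
  have hER : ∀ χ x y, E χ x y → R χ x ∧ R χ y := fun χ x y h =>
    ⟨⟨hJJ' x h.2.1, h.2.2⟩, hJnb x y h.2.1 h.1, (hbadj x y h.2.1 h.1) ▸ h.2.2⟩
  have hA1 : ∀ χ v, A χ v → S.dg v ≤ 1 := fun χ v h =>
    (mem_filter.1 (mem_sdiff.1 h.1).1).2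
  have hAY : ∀ χ v, A χ v → v ∈ Y := fun χ v h => (mem_filter.1 (mem_sdiff.1 h.1).1).1
  have hZmono : ∀ χ χ', χ ⊆ χ' → Z χ ⊆ Z χ' := fun χ χ' h =>
    allEnds_mono (fun v hv => ⟨hv.1, h hv.2⟩) (fun x y hxy => ⟨hxy.1, hxy.2.1, h hxy.2.2⟩)
  set D : Finset (Finset V) := univ.filter fun χ => (Z χ).card < m with hDdef
  have hDdown : ∀ χ ∈ D, ∀ χ' ⊆ χ, χ' ∈ D := by
    intro χ hχ χ' hsub
    rw [hDdef, mem_filter] at hχ ⊢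
    exact ⟨mem_univ _, lt_of_le_of_lt (card_le_card (hZmono _ _ hsub)) hχ.2⟩
  have hcompl : ∀ χ, χ ∈ D ∨ χᶜ ∈ D := by
    intro χ
    by_contra! hcon
    simp only [hDdef, mem_filter, mem_univ, true_and, not_lt] at hcon
    have loc : ∀ χ s, s ∈ Z χ → ∃ i S' v, Rot G S (A χ) (E χ) i S' s v ∧ R χ s ∧ R χ v ∧
        ∀ u w, ¬ (R χ u ∧ R χ w) → (S'.Adj u w ↔ S.Adj u w) := by
      intro χ s hs
      obtain ⟨i, S', v, h⟩ := mem_allEnds.1 hs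
      obtain ⟨K, _, hvK, hsK, _, hKR, hK⟩ := h.local (hAR χ) (hER χ)
      exact ⟨i, S', v, h, hKR s hsK, hKR v hvK, fun u w hn => hK u w fun hk =>
        hn ⟨hKR u hk.1, hKR w hk.2⟩⟩
    have hfar : ∀ a c, R χ a → R χᶜ c → ∀ p : S.Walk a c, ℓ ≤ p.length := by
      intro a c ha hc p
      by_contra! hlt
      have := hwalk a c ha.1 hc.1 p hlt
      have h2 := hc.2
      rw [mem_compl] at h2
      exact h2 (this ▸ ha.2)
    have hdisj : Disjoint (Z χ) (Z χᶜ) := by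
      rw [Finset.disjoint_left]
      intro s h1 h2
      obtain ⟨_, _, _, _, r1, _⟩ := loc χ s h1
      obtain ⟨_, _, _, _, r2, _⟩ := loc χᶜ s h2
      have := hfar s s r1 r2 .nil
      simp at this; omega
    obtain ⟨s₁, h1, s₂, h2, hadj⟩ := hjoin _ _ hdisj hcon.1 hcon.2
    obtain ⟨i₁, S₁, v₁, q₁, rs₁, rv₁, l₁⟩ := loc _ _ h1
    obtain ⟨i₂, S₂, v₂, q₂, rs₂, rv₂, l₂⟩ := loc _ _ h2
    obtain ⟨T, hTG, hTn, hTd, -⟩ := exists_join hSG hSn hℓ q₁ q₂ rs₁ rs₂ rv₁ rv₂ l₁ l₂ hfar hadj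
    have hv12 : v₁ ≠ v₂ := by
      rintro rfl
      have := hfar v₁ v₁ rv₁ rv₂ .nil
      simp at this; omega
    have hTY : ∀ u v, T.Adj u v → u ∈ Y := by
      intro u v huv
      by_contra hu
      have h0 : S.dg u = 0 := by
        by_contra h0
        obtain ⟨w, hw⟩ := dg_pos.1 (Nat.pos_of_ne_zero h0)
        exact hu (hSY _ _ hw)
      have h1 := hTd u
      rw [if_neg (by rintro rfl; exact hu (hAY _ _ q₁.root)),
        if_neg (by rintro rfl; exact hu (hAY _ _ q₂.root)), h0] at h1
      have := dg_pos.2 ⟨v, huv⟩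
      omega
    have hT2 : ∀ v, T.dg v ≤ 2 := by
      intro v
      have e := hTd v; have d1 := hA1 _ _ q₁.root; have d2 := hA1 _ _ q₂.root; have d := hS2 v
      by_cases e1 : v = v₁
      · subst e1; rw [if_pos rfl, if_neg hv12] at e; omega
      · by_cases e2 : v = v₂
        · subst e2; rw [if_pos rfl, if_neg e1] at e; omega
        · rw [if_neg e1, if_neg e2] at e; omega
    have hle := hmax T ⟨hTG, hTY, hT2, hTn⟩
    have : ∑ v, T.dg v = ∑ v, S.dg v + 1 + 1 := by
      simp only [hTd, sum_add_distrib]; simp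
    omega
  have hhalf : 2 ^ Fintype.card V ≤ 2 * D.card := by
    have h1 : (univ : Finset (Finset V)) ⊆ D ∪ D.image (fun χ => χᶜ) := by
      intro χ _
      rw [mem_union, mem_image]
      rcases hcompl χ with h | h
      exacts [.inl h, .inr ⟨χᶜ, h, compl_compl χ⟩]
    have h2 := (card_le_card h1).trans (card_union_le _ _)
    have h3 := card_image_le (s := D) (f := fun χ => χᶜ)
    rw [card_univ, Fintype.card_finset] at h2
    omega
  have hbd := upBoundary_le hDdown hr hhalf
  have hDpos : 0 < D.card := by 
    have := pow_pos (show 0 < 2 by norm_num) (Fintype.card V); omega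
  let F : Finset V → Finset V := fun χ => (nbr G (Z χ) ∩ Y) \ J'
  have hF1 : ∀ χ ∈ D, 12 * (Z χ).card ≤ ((F χ).filter fun x => b x ∉ χ).card +
      ((F χ).filter fun x => b x ∈ χ).card + J'.card := by
    intro χ hχ
    have h1 := hexp (Z χ) (mem_filter.1 hχ).2.le
    have h2 : (nbr G (Z χ) ∩ Y).card ≤ (F χ).card + J'.card := card_le_card_sdiff_add_card
    have h3 := card_filter_add_card_filter_not (s := F χ) (fun x => b x ∈ χ)
    omega
  have hF2 : ∀ χ, ((F χ).filter fun x => b x ∈ χ).card ≤ 3 * (Z χ).card := by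
    intro χ
    refine (card_le_card fun x hx => ?_).trans (card_nearS_le hS2 (Z χ))
    simp only [F, mem_filter, mem_sdiff, mem_inter] at hx
    obtain ⟨⟨⟨hxn, hxY⟩, hxJ⟩, hbx⟩ := hx
    obtain ⟨s, hs, hsx⟩ := mem_nbr.1 hxn
    by_cases h0 : 0 < S.dg x
    · exact mem_nearS_allEnds hS2 (hA1 χ) hs hsx h0 fun y hy => ⟨hy, hxJ, hbx⟩
    -- An isolated vertex with active label is itself an end, without any rotation.
    · refine mem_union_left _ (mem_allEnds.2 ⟨0, S, x, .base x ⟨?_, hbx⟩⟩)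
      rw [hE₀, mem_sdiff, mem_filter]
      exact ⟨⟨hxY, by omega⟩, hJJ' x hxJ⟩
  have hflip1 := sum_flip_le (D := D) (F := F) (b := b) (L := L)
    (fun χ χ' h => sdiff_subset_sdiff (inter_subset_inter (nbr_mono (hZmono _ _ h)) subset_rfl)
      subset_rfl) hfib
  have hflip2 := sum_flip_le (D := D) (F := fun _ => E₀) (b := b) (L := L)
    (fun _ _ _ => subset_rfl) hfib
  have hE1 : ∀ χ, (E₀.filter fun x => b x ∈ χ).card ≤ (Z χ).card := by
    intro χ
    refine card_le_card fun x hx => mem_allEnds.2 ⟨0, S, x, .base x ?_⟩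
    exact mem_filter.1 hx
  have s1 := sum_le_sum hF1
  have s2 := sum_le_sum fun χ (_ : χ ∈ D) => hF2 χ
  have s3 := sum_le_sum fun χ (_ : χ ∈ D) => hE1 χ
  have s4 : D.card * E₀.card = ∑ χ ∈ D, (E₀.filter fun x => b x ∈ χ).card +
      ∑ χ ∈ D, (E₀.filter fun x => b x ∉ χ).card := by
    rw [← sum_add_distrib, ← smul_eq_mul, ← sum_const]
    exact sum_congr rfl fun χ _ => (card_filter_add_card_filter_not _).symm
  simp only [sum_add_distrib, ← mul_sum, sum_const, smul_eq_mul] at s1 s2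
  -- With sums over `D`: `s1`, `s2` and the first flip give 6 ∑|Z| ≤ |D||J'| + L·∂, while `s3`, `s4`
  -- and the second flip give |D||E₀| ≤ 2 ∑|Z| + L·∂. Here ∂ is the boundary of `D`.
  have s5 : 3 * (D.card * E₀.card) ≤ D.card * J'.card + 4 * (L * upBoundary D) := by
    omega
  have s6 : D.card * (3 * E₀.card) ≤ D.card * (J'.card + 4 * L * r) := by
    have := Nat.mul_le_mul_left (4 * L) hbd
    calc _ = 3 * (D.card * E₀.card) := by ring
      _ ≤ D.card * J'.card + 4 * L * (r * D.card) := by linarith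
      _ = _ := by ring
  have s7 := Nat.le_of_mul_le_mul_left s6 hDpos
  have s8 : (Y.filter fun v => S.dg v ≤ 1).card ≤ E₀.card + J.card := card_le_card_sdiff_add_card
  calc 3 * k * (Y.filter fun v => S.dg v ≤ 1).card ≤ k * (6 * J.card + 4 * L * r) := by
        rw [mul_comm 3 k, mul_assoc]; exact Nat.mul_le_mul_left _ (by omega)
    _ = 6 * (k * J.card) + 4 * k * L * r := by ring
    _ ≤ _ := by omega

/-- Removing an edge from every cycle of a graph of maximum degree two with long cycles. -/
theorem exists_acyclic_le {S : SimpleGraph V} (hS : ∀ v, S.dg v ≤ 2) (hn : S.NoShort ℓ) :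
    ∃ F ≤ S, F.IsAcyclic ∧ ℓ * ∑ v, (S.dg v - F.dg v) ≤ 2 * Fintype.card V := by
  obtain ⟨F, -, hFS, hFa, hFr⟩ := exists_isAcyclic_reachable_eq_le_of_le_of_isAcyclic
    (G := S) (H := ⊥) bot_le isAcyclic_bot
  refine ⟨F, hFS, hFa, ?_⟩
  have hF2 : ∀ v, F.dg v ≤ 2 := fun v => (dg_mono hFS v).trans (hS v)
  set D := univ.filter fun v => F.dg v < S.dg v with hD
  have hDx : ∀ x ∈ D, ∃ y, S.Adj x y ∧ ¬ F.Adj x y := by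
    intro x hx
    by_contra! hcon
    have : S.dg x ≤ F.dg x := card_le_card fun y hy => by
      simp only [mem_filter, mem_univ, true_and] at hy ⊢; exact hcon y hy
    have := (mem_filter.1 hx).2; omega
  -- `F` has the components of `S`, so a vertex that lost an edge still has one. It therefore lost
  -- exactly one and is now an end of a path.
  have hpos : ∀ x ∈ D, 0 < F.dg x := by
    intro x hx
    obtain ⟨y, hy, _⟩ := hDx x hx
    have : F.Reachable x y := by rw [hFr]; exact hy.reachable
    obtain ⟨p⟩ := this
    cases p with
    | nil => exact absurd rfl (S.ne_of_adj hy)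
    | cons h _ => exact dg_pos.2 ⟨_, h⟩
  have hsum : ∑ v, (S.dg v - F.dg v) ≤ D.card := by
    rw [hD, card_filter]
    refine sum_le_sum fun v _ => ?_
    have h1 := hS v
    split_ifs with h
    · have := hpos v (mem_filter.2 ⟨mem_univ _, h⟩); omega
    · omega
  -- The path of `F` between the endpoints of a lost edge was closed by that edge to a cycle of `S`,
  -- so it is long. Since each component has at most two such ends, double counting bounds their
  -- number.
  have hbig : ∀ x ∈ D, ℓ ≤ (univ.filter fun u => F.Reachable x u).card := by
    intro x hx
    obtain ⟨y, hy, hny⟩ := hDx x hx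
    have : F.Reachable x y := by rw [hFr]; exact hy.reachable
    obtain ⟨p, hp⟩ := this.exists_isPath
    have hle : F ≤ S.deleteEdges {s(x, y)} := by
      intro a c hac
      rw [deleteEdges_adj]
      refine ⟨hFS hac, fun h => ?_⟩
      simp only [Set.mem_singleton_iff, Sym2.eq_iff] at h
      rcases h with ⟨rfl, rfl⟩ | ⟨rfl, rfl⟩
      exacts [hny hac, hny hac.symm]
    have h1 := hn x y hy (p.mapLe hle)
    rw [Walk.length_mapLe] at h1
    have h2 : p.support.toFinset.card = p.length + 1 := by
      rw [List.toFinset_card_of_nodup hp.support_nodup, Walk.length_support]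
    rw [← h2] at h1
    refine h1.trans (card_le_card fun u hu => ?_)
    rw [List.mem_toFinset] at hu
    simp only [mem_filter, mem_univ, true_and]
    exact ⟨p.takeUntil u hu⟩
  have hcount : ∑ x ∈ D, (univ.filter fun u => F.Reachable x u).card ≤ 2 * Fintype.card V := by
    have := sum_card_bipartiteAbove_eq_sum_card_bipartiteBelow (s := D) (t := univ)
      (fun x u => F.Reachable x u)
    simp only [bipartiteAbove, bipartiteBelow] at this
    rw [this]
    have : ∀ u ∈ (univ : Finset V), (D.filter fun x => F.Reachable x u).card ≤ 2 := by
      intro u _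
      by_contra! hgt
      obtain ⟨a, c, d, ha, hc, hd, hac, had, hcd⟩ := two_lt_card_iff.1 hgt
      rw [mem_filter] at ha hc hd
      have hle : ∀ x ∈ D, F.dg x ≤ 1 := fun x hx => by
        have := (mem_filter.1 hx).2; have := hS x; omega
      exact not_three_ends hF2 hac had hcd (hle a ha.1) (hle c hc.1) (hle d hd.1)
        (ha.2.trans hc.2.symm) (ha.2.trans hd.2.symm)
    refine (sum_le_card_nsmul _ _ _ this).trans ?_
    rw [card_univ, smul_eq_mul, mul_comm]
  calc _ ≤ ℓ * D.card := Nat.mul_le_mul_left _ hsum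
    _ = ∑ x ∈ D, ℓ := by rw [sum_const, smul_eq_mul, mul_comm]
    _ ≤ _ := (sum_le_sum hbig).trans hcount

/-- In a graph with expansion into `Y` almost all of `Y` is covered by a linear forest with few
components. -/
theorem exists_linForest (hk : 2 ≤ k)
    (hexp : ∀ U : Finset V, U.card ≤ m → 12 * U.card ≤ (nbr G U ∩ Y).card)
    (hjoin : ∀ U W : Finset V, Disjoint U W → m ≤ U.card → m ≤ W.card →
      ∃ u ∈ U, ∃ w ∈ W, G.Adj u w) (hr : 2 * Fintype.card V ≤ r ^ 2) :
    ∃ F ≤ G, (∀ u v, F.Adj u v → u ∈ Y) ∧ (∀ v, F.dg v ≤ 2) ∧ F.IsAcyclic ∧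
      3 * k * ∑ v ∈ Y, (2 - F.dg v) ≤ 30 * Fintype.card V + 8 * k * (2 * (k * k) + 1) * r := by
  obtain ⟨S, hS, hmax⟩ := exists_max_linForest G Y k
  have h1 := card_free_le (k := k) hk hexp hjoin hr hS hmax
  obtain ⟨hSG, hSY, hS2, hSn⟩ := hS
  obtain ⟨F, hFS, hFa, hF⟩ := exists_acyclic_le hS2 hSn
  refine ⟨F, hFS.trans hSG, fun u v h => hSY u v (hFS h), fun v => (dg_mono hFS v).trans (hS2 v),
    hFa, ?_⟩
  have h2 : ∑ v ∈ Y, (2 - F.dg v) ≤ 2 * (Y.filter fun v => S.dg v ≤ 1).card +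
      ∑ v, (S.dg v - F.dg v) := by
    calc ∑ v ∈ Y, (2 - F.dg v) ≤ ∑ v ∈ Y, ((if S.dg v ≤ 1 then 2 else 0) + (S.dg v - F.dg v)) := by
          refine sum_le_sum fun v _ => ?_
          have := hS2 v; have := dg_mono hFS v
          split_ifs <;> omega
      _ ≤ _ := by
          rw [sum_add_distrib, card_filter, mul_sum]
          refine add_le_add (sum_le_sum fun v _ => by split_ifs <;> simp) ?_
          exact sum_le_sum_of_subset (subset_univ _)
  calc _ ≤ 3 * k * (2 * (Y.filter fun v => S.dg v ≤ 1).card + ∑ v, (S.dg v - F.dg v)) :=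
        Nat.mul_le_mul_left _ h2
    _ = 2 * (3 * k * (Y.filter fun v => S.dg v ≤ 1).card) + 3 * (k * ∑ v, (S.dg v - F.dg v)) := by
        ring
    _ ≤ 2 * (12 * Fintype.card V + 4 * k * (2 * (k * k) + 1) * r) + 3 * (2 * Fintype.card V) := by
        gcongr
    _ = _ := by ring

end LongCycles

/-! ### Extending embeddings while preserving expansion. -/

section Extension

variable {V : Type*} [Fintype V]

/-- Every small set `U` has enough neighbours outside `X` to serve the demands `c`. -/
def Extendable (G : SimpleGraph V) (m : ℕ) (X : Finset V) (c : V → ℤ) : Prop :=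
  ∀ U : Finset V, U.card ≤ 2 * m → ∑ u ∈ U, c u ≤ ((nbr G U \ X).card : ℤ)

/-- Any two disjoint sets of at least `m` vertices are joined by an edge. -/
def Joined (G : SimpleGraph V) (m : ℕ) : Prop :=
  ∀ U W : Finset V, Disjoint U W → m ≤ U.card → m ≤ W.card → ∃ u ∈ U, ∃ w ∈ W, G.Adj u w

variable {G : SimpleGraph V} {m : ℕ} {X : Finset V} {c : V → ℤ}

/-- The vertices outside `U` and its neighbourhood send no edge to `U`, so there are fewer than `m`
of them. -/
theorem Joined.card_le (h : Joined G m) {U : Finset V} (hU : m ≤ U.card) :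
    Fintype.card V ≤ (nbr G U).card + U.card + m := by
  by_contra! hcon
  have h1 : (univ \ (nbr G U ∪ U)).card + (nbr G U ∪ U).card = Fintype.card V := by
    rw [card_sdiff_add_card_eq_card (subset_univ _), card_univ]
  have h2 := card_union_le (nbr G U) U
  obtain ⟨u, hu, w, hw, huw⟩ := h U (univ \ (nbr G U ∪ U))
    (Finset.disjoint_left.2 fun x hx hx' => by simp [hx] at hx') hU (by omega)
  simp only [mem_sdiff, mem_univ, true_and, mem_union, not_or, mem_nbr] at hw
  exact hw.1 ⟨u, hu, huw⟩

theorem Extendable.anti {X' : Finset V} {c' : V → ℤ} (h : Extendable G m X c) (hX : X' ⊆ X)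
    (hc : ∀ u, c' u ≤ c u) : Extendable G m X' c' := by
  intro U hU
  calc _ ≤ ∑ u ∈ U, c u := sum_le_sum fun u _ => hc u
    _ ≤ _ := h U hU
    _ ≤ _ := by exact_mod_cast card_le_card (sdiff_subset_sdiff subset_rfl hX)

/-- If no neighbour of `s` can be added, each candidate is blocked by a tight set that misses `s`
and sees the candidate. Tight sets are small, and by submodularity the union of two is tight again.
The union of all blockers sees every free neighbour of `s`; adjoining `s` to it raises the demand
but adds no neighbour outside `X`, a contradiction. -/
theorem Extendable.exists_insert (h : Extendable G m X c) (hj : Joined G m) (hm : 0 < m)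
    (hc : ∀ u, c u ≤ 20) {s : V} (hs : 1 ≤ c s) (hX : X.card + 44 * m ≤ Fintype.card V) :
    ∃ y, G.Adj s y ∧ y ∉ X ∧ Extendable G m (insert y X) fun u => c u - if u = s then 1 else 0 := by
  by_contra! hcon
  -- A set of between m and 2m vertices has at least 44m - 3m = 41m neighbours outside `X`, but a
  -- total demand of at most 40m.
  have hslack : ∀ U : Finset V, U.card ≤ 2 * m → ∑ u ∈ U, c u = ((nbr G U \ X).card : ℤ) →
      U.card < m := by
    intro U hU heq
    by_contra! hge
    have h1 := hj.card_le hge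
    have h2 : (nbr G U).card ≤ (nbr G U \ X).card + X.card := card_le_card_sdiff_add_card
    have h3 : ∑ u ∈ U, c u ≤ U.card * 20 := by
      have := sum_le_card_nsmul U c 20 fun u _ => hc u
      simpa using this
    have : (U.card : ℤ) ≤ 2 * m := by exact_mod_cast hU
    have h4 : Fintype.card V ≤ (nbr G U \ X).card + X.card + U.card + m := by omega
    have h5 : ((nbr G U \ X).card : ℤ) ≤ 40 * m := by linarith
    have h6 : (nbr G U \ X).card ≤ 40 * m := by exact_mod_cast h5
    omega
  have hbad : ∀ y, G.Adj s y → y ∉ X → ∃ U : Finset V, U.card < m ∧ s ∉ U ∧ y ∈ nbr G U ∧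
      ∑ u ∈ U, c u = ((nbr G U \ X).card : ℤ) := by
    intro y hy hyX
    have := hcon y hy hyX
    unfold Extendable at this
    push Not at this
    obtain ⟨U, hU, hlt⟩ := this
    rw [sum_sub_distrib, sum_ite_eq'] at hlt
    have h1 := h U hU
    have h2 : (nbr G U \ X).card ≤ (nbr G U \ insert y X).card + if y ∈ nbr G U then 1 else 0 := by
      split_ifs with hyU
      · have : nbr G U \ X ⊆ insert y (nbr G U \ insert y X) := by
          intro x; simp only [mem_sdiff, mem_insert]; tauto
        exact (card_le_card this).trans (card_insert_le _ _)
      · refine card_le_card fun x hx => ?_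
        simp only [mem_sdiff, mem_insert] at hx ⊢
        exact ⟨hx.1, fun h => h.elim (fun h => hyU (h ▸ hx.1)) hx.2⟩
    have h2' : ((nbr G U \ X).card : ℤ) ≤ (nbr G U \ insert y X).card +
        if y ∈ nbr G U then 1 else 0 := by
      split_ifs at h2 ⊢ <;> exact_mod_cast h2
    have hsU : s ∉ U := by
      intro hsU
      rw [if_pos hsU] at hlt
      split_ifs at h2' <;> omega
    have hyU : y ∈ nbr G U := by
      by_contra hyU
      rw [if_neg hyU] at h2'; rw [if_neg hsU] at hlt; omega
    rw [if_pos hyU] at h2'; rw [if_neg hsU] at hlt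
    have heq : ∑ u ∈ U, c u = ((nbr G U \ X).card : ℤ) := by omega
    exact ⟨U, hslack U hU heq, hsU, hyU, heq⟩
  have hall : ∀ Q : Finset V, (∀ y ∈ Q, G.Adj s y ∧ y ∉ X) → ∃ W : Finset V, W.card < m ∧ s ∉ W ∧
      (∀ y ∈ Q, y ∈ nbr G W) ∧ ∑ u ∈ W, c u = ((nbr G W \ X).card : ℤ) := by
    intro Q
    induction Q using Finset.induction_on with
    | empty => exact fun _ => ⟨∅, by simpa using hm, by simp, by simp, by simp [nbr]⟩
    | insert y Q hy ih =>
      intro hQ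
      obtain ⟨W, hW, hsW, hWQ, hWt⟩ := ih fun y hy => hQ y (mem_insert_of_mem hy)
      obtain ⟨U, hU, hsU, hyU, hUt⟩ := hbad y (hQ y (mem_insert_self _ _)).1
        (hQ y (mem_insert_self _ _)).2
      have hcard := card_union_le W U
      have hcard' := card_le_card (inter_subset_left : W ∩ U ⊆ W)
      -- Both sets are below m, so the union is within the range 2m of `Extendable`; being tight, it
      -- is then below m again.
      have g1 := h (W ∪ U) (by omega)
      have g2 := h (W ∩ U) (by omega)
      have g3 := sum_union_inter (s₁ := W) (s₂ := U) (f := c)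
      have g4 : ((nbr G (W ∪ U) \ X).card : ℤ) + (nbr G (W ∩ U) \ X).card ≤
          (nbr G W \ X).card + (nbr G U \ X).card := by
        rw [← Nat.cast_add, ← Nat.cast_add, ← card_union_add_card_inter (nbr G W \ X)]
        have e1 : nbr G (W ∪ U) \ X ⊆ nbr G W \ X ∪ nbr G U \ X := by
          intro x hx
          simp only [mem_sdiff, mem_union, mem_nbr] at hx ⊢
          obtain ⟨⟨u, hu | hu, hux⟩, hxX⟩ := hx
          exacts [.inl ⟨⟨u, hu, hux⟩, hxX⟩, .inr ⟨⟨u, hu, hux⟩, hxX⟩]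
        have e2 : nbr G (W ∩ U) \ X ⊆ (nbr G W \ X) ∩ (nbr G U \ X) := by
          intro x hx
          rw [mem_sdiff] at hx
          exact mem_inter.2 ⟨mem_sdiff.2 ⟨nbr_mono inter_subset_left hx.1, hx.2⟩,
            mem_sdiff.2 ⟨nbr_mono inter_subset_right hx.1, hx.2⟩⟩
        exact_mod_cast add_le_add (card_le_card e1) (card_le_card e2)
      have g5 : ∑ u ∈ W ∪ U, c u = ((nbr G (W ∪ U) \ X).card : ℤ) := by linarith
      refine ⟨W ∪ U, hslack _ (by omega) g5, by simp [hsW, hsU], ?_, g5⟩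
      intro y' hy'
      rcases mem_insert.1 hy' with rfl | hy'
      · exact nbr_mono subset_union_right hyU
      · exact nbr_mono subset_union_left (hWQ y' hy')
  obtain ⟨W, hW, hsW, hWQ, hWt⟩ := hall (univ.filter fun y => G.Adj s y ∧ y ∉ X)
    fun y hy => (mem_filter.1 hy).2
  have g := h (insert s W) ((card_insert_le _ _).trans (by omega))
  rw [sum_insert hsW, hWt] at g
  have : nbr G (insert s W) \ X ⊆ nbr G W \ X := by
    intro x hx
    simp only [mem_sdiff, mem_nbr, mem_insert] at hx
    obtain ⟨⟨u, rfl | hu, hux⟩, hxX⟩ := hx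
    · exact mem_sdiff.2 ⟨hWQ x (by simp [hux, hxX]), hxX⟩
    · exact mem_sdiff.2 ⟨mem_nbr.2 ⟨u, hu, hux⟩, hxX⟩
  have := card_le_card this
  omega

/-- Removing vertices gives back the demands of their parents. -/
theorem Extendable.sdiff (h : Extendable G m X c) {D : Finset V} (hD : D ⊆ X) {par : V → V}
    (hpar : ∀ y ∈ D, G.Adj (par y) y) :
    Extendable G m (X \ D) fun u => c u + (D.filter fun y => par y = u).card := by
  intro U hU
  have h1 := h U hU
  have h2 : ∑ u ∈ U, (D.filter fun y => par y = u).card = (D.filter fun y => par y ∈ U).card := by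
    rw [card_eq_sum_card_fiberwise (s := D.filter fun y => par y ∈ U) (f := par) (t := U)
      (fun y hy => (mem_filter.1 hy).2)]
    refine sum_congr rfl fun u hu => ?_
    rw [filter_filter]
    congr 1
    ext y; simp only [mem_filter]
    grind
  have h3 : (nbr G U \ X).card + (D.filter fun y => par y ∈ U).card ≤
      (nbr G U \ (X \ D)).card := by
    rw [← card_union_of_disjoint]
    · refine card_le_card fun x hx => ?_
      simp only [mem_union, mem_sdiff, mem_filter, mem_nbr] at hx ⊢
      rcases hx with hx | hx
      · exact ⟨hx.1, fun h => hx.2 h.1⟩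
      · exact ⟨⟨par x, hx.2, hpar x hx.1⟩, fun h => h.2 hx.1⟩
    · rw [Finset.disjoint_left]
      intro x hx hx'
      exact (mem_sdiff.1 hx).2 (hD (mem_filter.1 hx').1)
  rw [sum_add_distrib, ← Nat.cast_sum, h2]
  have h3' : ((nbr G U \ X).card : ℤ) + (D.filter fun y => par y ∈ U).card ≤
      (nbr G U \ (X \ D)).card := by exact_mod_cast h3
  linarith

theorem Extendable.exists_children (h : Extendable G m X c) (hj : Joined G m) (hm : 0 < m)
    (hc : ∀ u, c u ≤ 20) (d : V → ℕ) (hd : ∀ u, 0 < d u → (d u : ℤ) ≤ c u)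
    (hX : X.card + ∑ u, d u + 44 * m ≤ Fintype.card V) :
    ∃ (N : Finset V) (par : V → V), Disjoint N X ∧ (∀ y ∈ N, G.Adj (par y) y) ∧
      (∀ u, (N.filter fun y => par y = u).card = d u) ∧
      Extendable G m (X ∪ N) fun u => c u - d u := by
  induction ht : ∑ u, d u generalizing d with
  | zero =>
    have h0 : ∀ u, d u = 0 := by simpa using ht
    exact ⟨∅, id, by simp, by simp, by simp [h0], by simpa [h0] using h⟩
  | succ t ih =>
    obtain ⟨s, hs⟩ : ∃ s, 0 < d s := by
      by_contra! hcon
      have : ∑ u, d u = 0 := sum_eq_zero fun u _ => Nat.le_zero.1 (hcon u)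
      omega
    let d' : V → ℕ := fun u => d u - if u = s then 1 else 0
    have hdd : ∀ u, d' u + (if u = s then 1 else 0) = d u := by
      intro u; simp only [d']; split_ifs with hu
      · subst hu; omega
      · simp
    have hsum : ∑ u, d' u + 1 = ∑ u, d u := by
      rw [← sum_congr rfl fun u _ => hdd u, sum_add_distrib]; simp
    have hle : ∀ u, d' u ≤ d u := fun u => Nat.sub_le _ _
    obtain ⟨N, par, hN, hadj, hcnt, hext⟩ := ih d'
      (fun u hu => by
        have h1 := hd u (lt_of_lt_of_le hu (hle u)); have h2 := hle u; omega)
      (by omega) (by omega)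
    have hNcard : N.card = ∑ u, d' u := by
      rw [card_eq_sum_card_fiberwise (f := par) (t := univ) (fun _ _ => by simp)]
      exact sum_congr rfl fun u _ => hcnt u
    have hXN := card_union_le X N
    obtain ⟨y, hsy, hyX, hext'⟩ := hext.exists_insert hj hm (s := s)
      (fun u => by have := hc u; omega)
      (by have h1 := hd s hs; have h2 := hdd s; rw [if_pos rfl] at h2; omega) (by omega)
    rw [mem_union, not_or] at hyX
    refine ⟨insert y N, Function.update par y s, ?_, ?_, ?_, ?_⟩
    · rw [disjoint_insert_left]; exact ⟨hyX.1, hN⟩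
    · intro z hz
      by_cases hzy : z = y
      · subst hzy; simpa using hsy
      · rw [Function.update_of_ne hzy]; exact hadj z ((mem_insert.1 hz).resolve_left hzy)
    · intro u
      have e : (N.filter fun z => Function.update par y s z = u) = N.filter fun z => par z = u := by
        refine filter_congr fun z hz => ?_
        rw [Function.update_of_ne (by rintro rfl; exact hyX.2 hz)]
      rw [filter_insert, e]
      have h1 := hcnt u; have h2 := hdd u
      by_cases hu : s = u
      · subst hu
        rw [if_pos (by simp), card_insert_of_notMem (by simp [hyX.2]), h1]
        simpa using h2
      · rw [if_neg (by simpa using hu), h1]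
        rw [if_neg (Ne.symm hu)] at h2; exact h2
    · refine hext'.anti (by rw [union_insert]) fun u => ?_
      have h2 := hdd u
      split_ifs at h2 ⊢ <;> omega

end Extension

/-! ### Growing binary trees. -/

section Connecting

variable {V : Type*} [Fintype V] {G : SimpleGraph V} {m : ℕ} {X : Finset V} {c : V → ℤ}

/-- `N` carries a tree of depth `κ` rooted at `a`, described by parents and depths. -/
structure TreeAt (G : SimpleGraph V) (a : V) (κ : ℕ) (N : Finset V) (par : V → V) (dep : V → ℕ) :
    Prop where
  adj : ∀ y ∈ N, G.Adj (par y) y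
  one_le : ∀ y ∈ N, 1 ≤ dep y
  le : ∀ y ∈ N, dep y ≤ κ
  par_one : ∀ y ∈ N, dep y = 1 → par y = a
  par_mem : ∀ y ∈ N, 1 < dep y → par y ∈ N ∧ dep (par y) + 1 = dep y
  root : (N.filter fun y => par y = a).card ≤ 1

/-- The root gets a single child and every later vertex two, so one unit of demand at `a` and two at
each new vertex suffice. Level κ + 1 then has 2^κ vertices. -/
theorem Extendable.exists_tree (h : Extendable G m X c) (hj : Joined G m) (hm : 0 < m)
    (hc : ∀ u, c u ≤ 20) {a : V} (ha : a ∈ X) (hca : 1 ≤ c a) (hcX : ∀ u, u ∉ X → 2 ≤ c u) (κ : ℕ)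
    (hX : X.card + 2 ^ (κ + 1) + 44 * m ≤ Fintype.card V) :
    ∃ (N : Finset V) (par : V → V) (dep : V → ℕ), TreeAt G a (κ + 1) N par dep ∧ Disjoint N X ∧
      (N.filter fun y => dep y = κ + 1).card = 2 ^ κ ∧ N.card < 2 ^ (κ + 1) ∧
      Extendable G m (X ∪ N) fun u => c u - (N.filter fun y => par y = u).card := by
  induction κ with
  | zero =>
    obtain ⟨y, hay, hyX, hext⟩ := h.exists_insert hj hm hc hca (by omega)
    refine ⟨{y}, fun _ => a, fun _ => 1, ⟨by simpa using hay, by simp, by simp, by simp, by simp,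
      by simp [filter_singleton]⟩, by simpa using hyX, by simp, by simp, ?_⟩
    refine hext.anti (by rw [union_comm, insert_eq]) fun u => ?_
    rw [filter_singleton]
    by_cases hu : u = a
    · subst hu; simp
    · simp [hu, Ne.symm hu]
  | succ κ ih =>
    obtain ⟨N, par, dep, hT, hd, hlev, hN, hext⟩ := ih (by
      have : 2 ^ (κ + 1 + 1) = 2 * 2 ^ (κ + 1) := by ring
      omega)
    set Lv := N.filter fun y => dep y = κ + 1 with hLv
    have hcnt : ∀ u ∈ Lv, (N.filter fun y => par y = u).card = 0 := by
      intro u hu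
      rw [card_eq_zero, filter_eq_empty_iff]
      intro y hy hyu
      have h1 := hT.le y hy
      rw [hLv, mem_filter] at hu
      rcases Nat.eq_or_lt_of_le (hT.one_le y hy) with h2 | h2
      · have := hT.par_one y hy h2.symm
        rw [hyu] at this; subst this
        exact (Finset.disjoint_left.1 hd hu.1) ha
      · have := (hT.par_mem y hy h2).2
        rw [hyu, hu.2] at this; omega
    have hpow : 2 ^ (κ + 1 + 1) = 2 * 2 ^ (κ + 1) := by ring
    have hpow' : 2 ^ (κ + 1) = 2 * 2 ^ κ := by ring
    have hcu := card_union_le X N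
    obtain ⟨M, parM, hM, hMadj, hMcnt, hMext⟩ := hext.exists_children hj hm
      (fun u => by have := hc u; omega) (fun u => if u ∈ Lv then 2 else 0)
      (by
        intro u hu
        have huL : u ∈ Lv := by by_contra hn; simp [hn] at hu
        rw [if_pos huL, hcnt u huL]
        have := hcX u fun hx => Finset.disjoint_left.1 hd (mem_filter.1 huL).1 hx
        simpa using this)
      (by
        have : ∑ u, (if u ∈ Lv then 2 else 0) = 2 * 2 ^ κ := by
          rw [← hlev, sum_ite_mem, univ_inter, sum_const, smul_eq_mul, mul_comm]
        rw [this]; omega)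
    rw [disjoint_union_right] at hM
    have hMN : ∀ y ∈ M, y ∉ N := fun y hy hy' => Finset.disjoint_left.1 hM.2 hy hy'
    have hMpar : ∀ y ∈ M, parM y ∈ Lv := by
      intro y hy
      by_contra hn
      have := hMcnt (parM y)
      rw [if_neg hn, card_eq_zero, filter_eq_empty_iff] at this
      exact this hy rfl
    have hMcard : M.card = 2 ^ (κ + 1) := by
      rw [card_eq_sum_card_fiberwise (f := parM) (t := univ) (fun _ _ => by simp),
        sum_congr rfl fun u _ => hMcnt u, sum_ite_mem, univ_inter, sum_const, smul_eq_mul, hlev,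
        mul_comm]
      ring
    let par' : V → V := fun y => if y ∈ N then par y else parM y
    let dep' : V → ℕ := fun y => if y ∈ N then dep y else κ + 2
    have p1 : ∀ y ∈ N, par' y = par y := fun y hy => if_pos hy
    have p2 : ∀ y ∈ M, par' y = parM y := fun y hy => if_neg (hMN y hy)
    have d1 : ∀ y ∈ N, dep' y = dep y := fun y hy => if_pos hy
    have d2 : ∀ y ∈ M, dep' y = κ + 2 := fun y hy => if_neg (hMN y hy)
    have hdisj : Disjoint N M := hM.2.symm
    have hfil : ∀ u, ((N ∪ M).filter fun y => par' y = u).card =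
        (N.filter fun y => par y = u).card + if u ∈ Lv then 2 else 0 := by
      intro u
      rw [filter_union, card_union_of_disjoint (disjoint_filter_filter hdisj),
        filter_congr fun y hy => by rw [p1 y hy], ← hMcnt u]
      congr 2
      exact filter_congr fun y hy => by rw [p2 y hy]
    refine ⟨N ∪ M, par', dep', ⟨?_, ?_, ?_, ?_, ?_, ?_⟩, ?_, ?_, ?_, ?_⟩
    · intro y hy
      rcases mem_union.1 hy with hy | hy
      · rw [p1 y hy]; exact hT.adj y hy
      · rw [p2 y hy]; exact hMadj y hy
    · intro y hy
      rcases mem_union.1 hy with hy | hy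
      · rw [d1 y hy]; exact hT.one_le y hy
      · rw [d2 y hy]; omega
    · intro y hy
      rcases mem_union.1 hy with hy | hy
      · rw [d1 y hy]; have := hT.le y hy; omega
      · rw [d2 y hy]
    · intro y hy h1
      rcases mem_union.1 hy with hy | hy
      · rw [d1 y hy] at h1; rw [p1 y hy]; exact hT.par_one y hy h1
      · rw [d2 y hy] at h1; omega
    · intro y hy h1
      rcases mem_union.1 hy with hy | hy
      · rw [d1 y hy] at h1 ⊢; rw [p1 y hy]
        obtain ⟨q1, q2⟩ := hT.par_mem y hy h1
        rw [d1 _ q1]; exact ⟨mem_union_left _ q1, q2⟩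
      · have := mem_filter.1 (hMpar y hy)
        rw [p2 y hy, d2 y hy, d1 _ this.1, this.2]
        exact ⟨mem_union_left _ this.1, rfl⟩
    · rw [hfil, if_neg fun hn => Finset.disjoint_left.1 hd (mem_filter.1 hn).1 ha]
      exact hT.root
    · exact disjoint_union_left.2 ⟨hd, hM.1⟩
    · rw [← hMcard]
      congr 1
      ext y
      rw [mem_filter, mem_union]
      constructor
      · rintro ⟨hy | hy, h2⟩
        · rw [d1 y hy] at h2; have := hT.le y hy; omega
        · exact hy
      · intro hy; exact ⟨.inr hy, d2 y hy⟩
    · have := card_union_le N M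
      omega
    · refine hMext.anti (by rw [union_assoc]) fun u => ?_
      rw [hfil]; push_cast; split_ifs <;> simp

/-- The ancestors of a leaf of a tree. -/
theorem TreeAt.ancestors {a : V} {κ : ℕ} {N : Finset V} {par : V → V} {dep : V → ℕ}
    (hT : TreeAt G a κ N par dep) {t : V} (ht : t ∈ N) (hdt : dep t = κ) (i : ℕ) (hi : i < κ) :
    par^[i] t ∈ N ∧ dep (par^[i] t) + i = κ := by
  induction i with
  | zero => exact ⟨ht, by simpa using hdt⟩
  | succ i ih =>
    obtain ⟨h1, h2⟩ := ih (by omega)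
    rw [Function.iterate_succ_apply']
    obtain ⟨h3, h4⟩ := hT.par_mem _ h1 (by omega)
    exact ⟨h3, by omega⟩

/-- On a single branch no vertex is the parent of two others, since depth determines position. When
the rest of the tree is given back, a branch therefore costs at most one unit at the root and at
each of its vertices. -/
theorem TreeAt.count_le {a : V} {κ : ℕ} {N : Finset V} {par : V → V} {dep : V → ℕ}
    (hT : TreeAt G a κ N par dep) (ha : a ∉ N) {t : V} (ht : t ∈ N) (hdt : dep t = κ) (u : V) :
    (((range κ).image fun i => par^[i] t).filter fun y => par y = u).card ≤
      (if u = a then 1 else 0) + if u ∈ (range κ).image fun i => par^[i] t then 1 else 0 := by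
  set Q := (range κ).image fun i => par^[i] t with hQ
  have hle : (Q.filter fun y => par y = u).card ≤ 1 := by
    rw [card_le_one]
    intro x hx y hy
    simp only [hQ, mem_filter, mem_image, mem_range] at hx hy
    obtain ⟨⟨i, hi, rfl⟩, hxu⟩ := hx
    obtain ⟨⟨j, hj, rfl⟩, hyu⟩ := hy
    have e1 := hT.ancestors ht hdt i hi
    have e2 := hT.ancestors ht hdt j hj
    by_cases hu : u ∈ N
    · have key : ∀ i, i < κ → par (par^[i] t) = u → dep u + 1 = dep (par^[i] t) := by
        intro i hi hxu
        have e1 := hT.ancestors ht hdt i hi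
        have h1 := hT.one_le _ e1.1
        rcases Nat.eq_or_lt_of_le h1 with h | h
        · have := hT.par_one _ e1.1 h.symm
          exact absurd (this.symm.trans hxu ▸ hu) ha
        · rw [← hxu]; exact (hT.par_mem _ e1.1 h).2
      have k1 := key i hi hxu; have k2 := key j hj hyu
      have : i = j := by omega
      rw [this]
    · have key : ∀ i, i < κ → par (par^[i] t) = u → dep (par^[i] t) = 1 := by
        intro i hi hxu
        have e1 := hT.ancestors ht hdt i hi
        have h1 := hT.one_le _ e1.1
        by_contra hne
        exact hu (hxu ▸ (hT.par_mem _ e1.1 (by omega)).1)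
      have k1 := key i hi hxu; have k2 := key j hj hyu
      have : i = j := by omega
      rw [this]
  by_cases hu : u = a
  · rw [if_pos hu]; omega
  by_cases hu' : u ∈ Q
  · rw [if_pos hu']; omega
  · rw [if_neg hu, if_neg hu', add_zero, Nat.le_zero, card_eq_zero, filter_eq_empty_iff]
    intro y hy hyu
    rw [hQ, mem_image] at hy
    obtain ⟨i, hi, rfl⟩ := hy
    rw [mem_range] at hi
    have e1 := hT.ancestors ht hdt i hi
    rcases Nat.eq_or_lt_of_le (hT.one_le _ e1.1) with h | h
    · exact hu (hyu.symm.trans (hT.par_one _ e1.1 h.symm))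
    · have hi' : i + 1 < κ := by
        have := (hT.par_mem _ e1.1 h)
        have := hT.one_le _ this.1
        omega
      refine hu' (mem_image.2 ⟨i + 1, mem_range.2 hi', ?_⟩)
      rw [Function.iterate_succ_apply', hyu]

end Connecting

/-! ### Disjoint paths between prescribed pairs. -/

section Routing

variable {V : Type*} [Fintype V] {G : SimpleGraph V} {m : ℕ} {X : Finset V} {c : V → ℤ}

/-- `P 0, …, P (L - 1)` are the inner vertices of a path from `a` to `b` avoiding `X`. -/
structure Link (G : SimpleGraph V) (X : Finset V) (a b : V) (L : ℕ) (P : ℕ → V) : Prop where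
  inj : ∀ i < L, ∀ j < L, P i = P j → i = j
  notMem : ∀ i < L, P i ∉ X
  first : G.Adj a (P 0)
  adj : ∀ i, i + 1 < L → G.Adj (P i) (P (i + 1))
  last : G.Adj (P (L - 1)) b

/-- Trees grown from `a` and from `b` have at least `m` leaves each, hence an edge runs between
their leaves. Only the two branches leading to it are kept, and `Extendable.sdiff` returns
everything else. The search needs room for two trees, but the link permanently uses only 2(κ + 1)
vertices. If `a = b`, both trees start at the same vertex, which must pay twice. -/
theorem Extendable.exists_link (h : Extendable G m X c) (hj : Joined G m) (hm : 0 < m)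
    (hc : ∀ u, c u ≤ 20) {a b : V} (ha : a ∈ X) (hb : b ∈ X)
    (hca : 1 + (if a = b then 1 else 0) ≤ c a) (hcb : 1 ≤ c b) (hcX : ∀ u, u ∉ X → 2 ≤ c u) {κ : ℕ}
    (hκ : m ≤ 2 ^ κ) (hX : X.card + 2 * 2 ^ (κ + 1) + 44 * m ≤ Fintype.card V) :
    ∃ P : ℕ → V, Link G X a b (2 * (κ + 1)) P ∧
      Extendable G m (X ∪ (range (2 * (κ + 1))).image P) fun u => c u - (if u = a then 1 else 0) -
        (if u = b then 1 else 0) - if u ∈ (range (2 * (κ + 1))).image P then 1 else 0 := by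
  obtain ⟨N, par, dep, hT, hN, hlev, hNc, hext⟩ := h.exists_tree hj hm hc ha
    (by split_ifs at hca <;> omega) hcX κ (by omega)
  have hcu := card_union_le X N
  have hcnt0 : ∀ u, u ∉ N → u ≠ a → (N.filter fun y => par y = u).card = 0 := by
    intro u hu hua
    rw [card_eq_zero, filter_eq_empty_iff]
    intro y hy hyu
    rcases Nat.eq_or_lt_of_le (hT.one_le y hy) with h2 | h2
    · exact hua (hyu.symm.trans (hT.par_one y hy h2.symm))
    · exact hu (hyu ▸ (hT.par_mem y hy h2).1)
  obtain ⟨N', par', dep', hT', hN', hlev', hNc', hext'⟩ := hext.exists_tree hj hm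
    (fun u => by have := hc u; omega) (a := b) (mem_union_left _ hb)
    (by
      by_cases hab : a = b
      · subst hab; rw [if_pos rfl] at hca; have := hT.root; omega
      · rw [hcnt0 b (fun hn => Finset.disjoint_left.1 hN hn hb) (Ne.symm hab)]; simpa using hcb)
    (fun u hu => by
      rw [mem_union, not_or] at hu
      rw [hcnt0 u hu.2 (by rintro rfl; exact hu.1 ha)]; simpa using hcX u hu.1)
    κ (by omega)
  rw [disjoint_union_right] at hN'
  have hNN : ∀ x, x ∈ N → x ∉ N' := fun x hx hx' => Finset.disjoint_left.1 hN'.2 hx' hx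
  have hNX : ∀ x, x ∈ N → x ∉ X := fun x hx hx' => Finset.disjoint_left.1 hN hx hx'
  have hNX' : ∀ x, x ∈ N' → x ∉ X := fun x hx hx' => Finset.disjoint_left.1 hN'.1 hx hx'
  obtain ⟨t, ht, t', ht', hadj⟩ := hj (N.filter fun y => dep y = κ + 1)
    (N'.filter fun y => dep' y = κ + 1)
    (Finset.disjoint_left.2 fun x hx hx' => hNN x (mem_filter.1 hx).1 (mem_filter.1 hx').1)
    (by omega) (by omega)
  rw [mem_filter] at ht ht'
  have anc := hT.ancestors ht.1 ht.2
  have anc' := hT'.ancestors ht'.1 ht'.2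
  set Q := (range (κ + 1)).image fun i => par^[i] t with hQ
  set Q' := (range (κ + 1)).image fun i => par'^[i] t' with hQ'
  have hQN : Q ⊆ N := by
    intro x hx; obtain ⟨i, hi, rfl⟩ := mem_image.1 hx; exact (anc i (mem_range.1 hi)).1
  have hQN' : Q' ⊆ N' := by
    intro x hx; obtain ⟨i, hi, rfl⟩ := mem_image.1 hx; exact (anc' i (mem_range.1 hi)).1
  -- The first half descends from the child of `a` to the leaf `t`; the second climbs from `t'` to
  -- the child of `b`.
  let P : ℕ → V := fun i => if i ≤ κ then par^[κ - i] t else par'^[i - (κ + 1)] t'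
  have P1 : ∀ i, i ≤ κ → P i = par^[κ - i] t := fun i hi => if_pos hi
  have P2 : ∀ i, κ < i → P i = par'^[i - (κ + 1)] t' := fun i hi => if_neg (by omega)
  have hPQ : (range (2 * (κ + 1))).image P = Q ∪ Q' := by
    ext x
    simp only [hQ, hQ', mem_image, mem_union, mem_range]
    constructor
    · rintro ⟨i, hi, rfl⟩
      by_cases hik : i ≤ κ
      · exact .inl ⟨κ - i, by omega, (P1 i hik).symm⟩
      · exact .inr ⟨i - (κ + 1), by omega, (P2 i (by omega)).symm⟩
    · rintro (⟨i, hi, rfl⟩ | ⟨i, hi, rfl⟩)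
      · exact ⟨κ - i, by omega, by rw [P1 _ (by omega), Nat.sub_sub_self (by omega)]⟩
      · exact ⟨i + (κ + 1), by omega, by rw [P2 _ (by omega), Nat.add_sub_cancel]⟩
  have htop : par (par^[κ] t) = a := by
    have := anc κ (by omega)
    exact hT.par_one _ this.1 (by omega)
  have htop' : par' (par'^[κ] t') = b := by
    have := anc' κ (by omega)
    exact hT'.par_one _ this.1 (by omega)
  refine ⟨P, ⟨?_, ?_, ?_, ?_, ?_⟩, ?_⟩
  · intro i hi j hj hij
    by_cases hik : i ≤ κ <;> by_cases hjk : j ≤ κ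
    · rw [P1 i hik, P1 j hjk] at hij
      have e1 := (anc (κ - i) (by omega)).2; have e2 := (anc (κ - j) (by omega)).2
      rw [hij] at e1; omega
    · rw [P1 i hik, P2 j (by omega)] at hij
      exact absurd (hij ▸ (anc (κ - i) (by omega)).1) fun hh =>
        hNN _ hh (anc' (j - (κ + 1)) (by omega)).1
    · rw [P2 i (by omega), P1 j hjk] at hij
      exact absurd (hij ▸ (anc' (i - (κ + 1)) (by omega)).1) (hNN _ (anc (κ - j) (by omega)).1)
    · rw [P2 i (by omega), P2 j (by omega)] at hij
      have e1 := (anc' (i - (κ + 1)) (by omega)).2; have e2 := (anc' (j - (κ + 1)) (by omega)).2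
      rw [hij] at e1; omega
  · intro i hi
    by_cases hik : i ≤ κ
    · rw [P1 i hik]; exact hNX _ (anc _ (by omega)).1
    · rw [P2 i (by omega)]; exact hNX' _ (anc' _ (by omega)).1
  · rw [P1 0 (by omega), Nat.sub_zero]
    have := hT.adj _ (anc κ (by omega)).1
    rwa [htop] at this
  · intro i hi
    by_cases hik : i + 1 ≤ κ
    · rw [P1 i (by omega), P1 (i + 1) hik]
      have := hT.adj _ (anc (κ - (i + 1)) (by omega)).1
      rwa [← Function.iterate_succ_apply' par, show (κ - (i + 1)).succ = κ - i by omega] at this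
    · by_cases hik' : i = κ
      · subst hik'
        rw [P1 _ le_rfl, P2 _ (by omega)]
        simpa using hadj
      · rw [P2 i (by omega), P2 (i + 1) (by omega)]
        have := (hT'.adj _ (anc' (i - (κ + 1)) (by omega)).1).symm
        rwa [← Function.iterate_succ_apply' par',
          show (i - (κ + 1)).succ = i + 1 - (κ + 1) by omega] at this
  · rw [P2 _ (by omega), show 2 * (κ + 1) - 1 - (κ + 1) = κ by omega]
    have := (hT'.adj _ (anc' κ (by omega)).1).symm
    rwa [htop'] at this
  · rw [hPQ]
    let par'' : V → V := fun y => if y ∈ N then par y else par' y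
    have q1 : ∀ y ∈ N, par'' y = par y := fun y hy => if_pos hy
    have q2 : ∀ y ∈ N', par'' y = par' y := fun y hy => if_neg fun hn => hNN y hn hy
    have hfin := hext'.sdiff (D := (N \ Q) ∪ (N' \ Q')) (par := par'') (by
      intro x; simp only [mem_union, mem_sdiff]; tauto) (by
      intro y hy
      rcases mem_union.1 hy with hy | hy
      · rw [q1 y (mem_sdiff.1 hy).1]; exact hT.adj y (mem_sdiff.1 hy).1
      · rw [q2 y (mem_sdiff.1 hy).1]; exact hT'.adj y (mem_sdiff.1 hy).1)
    refine hfin.anti ?_ fun u => ?_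
    · intro x hx
      simp only [mem_union, mem_sdiff] at hx ⊢
      rcases hx with hx | hx | hx
      · exact ⟨.inl (.inl hx), fun hh => hh.elim (fun hh => hNX x hh.1 hx) fun hh => hNX' x hh.1 hx⟩
      · exact ⟨.inl (.inr (hQN hx)), fun hh => hh.elim (fun hh => hh.2 hx)
          fun hh => hNN x (hQN hx) hh.1⟩
      · exact ⟨.inr (hQN' hx), fun hh => hh.elim (fun hh => hNN x hh.1 (hQN' hx)) fun hh => hh.2 hx⟩
    · have s1 : (N.filter fun y => par y = u).card =
          ((N \ Q).filter fun y => par y = u).card + (Q.filter fun y => par y = u).card := by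
        rw [← card_union_of_disjoint (disjoint_filter_filter sdiff_disjoint), ← filter_union,
          sdiff_union_of_subset hQN]
      have s2 : (N'.filter fun y => par' y = u).card =
          ((N' \ Q').filter fun y => par' y = u).card + (Q'.filter fun y => par' y = u).card := by
        rw [← card_union_of_disjoint (disjoint_filter_filter sdiff_disjoint), ← filter_union,
          sdiff_union_of_subset hQN']
      have s3 : (((N \ Q) ∪ (N' \ Q')).filter fun y => par'' y = u).card =
          ((N \ Q).filter fun y => par y = u).card + ((N' \ Q').filter fun y => par' y = u).card := by
        rw [filter_union, card_union_of_disjoint (disjoint_filter_filter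
          (disjoint_of_subset_left sdiff_subset (disjoint_of_subset_right sdiff_subset hN'.2.symm)))]
        congr 2
        · exact filter_congr fun y hy => by rw [q1 y (mem_sdiff.1 hy).1]
        · exact filter_congr fun y hy => by rw [q2 y (mem_sdiff.1 hy).1]
      have c1 := hT.count_le (fun hn => hNX a hn ha) ht.1 ht.2 u
      have c2 := hT'.count_le (fun hn => hNX' b hn hb) ht'.1 ht'.2 u
      rw [← hQ] at c1; rw [← hQ'] at c2
      have c3 : (if u ∈ Q then 1 else 0) + (if u ∈ Q' then 1 else 0) =
          if u ∈ Q ∪ Q' then 1 else 0 := by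
        by_cases u1 : u ∈ Q
        · have : u ∉ Q' := fun h2 => hNN u (hQN u1) (hQN' h2)
          simp [u1, this]
        · simp [u1]
      rw [s1, s2, s3]
      push_cast
      have c4 : ((Q.filter fun y => par y = u).card : ℤ) + (Q'.filter fun y => par' y = u).card ≤
          (if u = a then 1 else 0) + (if u = b then 1 else 0) + if u ∈ Q ∪ Q' then 1 else 0 := by
        have : (Q.filter fun y => par y = u).card + (Q'.filter fun y => par' y = u).card ≤
          (if u = a then 1 else 0) + (if u = b then 1 else 0) + if u ∈ Q ∪ Q' then 1 else 0 := by
          omega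
        exact_mod_cast this
      linarith

/-- Finitely many pairs of vertices can be joined simultaneously by disjoint paths with the same
number of inner vertices. -/
theorem Extendable.exists_links (h : Extendable G m X c) (hj : Joined G m) (hm : 0 < m)
    (hc : ∀ u, c u ≤ 20) {ι : Type*} (s : Finset ι) {a b : ι → V} (ha : ∀ i, a i ∈ X)
    (hb : ∀ i, b i ∈ X) (hcX : ∀ u, u ∉ X → 2 ≤ c u)
    (hcnt : ∀ u ∈ X, ((s.filter fun i => a i = u).card + (s.filter fun i => b i = u).card : ℤ) ≤ c u)
    {κ : ℕ} (hκ : m ≤ 2 ^ κ)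
    (hX : X.card + s.card * (2 * (κ + 1)) + 2 * 2 ^ (κ + 1) + 44 * m ≤ Fintype.card V) :
    ∃ (P : ι → ℕ → V) (N : Finset V), (∀ i ∈ s, Link G X (a i) (b i) (2 * (κ + 1)) (P i)) ∧
      (∀ i ∈ s, ∀ j < 2 * (κ + 1), ∀ i' ∈ s, ∀ j' < 2 * (κ + 1), P i j = P i' j' → i = i' ∧ j = j') ∧
      (∀ x, x ∈ N ↔ ∃ i ∈ s, ∃ j < 2 * (κ + 1), x = P i j) ∧ N.card ≤ s.card * (2 * (κ + 1)) ∧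
      Extendable G m (X ∪ N) fun u => c u - (s.filter fun i => a i = u).card -
        (s.filter fun i => b i = u).card - if u ∈ N then 1 else 0 := by
  induction s using Finset.induction_on with
  | empty => exact ⟨fun i _ => a i, ∅, by simp, by simp, by simp, by simp, by simpa using h⟩
  | insert e s he ih =>
    have f1 : ∀ (g : ι → V) u, ((insert e s).filter fun i => g i = u).card =
        (s.filter fun i => g i = u).card + if u = g e then 1 else 0 := by
      intro g u
      rw [filter_insert]
      by_cases hu : g e = u
      · rw [if_pos hu, if_pos hu.symm, card_insert_of_notMem (by simp [he])]
      · rw [if_neg hu, if_neg (Ne.symm hu), add_zero]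
    rw [card_insert_of_notMem he, add_mul, one_mul] at hX
    obtain ⟨P, N, hP, hinj, hN, hNc, hext⟩ := ih
      (fun u hu => by have := hcnt u hu; rw [f1, f1] at this; push_cast at this; split_ifs at this <;> omega)
      (by omega)
    have hNX : ∀ x ∈ N, x ∉ X := by
      intro x hx
      obtain ⟨i, hi, j, hj, rfl⟩ := (hN x).1 hx
      exact (hP i hi).notMem j hj
    have hz : ∀ (g : ι → V), (∀ i, g i ∈ X) → ∀ u, u ∉ X → (s.filter fun i => g i = u).card = 0 := by
      intro g hg u hu
      rw [card_eq_zero, filter_eq_empty_iff]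
      intro i _ hi
      exact hu (hi ▸ hg i)
    have hcu := card_union_le X N
    have hca := hcnt (a e) (ha e)
    have hcb := hcnt (b e) (hb e)
    rw [f1, f1] at hca hcb
    rw [if_pos rfl] at hca
    rw [if_pos rfl] at hcb
    obtain ⟨Q, hQ, hQext⟩ := hext.exists_link hj hm (fun u => by have := hc u; split_ifs <;> omega)
      (a := a e) (b := b e) (mem_union_left _ (ha e)) (mem_union_left _ (hb e))
      (by
        rw [if_neg fun hn => hNX _ hn (ha e)]
        split_ifs at hca ⊢ <;> push_cast at hca <;> omega)
      (by
        rw [if_neg fun hn => hNX _ hn (hb e)]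
        split_ifs at hcb <;> push_cast at hcb <;> omega)
      (fun u hu => by
        rw [mem_union, not_or] at hu
        rw [if_neg hu.2, hz a ha u hu.1, hz b hb u hu.1]
        simpa using hcX u hu.1) hκ (by omega)
    have hQN : ∀ i ∈ s, ∀ j < 2 * (κ + 1), ∀ j' < 2 * (κ + 1), P i j ≠ Q j' := by
      intro i hi j hj j' hj' heq
      exact hQ.notMem j' hj' (mem_union_right _ ((hN _).2 ⟨i, hi, j, hj, heq.symm⟩))
    have u1 : ∀ i ∈ s, Function.update P e Q i = P i := fun i hi =>
      Function.update_of_ne (by rintro rfl; exact he hi) _ _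
    have u2 : Function.update P e Q e = Q := Function.update_self _ _ _
    refine ⟨Function.update P e Q, N ∪ (range (2 * (κ + 1))).image Q, ?_, ?_, ?_, ?_, ?_⟩
    · intro i hi
      rcases mem_insert.1 hi with rfl | hi
      · rw [u2]
        exact ⟨hQ.inj, fun j hj hx => hQ.notMem j hj (mem_union_left _ hx), hQ.first, hQ.adj, hQ.last⟩
      · rw [u1 i hi]; exact hP i hi
    · intro i hi j hj i' hi' j' hj' heq
      rcases mem_insert.1 hi with rfl | hs <;> rcases mem_insert.1 hi' with h' | hs'
      · subst h'; rw [u2] at heq; exact ⟨rfl, hQ.inj j hj j' hj' heq⟩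
      · rw [u2, u1 i' hs'] at heq; exact absurd heq.symm (hQN i' hs' j' hj' j hj)
      · subst h'; rw [u2, u1 i hs] at heq; exact absurd heq (hQN i hs j hj j' hj')
      · rw [u1 i hs, u1 i' hs'] at heq; exact hinj i hs j hj i' hs' j' hj' heq
    · intro x
      rw [mem_union, hN, mem_image]
      constructor
      · rintro (⟨i, hi, j, hj, rfl⟩ | ⟨j, hj, rfl⟩)
        · exact ⟨i, mem_insert_of_mem hi, j, hj, by rw [u1 i hi]⟩
        · exact ⟨e, mem_insert_self _ _, j, mem_range.1 hj, by rw [u2]⟩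
      · rintro ⟨i, hi, j, hj, rfl⟩
        rcases mem_insert.1 hi with rfl | hi
        · exact .inr ⟨j, mem_range.2 hj, by rw [u2]⟩
        · exact .inl ⟨i, hi, j, hj, by rw [u1 i hi]⟩
    · rw [card_insert_of_notMem he, add_mul, one_mul]
      refine (card_union_le _ _).trans (add_le_add hNc (card_image_le.trans ?_))
      rw [card_range]
    · refine hQext.anti (by rw [union_assoc]) fun u => ?_
      rw [f1, f1]
      have : (if u ∈ N ∪ (range (2 * (κ + 1))).image Q then (1 : ℤ) else 0) =
          (if u ∈ N then 1 else 0) + if u ∈ (range (2 * (κ + 1))).image Q then 1 else 0 := by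
        by_cases h1 : u ∈ N
        · have : u ∉ (range (2 * (κ + 1))).image Q := by
            intro h2
            obtain ⟨j, hj, rfl⟩ := mem_image.1 h2
            exact hQ.notMem j (mem_range.1 hj) (mem_union_right _ h1)
          rw [if_pos h1, if_neg this, if_pos (mem_union_left _ h1)]; rfl
        · rw [if_neg h1, zero_add]
          congr 1
          rw [mem_union]; simp [h1]
      rw [this]; push_cast; linarith

/-- A long path whose vertices keep almost all of their demands. -/
theorem Extendable.exists_path (h : Extendable G m ∅ fun _ => 20) (hj : Joined G m) (hm : 0 < m)
    (L : ℕ) (hL : L + 1 + 44 * m ≤ Fintype.card V) :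
    ∃ p : ℕ → V, (∀ i ≤ L, ∀ j ≤ L, p i = p j → i = j) ∧ (∀ i < L, G.Adj (p i) (p (i + 1))) ∧
      Extendable G m ((range (L + 1)).image p) fun _ => 18 := by
  -- All demands are first lowered to 19, to cover the unit spent at the auxiliary starting vertex.
  -- Every path vertex except the last has then spent one more on its successor.
  suffices H : ∃ p : ℕ → V, (∀ i ≤ L, ∀ j ≤ L, p i = p j → i = j) ∧
      (∀ i < L, G.Adj (p i) (p (i + 1))) ∧
      Extendable G m ((range (L + 1)).image p)
        fun u => 19 - if u ∈ (range L).image p then 1 else 0 by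
    obtain ⟨p, h1, h2, h3⟩ := H
    exact ⟨p, h1, h2, h3.anti subset_rfl fun u => by split_ifs <;> norm_num⟩
  induction L with
  | zero =>
    obtain ⟨s⟩ : Nonempty V := Fintype.card_pos_iff.1 (by omega)
    obtain ⟨y, -, -, hy⟩ := h.exists_insert hj hm (fun _ => le_rfl) (s := s) (by norm_num)
      (by simp; omega)
    exact ⟨fun _ => y, by intro i hi j hj _; omega, by simp, hy.anti (by simp) fun u => by
      simp only [range_zero, image_empty, notMem_empty, if_false]; split_ifs <;> norm_num⟩
  | succ L ih =>
    obtain ⟨p, hinj, hadj, hext⟩ := ih (by omega)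
    have hpL : p L ∉ (range L).image p := by
      intro hx
      obtain ⟨i, hi, heq⟩ := mem_image.1 hx
      rw [mem_range] at hi
      have := hinj i hi.le L le_rfl heq; omega
    obtain ⟨y, hy, hyX, hext'⟩ := hext.exists_insert hj hm
      (fun u => by split_ifs <;> norm_num) (s := p L) (by rw [if_neg hpL]; norm_num)
      (by have := card_image_le (s := range (L + 1)) (f := p); rw [card_range] at this; omega)
    let q := Function.update p (L + 1) y
    have q1 : ∀ i ≤ L, q i = p i := fun i hi => Function.update_of_ne (by omega) _ _
    have q2 : q (L + 1) = y := Function.update_self _ _ _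
    have hy' : ∀ i ≤ L, p i ≠ y := fun i hi heq =>
      hyX (mem_image.2 ⟨i, mem_range.2 (by omega), heq⟩)
    have him : (range (L + 1)).image q = (range (L + 1)).image p :=
      image_congr fun i hi => q1 i (by simp at hi; omega)
    refine ⟨q, ?_, ?_, ?_⟩
    · intro i hi j hj heq
      rcases Nat.lt_or_ge L i with h1 | h1 <;> rcases Nat.lt_or_ge L j with h2 | h2
      · omega
      · rw [show i = L + 1 by omega, q2, q1 j h2] at heq; exact absurd heq.symm (hy' j h2)
      · rw [show j = L + 1 by omega, q2, q1 i h1] at heq; exact absurd heq (hy' i h1)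
      · rw [q1 i h1, q1 j h2] at heq; exact hinj i h1 j h2 heq
    · intro i hi
      rcases Nat.lt_or_ge i L with h1 | h1
      · rw [q1 i h1.le, q1 (i + 1) h1]; exact hadj i h1
      · rw [show i = L by omega, q1 L le_rfl, q2]; exact hy
    · refine hext'.anti ?_ fun u => ?_
      · rw [range_add_one, image_insert, him, q2]
      · rw [him, range_add_one, image_insert]
        by_cases h1 : u = p L
        · subst h1; rw [if_pos (mem_insert_self _ _), if_neg hpL, if_pos rfl]; norm_num
        · rw [if_neg h1]; simp [h1]

end Routing

/-! ### Absorbing the free vertices outside the frame. -/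

section Absorbing

variable {V : Type*} [Fintype V]

/-- A linear forest `S₀` in which the set `X` is separated from the rest; the `pool` consists of
ends of paths in `X`, and `A` is a set of inner vertices with expansion into `A'` away from `B`. -/
structure Reservoir (G : SimpleGraph V) (m ℓ : ℕ) (X A A' B pool : Finset V) (S₀ : SimpleGraph V)
    (cp : V → V) : Prop where
  joined : Joined G m
  expand : ∀ U : Finset V, U.card ≤ m → 12 * U.card ≤ (nbr G U \ X).card
  le : S₀ ≤ G
  dg_le : ∀ v, S₀.dg v ≤ 2
  closed : ∀ u v, S₀.Adj u v → u ∈ X → v ∈ X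
  A_subset : A ⊆ X
  pool_subset : pool ⊆ X
  disj : Disjoint A pool
  dg_A : ∀ v ∈ A, S₀.dg v = 2
  dg_pool : ∀ v ∈ pool, S₀.dg v = 1
  A'_subset : A' ⊆ A
  A'_B : Disjoint A' B
  pool_B : Disjoint pool B
  A'_adj : ∀ x ∈ A', ∀ y, S₀.Adj x y → y ∈ A ∧ y ∉ B
  expandA : ∀ U : Finset V, Disjoint U B → U.card ≤ m → U.Nonempty →
    20 * U.card ≤ (nbr G U ∩ A').card + pool.card
  cp_adj : ∀ u v, S₀.Adj u v → cp u = cp v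
  cp_card : ∀ i, ((A ∪ pool).filter fun x => cp x = i).card ≤ ℓ

variable {G : SimpleGraph V} {m ℓ : ℕ} {X A A' B pool : Finset V} {S₀ : SimpleGraph V} {cp : V → V}

/-- The total deficiency of `S` outside the designated ends. -/
noncomputable def deficiency (X A : Finset V) (S : SimpleGraph V) : ℕ := ∑ v ∈ Xᶜ ∪ A, (2 - S.dg v)

theorem Reservoir.card_marked_le (hR : Reservoir G m ℓ X A A' B pool S₀ cp) (K : Finset V) :
    ((A ∪ pool).filter fun x => cp x ∈ K.image cp).card ≤ K.card * ℓ := by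
  have : ((A ∪ pool).filter fun x => cp x ∈ K.image cp) ⊆
      (K.image cp).biUnion fun i => (A ∪ pool).filter fun x => cp x = i := by
    intro x hx
    rw [mem_filter] at hx
    exact mem_biUnion.2 ⟨cp x, hx.2, mem_filter.2 ⟨hx.1, rfl⟩⟩
  refine (card_le_card this).trans ((card_biUnion_le_card_mul _ _ ℓ fun i _ => hR.cp_card i).trans ?_)
  exact Nat.mul_le_mul_right _ card_image_le

/-- One absorption step: a free vertex is joined to the pool by rotating on both sides. -/
theorem Reservoir.step (hR : Reservoir G m ℓ X A A' B pool S₀ cp) {S : SimpleGraph V} (hSG : S ≤ G)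
    (hSa : S.IsAcyclic) (hS2 : ∀ v, S.dg v ≤ 2) {K : Finset V} (hK : K ⊆ A ∪ pool)
    (hSK : ∀ u ∈ X, u ∉ K → ∀ v, S.Adj u v ↔ S₀.Adj u v) (hm : 0 < m) {κ : ℕ} (hκ : m ≤ 2 ^ κ)
    (hnum : 4 * (K.card * ℓ) ≤ pool.card) (hpos : 0 < pool.card)
    (hdef : 0 < deficiency X A S) :
    ∃ (T : SimpleGraph V) (K' : Finset V), T ≤ G ∧ T.IsAcyclic ∧ (∀ v, T.dg v ≤ 2) ∧
      K' ⊆ A ∪ pool ∧ (∀ u ∈ X, u ∉ K' → ∀ v, T.Adj u v ↔ S₀.Adj u v) ∧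
      K'.card ≤ K.card + (2 * κ + 1) ∧ deficiency X A T + 1 = deficiency X A S ∧
      ∀ v, S.dg v ≤ T.dg v := by
  have hdgK : ∀ u ∈ X, u ∉ K → S.dg u = S₀.dg u := fun u hu hk => dg_congr (hSK u hu hk)
  let A₂ : V → Prop := fun v => (v ∉ X ∨ v ∈ A) ∧ S.dg v ≤ 1
  let E₂ : V → V → Prop := fun x y => S.Adj x y ∧ x ∉ X
  let R₂ : V → Prop := fun u => u ∉ X ∨ u ∈ K
  have hA2R : ∀ v, A₂ v → R₂ v := by
    rintro v ⟨h | h, hd⟩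
    · exact .inl h
    · by_contra hc
      simp only [R₂, not_or, not_not] at hc
      have := hdgK v hc.1 hc.2
      have := hR.dg_A v h
      omega
  have hE2R : ∀ x y, E₂ x y → R₂ x ∧ R₂ y := by
    rintro x y ⟨hxy, hx⟩
    refine ⟨.inl hx, ?_⟩
    by_contra hc
    simp only [R₂, not_or, not_not] at hc
    exact hx (hR.closed y x ((hSK y hc.1 hc.2 x).1 hxy.symm) hc.1)
  set Z₂ := allEnds G S A₂ E₂ with hZ2
  -- Outside `X` every edge may be deleted, so all outside neighbours of `Z₂` are near `Z₂`. Below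
  -- `m` this gives 12|Z₂| ≤ 3|Z₂|, so `Z₂` is empty, yet some vertex still has a defect.
  have hZ2m : m ≤ Z₂.card := by
    by_contra! hlt
    have h1 := hR.expand Z₂ hlt.le
    have h2 : nbr G Z₂ \ X ⊆ nearS S Z₂ := by
      intro x hx
      rw [mem_sdiff] at hx
      obtain ⟨s, hs, hsx⟩ := mem_nbr.1 hx.1
      by_cases h0 : 0 < S.dg x
      · exact mem_nearS_allEnds hS2 (fun w hw => hw.2) hs hsx h0 fun y hy => ⟨hy, hx.2⟩
      · exact mem_union_left _ (mem_allEnds.2 ⟨0, S, x, .base x ⟨.inl hx.2, by omega⟩⟩)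
    have h3 := (card_le_card h2).trans (card_nearS_le hS2 Z₂)
    have h4 : Z₂ = ∅ := card_eq_zero.1 (by omega)
    have h5 : deficiency X A S = 0 := by
      refine sum_eq_zero fun v hv => ?_
      rw [mem_union, mem_compl] at hv
      by_contra hne
      have : v ∈ Z₂ := mem_allEnds.2 ⟨0, S, v, .base v ⟨hv, by omega⟩⟩
      rw [h4] at this; simp at this
    omega
  -- The reservoir vertices whose label class contains no vertex changed so far. There `S` agrees
  -- with `S₀`, and `hclosed` below shows that this region is a union of components of `S`.
  let R₁ : V → Prop := fun u => u ∈ X ∧ cp u ∉ K.image cp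
  have hR1K : ∀ u, R₁ u → u ∉ K := fun u hu hk => hu.2 (mem_image_of_mem _ hk)
  let A₁ : V → Prop := fun v => v ∈ pool ∧ cp v ∉ K.image cp
  let E₁ : V → V → Prop := fun x y => S.Adj x y ∧ x ∈ A' ∧ cp x ∉ K.image cp
  have hA'X : ∀ x ∈ A', x ∈ X := fun x hx => hR.A_subset (hR.A'_subset hx)
  have hA1R : ∀ v, A₁ v → R₁ v ∧ v ∉ B := fun v hv =>
    ⟨⟨hR.pool_subset hv.1, hv.2⟩, Finset.disjoint_left.1 hR.pool_B hv.1⟩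
  have hE1 : ∀ x y, E₁ x y → S₀.Adj x y := fun x y h =>
    (hSK x (hA'X x h.2.1) (hR1K x ⟨hA'X x h.2.1, h.2.2⟩) y).1 h.1
  have hE1R : ∀ x y, E₁ x y → (R₁ x ∧ x ∉ B) ∧ (R₁ y ∧ y ∉ B) := by
    intro x y h
    have h0 := hE1 x y h
    have hy := hR.A'_adj x h.2.1 y h0
    exact ⟨⟨⟨hA'X x h.2.1, h.2.2⟩, Finset.disjoint_left.1 hR.A'_B h.2.1⟩,
      ⟨hR.A_subset hy.1, hR.cp_adj x y h0 ▸ h.2.2⟩, hy.2⟩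
  have hA1dg : ∀ v, A₁ v → S.dg v ≤ 1 := by
    intro v hv
    rw [hdgK v (hR.pool_subset hv.1) (hR1K v (hA1R v hv).1), hR.dg_pool v hv.1]
  let Z : ℕ → Finset V := rotEnds G S A₁ E₁
  have hmark := hR.card_marked_le K
  have hZ0 : pool.card ≤ (Z 0).card + K.card * ℓ := by
    have : pool ⊆ Z 0 ∪ (A ∪ pool).filter fun x => cp x ∈ K.image cp := by
      intro v hv
      by_cases hc : cp v ∈ K.image cp
      · exact mem_union_right _ (mem_filter.2 ⟨mem_union_right _ hv, hc⟩)
      · exact mem_union_left _ (mem_rotEnds.2 ⟨0, le_rfl, S, v, .base v ⟨hv, hc⟩⟩)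
    have := (card_le_card this).trans (card_union_le _ _)
    omega
  have hZmono : ∀ i, (Z 0).card ≤ (Z i).card := by
    intro i
    induction i with
    | zero => exact le_rfl
    | succ i ih => exact ih.trans (card_le_card rotEnds_subset)
  have hZB : ∀ i, Disjoint (Z i) B := by
    intro i
    rw [Finset.disjoint_left]
    intro s hs
    obtain ⟨j, hj, S', v, h⟩ := mem_rotEnds.1 hs
    obtain ⟨_, _, _, h1, _, h2, _⟩ := h.local hA1R hE1R
    exact (h2 s h1).2
  -- At least three quarters of the pool lie in `Z 0`. So the pool has at most 4/3 |Z i| vertices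
  -- and the marked part at most 1/3 |Z i|. Expansion by 20 then leaves 3|Z (i + 1)| ≥ 18|Z i|, far
  -- more than is needed.
  have hdouble : ∀ i, (Z i).card ≤ m → 2 * (Z i).card ≤ (Z (i + 1)).card := by
    intro i hi
    have hne : (Z i).Nonempty := card_pos.1 (by have := hZmono i; omega)
    have h1 := hR.expandA (Z i) (hZB i) hi hne
    have h2 : nbr G (Z i) ∩ A' ⊆ nearS S (Z (i + 1)) ∪
        (A ∪ pool).filter fun x => cp x ∈ K.image cp := by
      intro x hx
      rw [mem_inter] at hx
      by_cases hc : cp x ∈ K.image cp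
      · exact mem_union_right _ (mem_filter.2 ⟨mem_union_left _ (hR.A'_subset hx.2), hc⟩)
      · obtain ⟨s, hs, hsx⟩ := mem_nbr.1 hx.1
        refine mem_union_left _ (mem_nearS_rotEnds hS2 hA1dg hs hsx ?_ fun y hy => ⟨hy, hx.2, hc⟩)
        rw [hdgK x (hA'X x hx.2) (hR1K x ⟨hA'X x hx.2, hc⟩), hR.dg_A x (hR.A'_subset hx.2)]
        norm_num
    have h3 := (card_le_card h2).trans (card_union_le _ _)
    have h4 := card_nearS_le hS2 (Z (i + 1))
    have h5 := hZmono i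
    omega
  -- Within κ doublings the set of ends reaches 2^κ ≥ m. This bound on the number of rotations keeps
  -- the set of changed vertices small.
  obtain ⟨i, hiκ, hi⟩ : ∃ i ≤ κ, m ≤ (Z i).card := by
    by_contra! hcon
    have : ∀ i ≤ κ, 2 ^ i ≤ (Z i).card := by
      intro i
      induction i with
      | zero => intro _; rw [pow_zero]; omega
      | succ i ih =>
        intro h
        have h1 := ih (by omega)
        have h2 := hdouble i (hcon i (by omega)).le
        rw [pow_succ]; omega
    have h1 := this κ le_rfl
    have h2 := hcon κ le_rfl
    omega
  have hclosed : ∀ a b, R₁ a → S.Reachable a b → R₁ b := by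
    rintro a b ha ⟨p⟩
    induction p with
    | nil => exact ha
    | cons h p ih =>
      refine ih ?_
      have h0 := (hSK _ ha.1 (hR1K _ ha) _).1 h
      exact ⟨hR.closed _ _ h0 ha.1, hR.cp_adj _ _ h0 ▸ ha.2⟩
  have hdisj : ∀ v, ¬ (R₁ v ∧ R₂ v) := by
    rintro v ⟨h1, h2 | h2⟩
    exacts [h2 h1.1, hR1K v h1 h2]
  have loc2 : ∀ s ∈ Z₂, ∃ i S' v, Rot G S A₂ E₂ i S' s v ∧ R₂ s ∧ R₂ v ∧
      ∀ u w, ¬ (R₂ u ∧ R₂ w) → (S'.Adj u w ↔ S.Adj u w) := by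
    intro s hs
    obtain ⟨i, S', v, h⟩ := mem_allEnds.1 hs
    obtain ⟨K, _, hvK, hsK, _, hKR, hK⟩ := h.local hA2R hE2R
    exact ⟨i, S', v, h, hKR s hsK, hKR v hvK, fun u w hn => hK u w fun hk =>
      hn ⟨hKR u hk.1, hKR w hk.2⟩⟩
  have loc1 : ∀ s ∈ Z i, ∃ S' v, ∃ j ≤ i, ∃ K₁ : Finset V, Rot G S A₁ E₁ j S' s v ∧ s ∈ K₁ ∧ v ∈ K₁ ∧
      K₁.card ≤ 2 * j + 1 ∧ (∀ u ∈ K₁, R₁ u) ∧ K₁ ⊆ A ∪ pool ∧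
      ∀ u w, ¬ (u ∈ K₁ ∧ w ∈ K₁) → (S'.Adj u w ↔ S.Adj u w) := by
    intro s hs
    obtain ⟨j, hj, S', v, h⟩ := mem_rotEnds.1 hs
    obtain ⟨K, hc, hvK, hsK, hKE, hKR, hK⟩ := h.local hA1R hE1R
    refine ⟨S', v, j, hj, K, h, hsK, hvK, hc, fun u hu => (hKR u hu).1, ?_, hK⟩
    intro u hu
    rcases hKE u hu with rfl | ⟨w, hw | hw⟩
    · exact mem_union_right _ h.root.1
    · exact mem_union_left _ (hR.A'_subset hw.2.1)
    · exact mem_union_left _ (hR.A'_adj w hw.2.1 u (hE1 w u hw)).1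
  obtain ⟨s₁, h1, s₂, h2, hadj⟩ := hR.joined (Z i) Z₂ (by
    rw [Finset.disjoint_left]
    intro s h1 h2
    obtain ⟨_, _, _, _, K₁, _, hs, _, _, hr, _⟩ := loc1 s h1
    obtain ⟨_, _, _, _, hr', _⟩ := loc2 s h2
    exact hdisj s ⟨hr s hs, hr'⟩) hi hZ2m
  obtain ⟨S₁, v₁, j, hj, K₁, q₁, hs₁, hv₁, hK₁c, hK₁R, hK₁sub, l₁⟩ := loc1 s₁ h1
  obtain ⟨i₂, S₂, v₂, q₂, rs₂, rv₂, l₂⟩ := loc2 s₂ h2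
  -- A bound above |V| makes `NoShort` mean acyclicity. The distance condition holds vacuously,
  -- since no walk of `S` leads from `R₁` to `R₂`.
  obtain ⟨T, hTG, hTn, hTd, hTadj⟩ := exists_join (ℓ := Fintype.card V + 2) hSG (hSa.noShort _)
    (by omega) (R₁ := fun u => u ∈ K₁) (R₂ := R₂) q₁ q₂ hs₁ rs₂ hv₁ rv₂ l₁ l₂
    (fun a b ha hb p => absurd ⟨hclosed a b (hK₁R a ha) p.reachable, hb⟩ (hdisj b)) hadj
  have hv12 : v₁ ≠ v₂ := by rintro rfl; exact hdisj v₁ ⟨hK₁R _ hv₁, rv₂⟩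
  have r1 := q₁.root
  have r2 := q₂.root
  refine ⟨T, K ∪ K₁, hTG, hTn.isAcyclic (by omega), ?_, union_subset hK hK₁sub, ?_, ?_, ?_, ?_⟩
  · intro v
    have e := hTd v; have d1 := hA1dg _ r1; have d2 := r2.2; have d := hS2 v
    by_cases e1 : v = v₁
    · subst e1; rw [if_pos rfl, if_neg hv12] at e; omega
    · by_cases e2 : v = v₂
      · subst e2; rw [if_pos rfl, if_neg e1] at e; omega
      · rw [if_neg e1, if_neg e2] at e; omega
  · intro u huX hu w
    rw [mem_union, not_or] at hu
    rw [← hSK u huX hu.1 w]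
    refine hTadj u w fun hh => ?_
    rcases hh.1 with h | h | h
    exacts [hu.2 h, h huX, hu.1 h]
  · have := card_union_le K K₁; omega
  · have hv1 : v₁ ∉ Xᶜ ∪ A := by
      rw [mem_union, mem_compl, not_or, not_not]
      exact ⟨hR.pool_subset r1.1, fun h => Finset.disjoint_left.1 hR.disj h r1.1⟩
    have hv2 : v₂ ∈ Xᶜ ∪ A := by rw [mem_union, mem_compl]; exact r2.1
    unfold deficiency
    rw [← add_sum_erase _ _ hv2, ← add_sum_erase _ _ hv2]
    have e1 : ∑ x ∈ (Xᶜ ∪ A).erase v₂, (2 - T.dg x) = ∑ x ∈ (Xᶜ ∪ A).erase v₂, (2 - S.dg x) := by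
      refine sum_congr rfl fun x hx => ?_
      rw [mem_erase] at hx
      rw [hTd x, if_neg hx.1, if_neg (by rintro rfl; exact hv1 hx.2)]; simp
    have e2 := hTd v₂
    rw [if_pos rfl, if_neg hv12.symm] at e2
    have := r2.2
    omega
  · intro v; rw [hTd v]; omega

/-- Iterating the absorption step until no free vertex is left. -/
theorem Reservoir.absorb (hR : Reservoir G m ℓ X A A' B pool S₀ cp) (hS₀ : S₀.IsAcyclic)
    (hm : 0 < m) {κ : ℕ} (hκ : m ≤ 2 ^ κ)
    (hnum : 4 * (deficiency X A S₀ * (2 * κ + 1) * ℓ) ≤ pool.card) (hpos : 0 < pool.card) :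
    ∃ S : SimpleGraph V, S ≤ G ∧ S.IsAcyclic ∧ (∀ v, S.dg v ≤ 2) ∧
      (∀ u ∈ X, u ∉ A → u ∉ pool → ∀ v, S.Adj u v ↔ S₀.Adj u v) ∧
      (∀ v, v ∉ X ∨ v ∈ A → S.dg v = 2) ∧ ∀ v ∈ pool, 1 ≤ S.dg v := by
  have key : ∀ d, d ≤ deficiency X A S₀ → ∃ (S : SimpleGraph V) (K : Finset V), S ≤ G ∧
      S.IsAcyclic ∧ (∀ v, S.dg v ≤ 2) ∧ K ⊆ A ∪ pool ∧
      (∀ u ∈ X, u ∉ K → ∀ v, S.Adj u v ↔ S₀.Adj u v) ∧ K.card ≤ d * (2 * κ + 1) ∧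
      deficiency X A S + d = deficiency X A S₀ ∧ ∀ v, S₀.dg v ≤ S.dg v := by
    intro d
    induction d with
    | zero => exact fun _ => ⟨S₀, ∅, hR.le, hS₀, hR.dg_le, by simp, by simp, by simp, by simp,
        fun _ => le_rfl⟩
    | succ d ih =>
      intro hd
      obtain ⟨S, K, h1, h2, h3, h4, h5, h6, h7, h8⟩ := ih (by omega)
      obtain ⟨T, K', t1, t2, t3, t4, t5, t6, t7, t8⟩ := hR.step h1 h2 h3 h4 h5 hm hκ (by
        refine le_trans ?_ hnum
        gcongr
        exact h6.trans (Nat.mul_le_mul_right _ (by omega))) hpos (by omega)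
      exact ⟨T, K', t1, t2, t3, t4, t5, by rw [add_mul]; omega, by omega,
        fun v => (h8 v).trans (t8 v)⟩
  obtain ⟨S, K, h1, h2, h3, h4, h5, h6, h7, h8⟩ := key _ le_rfl
  refine ⟨S, h1, h2, h3, ?_, ?_, ?_⟩
  · intro u hu hA hp
    refine h5 u hu fun hk => ?_
    rcases mem_union.1 (h4 hk) with h | h
    exacts [hA h, hp h]
  · intro v hv
    have h0 : deficiency X A S = 0 := by omega
    have := sum_eq_zero_iff.1 h0 v (by rw [mem_union, mem_compl]; exact hv)
    have := h3 v
    omega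
  · intro v hv
    have := h8 v; rw [hR.dg_pool v hv] at this; exact this

end Absorbing

/-! ### Matchings and gadgets. -/

section Closing

/-- In a 2-regular graph each component is the vertex set of a cycle, and here there is only one
component. -/
theorem isHamiltonian_of_dg_eq_two {V : Type*} [Fintype V] [DecidableEq V] [Nonempty V]
    {G R : SimpleGraph V}
    (hRG : R ≤ G) (h2 : ∀ v, R.dg v = 2) (hc : ∀ u v, R.Reachable u v) : G.IsHamiltonian := by
  intro _
  obtain ⟨v⟩ := ‹Nonempty V›
  have hcyc : R.IsCycles := by
    intro v _
    rw [← h2 v, dg, ← Set.ncard_coe_finset]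
    congr 1; ext w; simp
  obtain ⟨w, hw⟩ := dg_pos.1 (by rw [h2 v]; norm_num : 0 < R.dg v)
  obtain ⟨p, hp, hverts⟩ := hcyc.exists_cycle_toSubgraph_verts_eq_connectedComponentSupp
    (c := R.connectedComponentMk v) rfl ⟨w, hw⟩
  refine ⟨v, p.mapLe hRG, ?_⟩
  rw [Walk.isHamiltonianCycle_iff_isCycle_and_support_count_tail_eq_one]
  refine ⟨hp.mapLe hRG, fun a => ?_⟩
  have ha : a ∈ p.support := by
    rw [← Walk.mem_verts_toSubgraph, hverts]
    exact ConnectedComponent.sound (hc a v)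
  have hsup : (p.mapLe hRG).support = p.support := by simp [Walk.mapLe]
  rw [hsup]
  refine List.count_eq_one_of_mem hp.support_nodup ?_
  by_cases hav : a = v
  · subst hav; exact Walk.end_mem_tail_support hp.not_nil
  · rw [← Walk.cons_tail_support] at ha
    exact (List.mem_cons.1 ha).resolve_left hav

variable {V : Type*} [Fintype V]

theorem dg_sup {S T : SimpleGraph V} (h : ∀ u v, S.Adj u v → ¬ T.Adj u v) (v : V) :
    (S ⊔ T).dg v = S.dg v + T.dg v := by
  unfold dg
  rw [← card_union_of_disjoint]
  · congr 1; ext w; simp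
  · rw [Finset.disjoint_left]; intro w hw hw'
    simp only [mem_filter, mem_univ, true_and] at hw hw'
    exact h v w hw hw'

/-- `M` is a perfect matching of the set `D`. -/
def IsMat (M : SimpleGraph V) (D : Finset V) : Prop :=
  (∀ u v, M.Adj u v → u ∈ D) ∧ ∀ u ∈ D, M.dg u = 1

theorem IsMat.dg_eq_zero {M : SimpleGraph V} {D : Finset V} (h : IsMat M D) {u : V} (hu : u ∉ D) :
    M.dg u = 0 := by
  by_contra hn
  obtain ⟨w, hw⟩ := dg_pos.1 (Nat.pos_of_ne_zero hn)
  exact hu (h.1 u w hw)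

theorem IsMat.sup {M M' : SimpleGraph V} {D D' : Finset V} (h : IsMat M D) (h' : IsMat M' D')
    (hd : Disjoint D D') : IsMat (M ⊔ M') (D ∪ D') := by
  have hn : ∀ u v, M.Adj u v → ¬ M'.Adj u v := fun u v h1 h2 =>
    Finset.disjoint_left.1 hd (h.1 u v h1) (h'.1 u v h2)
  refine ⟨fun u v huv => ?_, fun u hu => ?_⟩
  · rcases huv with huv | huv
    exacts [mem_union_left _ (h.1 u v huv), mem_union_right _ (h'.1 u v huv)]
  · rw [dg_sup hn]
    rcases mem_union.1 hu with hu | hu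
    · rw [h.2 u hu, h'.dg_eq_zero (Finset.disjoint_left.1 hd hu)]
    · rw [h'.2 u hu, h.dg_eq_zero (Finset.disjoint_right.1 hd hu)]

/-- The graph with edges `f 0 f 1, f 2 f 3, …, f (2t-2) f (2t-1)`. -/
def pairG (f : ℕ → V) (t : ℕ) : SimpleGraph V where
  Adj u v := u ≠ v ∧ ∃ i < t, (u = f (2 * i) ∧ v = f (2 * i + 1)) ∨ (v = f (2 * i) ∧ u = f (2 * i + 1))
  symm := ⟨by
    rintro u v ⟨h, i, hi, h'⟩
    exact ⟨h.symm, i, hi, h'.symm⟩⟩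
  loopless := ⟨by rintro u ⟨h, _⟩; exact h rfl⟩

theorem isMat_pairG {f : ℕ → V} {t : ℕ} (hf : ∀ i < 2 * t, ∀ j < 2 * t, f i = f j → i = j) :
    IsMat (pairG f t) ((range (2 * t)).image f) := by
  constructor
  · rintro u v ⟨_, i, hi, ⟨rfl, _⟩ | ⟨_, rfl⟩⟩
    · exact mem_image_of_mem _ (mem_range.2 (by omega))
    · exact mem_image_of_mem _ (mem_range.2 (by omega))
  · intro u hu
    obtain ⟨k, hk, rfl⟩ := mem_image.1 hu
    rw [mem_range] at hk
    unfold dg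
    rw [card_eq_one]
    rcases Nat.even_or_odd' k with ⟨i, rfl | rfl⟩
    · refine ⟨f (2 * i + 1), ?_⟩
      ext w
      simp only [mem_filter, mem_univ, true_and, mem_singleton]
      constructor
      · rintro ⟨_, j, hj, ⟨h1, h2⟩ | ⟨h1, h2⟩⟩
        · have := hf _ hk _ (by omega) h1
          rw [h2]; congr 1; omega
        · have := hf _ hk _ (by omega) h2; omega
      · rintro rfl
        refine ⟨fun h => ?_, i, by omega, .inl ⟨rfl, rfl⟩⟩
        have := hf _ hk _ (by omega) h; omega
    · refine ⟨f (2 * i), ?_⟩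
      ext w
      simp only [mem_filter, mem_univ, true_and, mem_singleton]
      constructor
      · rintro ⟨_, j, hj, ⟨h1, h2⟩ | ⟨h1, h2⟩⟩
        · have := hf _ hk _ (by omega) h1; omega
        · have := hf _ hk _ (by omega) h2
          rw [h1]; congr 1; omega
      · rintro rfl
        refine ⟨fun h => ?_, i, by omega, .inr ⟨rfl, rfl⟩⟩
        have := hf _ hk _ (by omega) h; omega

theorem pairG_le {G : SimpleGraph V} {f : ℕ → V} {t : ℕ}
    (hf : ∀ i < t, G.Adj (f (2 * i)) (f (2 * i + 1))) : pairG f t ≤ G := by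
  rintro u v ⟨_, i, hi, ⟨rfl, rfl⟩ | ⟨rfl, rfl⟩⟩
  exacts [hf i hi, (hf i hi).symm]

theorem pairG_adj {f : ℕ → V} {t : ℕ} (hf : ∀ i < 2 * t, ∀ j < 2 * t, f i = f j → i = j) {i : ℕ}
    (hi : i < t) : (pairG f t).Adj (f (2 * i)) (f (2 * i + 1)) :=
  ⟨fun h => by have := hf _ (by omega) _ (by omega) h; omega, i, hi, .inl ⟨rfl, rfl⟩⟩

/-- Two internally disjoint paths `g true` and `g false` from `ga` to `gb`, each with `2 * κ` inner
vertices. -/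
structure Gadget (G : SimpleGraph V) (κ : ℕ) (ga gb : V) (g : Bool → ℕ → V) : Prop where
  pos : 0 < κ
  first : ∀ b, G.Adj ga (g b 0)
  adj : ∀ b j, j + 1 < 2 * κ → G.Adj (g b j) (g b (j + 1))
  last : ∀ b, G.Adj (g b (2 * κ - 1)) gb
  ne : ga ≠ gb
  ne_ga : ∀ b, ∀ j < 2 * κ, g b j ≠ ga
  ne_gb : ∀ b, ∀ j < 2 * κ, g b j ≠ gb
  inj : ∀ b, ∀ j < 2 * κ, ∀ b', ∀ j' < 2 * κ, g b j = g b' j' → b = b' ∧ j = j'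

/-- The vertices of a gadget. -/
noncomputable def gadSet (κ : ℕ) (ga gb : V) (g : Bool → ℕ → V) : Finset V :=
  {ga, gb} ∪ ((range (2 * κ)).image (g true) ∪ (range (2 * κ)).image (g false))

theorem mem_gadSet {κ : ℕ} {ga gb u : V} {g : Bool → ℕ → V} :
    u ∈ gadSet κ ga gb g ↔ u = ga ∨ u = gb ∨ ∃ b, ∃ j < 2 * κ, u = g b j := by
  simp only [gadSet, mem_union, mem_insert, mem_singleton, mem_image, mem_range]
  constructor
  · rintro ((h | h) | ⟨j, hj, h⟩ | ⟨j, hj, h⟩)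
    exacts [.inl h, .inr (.inl h), .inr (.inr ⟨true, j, hj, h.symm⟩),
      .inr (.inr ⟨false, j, hj, h.symm⟩)]
  · rintro (h | h | ⟨b, j, hj, h⟩)
    · exact .inl (.inl h)
    · exact .inl (.inr h)
    · cases b
      · exact .inr (.inr ⟨j, hj, h.symm⟩)
      · exact .inr (.inl ⟨j, hj, h.symm⟩)

/-- The path `ga, g 0, …, g (2 * κ - 1), gb`. -/
def fullPath (κ : ℕ) (ga gb : V) (g : ℕ → V) (j : ℕ) : V :=
  if j = 0 then ga else if j = 2 * κ + 1 then gb else g (j - 1)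

/-- The matching of a gadget in mode `b`. -/
def gadMat (κ : ℕ) (ga gb : V) (g : Bool → ℕ → V) (b : Bool) : SimpleGraph V :=
  pairG (fullPath κ ga gb (g b)) (κ + 1) ⊔ pairG (g !b) κ

section

variable {G : SimpleGraph V} {κ : ℕ} {ga gb : V} {g : Bool → ℕ → V}

theorem fullPath_zero {f : ℕ → V} : fullPath κ ga gb f 0 = ga := if_pos rfl

theorem fullPath_last {f : ℕ → V} : fullPath κ ga gb f (2 * κ + 1) = gb := by simp [fullPath]

theorem fullPath_mid {f : ℕ → V} {j : ℕ} (hj : j < 2 * κ) : fullPath κ ga gb f (j + 1) = f j := by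
  unfold fullPath; rw [if_neg (by omega), if_neg (by omega)]; rfl

theorem Gadget.fullPath_inj (h : Gadget G κ ga gb g) (b : Bool) :
    ∀ i < 2 * (κ + 1), ∀ j < 2 * (κ + 1), fullPath κ ga gb (g b) i = fullPath κ ga gb (g b) j →
      i = j := by
  intro i hi j hj heq
  unfold fullPath at heq
  have e1 := h.ne_ga b; have e2 := h.ne_gb b; have e3 := h.ne
  split_ifs at heq with h1 h2 h3 h4 h5 h6 h7 h8
  · omega
  · exact absurd heq e3
  · exact absurd heq.symm (e1 _ (by omega))
  · exact absurd heq.symm e3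
  · omega
  · exact absurd heq.symm (e2 _ (by omega))
  · exact absurd heq (e1 _ (by omega))
  · exact absurd heq (e2 _ (by omega))
  · have := (h.inj b _ (by omega) b _ (by omega) heq).2; omega

theorem Gadget.inj' (h : Gadget G κ ga gb g) (b : Bool) :
    ∀ i < 2 * κ, ∀ j < 2 * κ, g b i = g b j → i = j :=
  fun i hi j hj heq => (h.inj b i hi b j hj heq).2

/-- Each side has an even number of inner vertices, so side `b` together with both poles is matched
along its path, and so is the other side without the poles. -/
theorem Gadget.isMat (h : Gadget G κ ga gb g) (b : Bool) :
    IsMat (gadMat κ ga gb g b) (gadSet κ ga gb g) := by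
  have h1 := (isMat_pairG (h.fullPath_inj b)).sup (isMat_pairG (h.inj' !b)) (by
    rw [Finset.disjoint_left]
    intro x hx hx'
    obtain ⟨i, hi, rfl⟩ := mem_image.1 hx
    obtain ⟨j, hj, heq⟩ := mem_image.1 hx'
    rw [mem_range] at hi hj
    unfold fullPath at heq
    split_ifs at heq
    · exact h.ne_ga _ j hj heq
    · exact h.ne_gb _ j hj heq
    · have := (h.inj _ j hj _ _ (by omega) heq).1
      cases b <;> simp at this)
  have hset : gadSet κ ga gb g = (range (2 * (κ + 1))).image (fullPath κ ga gb (g b)) ∪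
      (range (2 * κ)).image (g !b) := ?_
  · rw [hset]; exact h1
  ext u
  rw [mem_gadSet, mem_union, mem_image, mem_image]
  constructor
  · rintro (rfl | rfl | ⟨b', j, hj, rfl⟩)
    · exact .inl ⟨0, by simp, fullPath_zero⟩
    · exact .inl ⟨2 * κ + 1, by simp; omega, fullPath_last⟩
    · by_cases hb : b' = b
      · subst hb
        exact .inl ⟨j + 1, by simp; omega, fullPath_mid hj⟩
      · have : b' = !b := by cases b <;> cases b' <;> simp_all
        subst this
        exact .inr ⟨j, by simpa using hj, rfl⟩
  · rintro (⟨i, hi, rfl⟩ | ⟨j, hj, rfl⟩)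
    · rw [mem_range] at hi
      unfold fullPath
      split_ifs
      · exact .inl rfl
      · exact .inr (.inl rfl)
      · exact .inr (.inr ⟨b, i - 1, by omega, rfl⟩)
    · exact .inr (.inr ⟨_, j, mem_range.1 hj, rfl⟩)

theorem Gadget.gadMat_le (h : Gadget G κ ga gb g) (b : Bool) : gadMat κ ga gb g b ≤ G := by
  have := h.pos
  refine sup_le (pairG_le fun i hi => ?_) (pairG_le fun i hi => h.adj _ _ (by omega))
  rcases Nat.eq_zero_or_pos i with rfl | hi0
  · rw [mul_zero, fullPath_zero, fullPath_mid (by omega)]; exact h.first b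
  · obtain ⟨k, rfl⟩ : ∃ k, i = k + 1 := ⟨i - 1, by omega⟩
    rw [show 2 * (k + 1) = 2 * k + 1 + 1 by ring, fullPath_mid (by omega)]
    by_cases hk : k + 1 = κ
    · rw [show 2 * k + 1 + 1 + 1 = 2 * κ + 1 by omega, fullPath_last,
        show 2 * k + 1 = 2 * κ - 1 by omega]
      exact h.last b
    · rw [fullPath_mid (by omega)]; exact h.adj b _ (by omega)

/-- Following the matched edges and the wires through a gadget. -/
theorem Gadget.reachable (h : Gadget G κ ga gb g) {b : Bool} {H : SimpleGraph V}
    (hH : gadMat κ ga gb g b ≤ H)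
    (hw : ∀ j, j + 1 < 2 * κ → H.Reachable (g true j) (g false j)) :
    (∀ j, j + 1 < 2 * κ → ∀ b', H.Reachable ga (g b' j)) ∧ H.Reachable ga (g (!b) (2 * κ - 1)) ∧
      H.Reachable (g b (2 * κ - 1)) gb := by
  have := h.pos
  have hw' : ∀ j, j + 1 < 2 * κ → ∀ b' b'', H.Reachable (g b' j) (g b'' j) := by
    intro j hj b' b''
    have h1 := hw j hj
    cases b' <;> cases b''
    exacts [.refl _, h1.symm, h1, .refl _]
  have inner : ∀ i < κ, H.Adj (g (!b) (2 * i)) (g (!b) (2 * i + 1)) := fun i hi =>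
    hH (.inr (pairG_adj (h.inj' !b) hi))
  have outer : ∀ i < κ + 1, H.Adj (fullPath κ ga gb (g b) (2 * i)) (fullPath κ ga gb (g b) (2 * i + 1)) :=
    fun i hi => hH (.inl (pairG_adj (h.fullPath_inj b) hi))
  -- The walk zigzags from `ga`: a matched edge forward on one side, a wire across, a matched edge
  -- forward on the other side. The parity of the index decides which side has the edge leading on.
  have key : ∀ j, j + 1 < 2 * κ → ∀ b', H.Reachable ga (g b' j) := by
    intro j
    induction j with
    | zero =>
      intro hj b'
      have h0 := outer 0 (by omega)
      rw [mul_zero, fullPath_zero, fullPath_mid (by omega)] at h0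
      exact h0.reachable.trans (hw' 0 hj b b')
    | succ j ih =>
      intro hj b'
      have ih := ih (by omega)
      rcases Nat.even_or_odd' j with ⟨i, rfl | rfl⟩
      · exact ((ih !b).trans (inner i (by omega)).reachable).trans (hw' _ hj _ _)
      · have h0 := outer (i + 1) (by omega)
        rw [show 2 * (i + 1) = 2 * i + 1 + 1 by ring, fullPath_mid (by omega),
          fullPath_mid (by omega)] at h0
        exact ((ih b).trans h0.reachable).trans (hw' _ hj _ _)
  refine ⟨key, ?_, ?_⟩
  · have h1 := key (2 * (κ - 1)) (by omega) (!b)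
    have h2 := inner (κ - 1) (by omega)
    rw [show 2 * (κ - 1) + 1 = 2 * κ - 1 by omega] at h2
    exact h1.trans h2.reachable
  · have h0 := outer κ (by omega)
    rw [fullPath_last, show 2 * κ = 2 * κ - 1 + 1 by omega, fullPath_mid (by omega)] at h0
    exact h0.reachable

/-- In one of the two modes all vertices of a gadget lie in the same component. -/
theorem Gadget.exists_mode (h : Gadget G κ ga gb g) {Q : SimpleGraph V}
    (h1 : ∀ u ∈ gadSet κ ga gb g, Q.dg u = 1) (h2 : ∀ u, u ∉ gadSet κ ga gb g → Q.dg u = 2)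
    (hw : ∀ j, j + 1 < 2 * κ → Q.Reachable (g true j) (g false j)) :
    ∃ b, ∀ u ∈ gadSet κ ga gb g, (Q ⊔ gadMat κ ga gb g b).Reachable ga u := by
  have hpos := h.pos
  have hga : ga ∈ gadSet κ ga gb g := mem_gadSet.2 (.inl rfl)
  have hgm : ∀ b, ∀ j < 2 * κ, g b j ∈ gadSet κ ga gb g := fun b j hj =>
    mem_gadSet.2 (.inr (.inr ⟨b, j, hj, rfl⟩))
  have hmax : ∀ v, Q.dg v ≤ 2 := fun v => by
    by_cases hv : v ∈ gadSet κ ga gb g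
    · rw [h1 v hv]; norm_num
    · rw [h2 v hv]
  -- The component of `ga` in `Q` is a path, and its other end `w` must be a gadget vertex too. The
  -- position of `w` dictates the mode.
  obtain ⟨w, hwne, hwr, hwo⟩ := exists_reachable_odd (S := Q) (u := ga) (by rw [h1 ga hga]; exact odd_one)
  have hwD : w ∈ gadSet κ ga gb g := by
    by_contra hn
    rw [h2 w hn] at hwo
    exact absurd hwo (by decide)
  have finish : ∀ b, (Q ⊔ gadMat κ ga gb g b).Reachable ga gb →
      ∀ u ∈ gadSet κ ga gb g, (Q ⊔ gadMat κ ga gb g b).Reachable ga u := by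
    intro b hb u hu
    obtain ⟨r1, r2, r3⟩ := h.reachable (b := b) (H := Q ⊔ gadMat κ ga gb g b) le_sup_right
      (fun j hj => (hw j hj).mono le_sup_left)
    rcases mem_gadSet.1 hu with rfl | rfl | ⟨b', j, hj, rfl⟩
    · exact .refl _
    · exact hb
    · by_cases hj' : j + 1 < 2 * κ
      · exact r1 j hj' b'
      · obtain rfl : j = 2 * κ - 1 := by omega
        by_cases hb' : b' = b
        · subst hb'; exact hb.trans r3.symm
        · have : b' = !b := by cases b <;> cases b' <;> simp_all
          subst this; exact r2
  rcases mem_gadSet.1 hwD with rfl | rfl | ⟨b, j, hj, rfl⟩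
  · exact absurd rfl hwne
  · exact ⟨true, finish true (hwr.mono le_sup_left)⟩
  · by_cases hj' : j + 1 < 2 * κ
    -- At a wired index, both ends of the wire and `ga` would be three ends in one component.
    · exfalso
      have hr : ∀ b', Q.Reachable ga (g b' j) := by
        intro b'
        have := hw j hj'
        cases b <;> cases b'
        exacts [hwr, hwr.trans this.symm, hwr.trans this, hwr]
      have hne : g true j ≠ g false j := fun he => by
        have := (h.inj true j hj false j hj he).1; simp at this
      exact not_three_ends hmax (h.ne_ga true j hj).symm (h.ne_ga false j hj).symm hne
        (h1 _ hga).le (h1 _ (hgm true j hj)).le (h1 _ (hgm false j hj)).le (hr true) (hr false)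
    · obtain rfl : j = 2 * κ - 1 := by omega
      -- Outside the gadget `ga` is tied to the last vertex of side `b`, and mode `b` matches
      -- precisely that vertex with `gb`.
      refine ⟨b, finish b ((hwr.mono le_sup_left).trans ?_)⟩
      exact (h.reachable (b := b) (H := Q ⊔ gadMat κ ga gb g b) le_sup_right
        (fun j hj => (hw j hj).mono le_sup_left)).2.2

end

end Closing

/-! ### Choosing the modes of all gadgets. -/

section Modes

variable {V : Type*} [Fintype V] {G : SimpleGraph V} {ι : Type*} {κ : ℕ} {ga gb : ι → V}
  {g : ι → Bool → ℕ → V}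

/-- The union of the matchings of the gadgets in `s` with modes `μ`. -/
def modesG (κ : ℕ) (ga gb : ι → V) (g : ι → Bool → ℕ → V) (s : Finset ι) (μ : ι → Bool) :
    SimpleGraph V where
  Adj u v := ∃ i ∈ s, (gadMat κ (ga i) (gb i) (g i) (μ i)).Adj u v
  symm := ⟨fun _ _ ⟨i, hi, h⟩ => ⟨i, hi, h.symm⟩⟩
  loopless := ⟨fun u ⟨i, _, h⟩ => (gadMat κ (ga i) (gb i) (g i) (μ i)).loopless.irrefl u h⟩

theorem isMat_modesG (h : ∀ i, Gadget G κ (ga i) (gb i) (g i))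
    (hd : ∀ i j, i ≠ j → Disjoint (gadSet κ (ga i) (gb i) (g i)) (gadSet κ (ga j) (gb j) (g j)))
    (s : Finset ι) (μ : ι → Bool) :
    IsMat (modesG κ ga gb g s μ) (s.biUnion fun i => gadSet κ (ga i) (gb i) (g i)) := by
  constructor
  · rintro u v ⟨i, hi, huv⟩
    exact mem_biUnion.2 ⟨i, hi, ((h i).isMat (μ i)).1 u v huv⟩
  · intro u hu
    obtain ⟨i, hi, hui⟩ := mem_biUnion.1 hu
    rw [← ((h i).isMat (μ i)).2 u hui]
    refine dg_congr fun v => ⟨?_, fun hv => ⟨i, hi, hv⟩⟩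
    rintro ⟨j, hj, huv⟩
    by_cases hij : i = j
    · subst hij; exact huv
    · exact absurd (((h j).isMat (μ j)).1 u v huv) (Finset.disjoint_left.1 (hd i j hij) hui)

theorem modesG_update {s : Finset ι} {μ : ι → Bool} {i : ι} (hi : i ∈ s) (b : Bool) :
    modesG κ ga gb g s (Function.update μ i b) =
      modesG κ ga gb g (s.erase i) μ ⊔ gadMat κ (ga i) (gb i) (g i) b := by
  ext u v
  rw [sup_adj]
  constructor
  · rintro ⟨j, hj, h⟩
    by_cases hij : j = i
    · subst hij; rw [Function.update_self] at h; exact .inr h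
    · rw [Function.update_of_ne hij] at h; exact .inl ⟨j, mem_erase.2 ⟨hij, hj⟩, h⟩
  · rintro (⟨j, hj, h⟩ | h)
    · refine ⟨j, mem_of_mem_erase hj, ?_⟩
      rw [Function.update_of_ne (ne_of_mem_erase hj)]; exact h
    · refine ⟨i, hi, ?_⟩
      rw [Function.update_self]; exact h

/-- The modes can be chosen such that each gadget lies in a single component. -/
theorem exists_modes [Fintype ι] (h : ∀ i, Gadget G κ (ga i) (gb i) (g i))
    (hd : ∀ i j, i ≠ j → Disjoint (gadSet κ (ga i) (gb i) (g i)) (gadSet κ (ga j) (gb j) (g j)))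
    {Q : SimpleGraph V} (h1 : ∀ i, ∀ u ∈ gadSet κ (ga i) (gb i) (g i), Q.dg u = 1)
    (h2 : ∀ u, (∀ i, u ∉ gadSet κ (ga i) (gb i) (g i)) → Q.dg u = 2)
    (hno : ∀ i j, ∀ u ∈ gadSet κ (ga i) (gb i) (g i), ∀ v ∈ gadSet κ (ga j) (gb j) (g j), ¬ Q.Adj u v)
    (hw : ∀ i j, j + 1 < 2 * κ → Q.Reachable (g i true j) (g i false j)) :
    ∃ μ : ι → Bool, (∀ u, (Q ⊔ modesG κ ga gb g univ μ).dg u = 2) ∧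
      ∀ i, ∀ u ∈ gadSet κ (ga i) (gb i) (g i), (Q ⊔ modesG κ ga gb g univ μ).Reachable (ga i) u := by
  have hdg : ∀ (s : Finset ι) μ u, (Q ⊔ modesG κ ga gb g s μ).dg u =
      Q.dg u + (modesG κ ga gb g s μ).dg u := by
    intro s μ u
    refine dg_sup ?_ u
    rintro u v huv ⟨i, _, h'⟩
    exact hno i i u (((h i).isMat _).1 u v h') v (((h i).isMat _).1 v u h'.symm) huv
  have key : ∀ t : Finset ι, ∃ μ : ι → Bool, ∀ i ∈ t, ∀ u ∈ gadSet κ (ga i) (gb i) (g i),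
      (Q ⊔ modesG κ ga gb g univ μ).Reachable (ga i) u := by
    intro t
    induction t using Finset.induction_on with
    | empty => exact ⟨fun _ => true, by simp⟩
    | insert i t hi ih =>
      obtain ⟨μ, hμ⟩ := ih
      set Q' := Q ⊔ modesG κ ga gb g (univ.erase i) μ with hQ'
      have hm := isMat_modesG h hd (univ.erase i) μ
      obtain ⟨b, hb⟩ := (h i).exists_mode (Q := Q')
        (by
          intro u hu
          rw [hdg, h1 i u hu, hm.dg_eq_zero]
          intro hn
          obtain ⟨j, hj, huj⟩ := mem_biUnion.1 hn
          exact Finset.disjoint_left.1 (hd i j (ne_of_mem_erase hj).symm) hu huj)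
        (by
          intro u hu
          rw [hdg]
          by_cases hex : ∃ j, u ∈ gadSet κ (ga j) (gb j) (g j)
          · obtain ⟨j, hj⟩ := hex
            rw [h1 j u hj, hm.2 u (mem_biUnion.2 ⟨j, mem_erase.2 ⟨by rintro rfl; exact hu hj,
              mem_univ _⟩, hj⟩)]
          · push Not at hex
            rw [h2 u hex, hm.dg_eq_zero]
            intro hn
            obtain ⟨j, _, huj⟩ := mem_biUnion.1 hn
            exact hex j huj)
        (fun j hj => (hw i j hj).mono le_sup_left)
      have e1 : Q ⊔ modesG κ ga gb g univ (Function.update μ i b) =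
          Q' ⊔ gadMat κ (ga i) (gb i) (g i) b := by
        rw [modesG_update (mem_univ i), hQ', sup_assoc]
      have e2 : Q ⊔ modesG κ ga gb g univ μ = Q' ⊔ gadMat κ (ga i) (gb i) (g i) (μ i) := by
        rw [hQ', sup_assoc, ← modesG_update (mem_univ i), Function.update_eq_self]
      -- Changing the mode of gadget `i` loses only edges inside that gadget, whose vertices now
      -- form part of one component. Connections already achieved survive.
      have trans : ∀ u v, (Q ⊔ modesG κ ga gb g univ μ).Reachable u v →
          (Q' ⊔ gadMat κ (ga i) (gb i) (g i) b).Reachable u v := by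
        rintro u v ⟨p⟩
        induction p with
        | nil => exact .refl _
        | @cons u w v hadj p ih =>
          refine Reachable.trans ?_ ih
          rw [e2] at hadj
          rcases hadj with hadj | hadj
          · exact Adj.reachable (.inl hadj)
          · exact (hb u (((h i).isMat _).1 u w hadj)).symm.trans
              (hb w (((h i).isMat _).1 w u hadj.symm))
      refine ⟨Function.update μ i b, ?_⟩
      rw [e1]
      intro j hj u hu
      rcases mem_insert.1 hj with rfl | hj
      · exact hb u hu
      · exact trans _ _ (hμ j hj u hu)
  obtain ⟨μ, hμ⟩ := key univ
  refine ⟨μ, fun u => ?_, fun i => hμ i (mem_univ i)⟩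
  have hm := isMat_modesG h hd univ μ
  rw [hdg]
  by_cases hex : ∃ j, u ∈ gadSet κ (ga j) (gb j) (g j)
  · obtain ⟨j, hj⟩ := hex
    rw [h1 j u hj, hm.2 u (mem_biUnion.2 ⟨j, mem_univ _, hj⟩)]
  · push Not at hex
    rw [h2 u hex, hm.dg_eq_zero]
    intro hn
    obtain ⟨j, _, huj⟩ := mem_biUnion.1 hn
    exact hex j huj

/-- A linear forest whose ends are the vertices of a chain of wired gadgets and a matchable set can
be closed up to a Hamilton cycle. -/
theorem exists_factor_of_gadgets {q : ℕ} [NeZero q] {ga gb : Fin q → V}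
    {g : Fin q → Bool → ℕ → V}
    (h : ∀ i, Gadget G κ (ga i) (gb i) (g i))
    (hd : ∀ i j, i ≠ j →
      Disjoint (gadSet κ (ga i) (gb i) (g i)) (gadSet κ (ga j) (gb j) (g j)))
    {S M : SimpleGraph V} {D : Finset V} (hSG : S ≤ G) (hMG : M ≤ G) (hS : S.IsAcyclic)
    (hM : IsMat M D)
    (hDd : ∀ i, Disjoint (gadSet κ (ga i) (gb i) (g i)) D)
    (h1 : ∀ i, ∀ u ∈ gadSet κ (ga i) (gb i) (g i), S.dg u = 1) (h1' : ∀ u ∈ D, S.dg u = 1)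
    (h2 : ∀ u, (∀ i, u ∉ gadSet κ (ga i) (gb i) (g i)) → u ∉ D → S.dg u = 2)
    (hno : ∀ u v, S.dg u = 1 → S.dg v = 1 → ¬ S.Adj u v)
    (hw : ∀ i j, j + 1 < 2 * κ → S.Reachable (g i true j) (g i false j))
    (hchain : ∀ i, S.Reachable (gb i) (ga (i + 1)))
    (hD : ∀ u ∈ D, ∃ i, ∃ v ∈ gadSet κ (ga i) (gb i) (g i), S.Reachable u v) :
    ∃ R : SimpleGraph V, R ≤ G ∧ (∀ v, R.dg v = 2) ∧ ∀ u v, R.Reachable u v := by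
  have hno' : ∀ u v, S.Adj u v → ¬ M.Adj u v := fun u v hS hM' =>
    hno u v (h1' u (hM.1 u v hM')) (h1' v (hM.1 v u hM'.symm)) hS
  have hdg := dg_sup hno'
  obtain ⟨μ, hμ2, hμ⟩ := exists_modes (Q := S ⊔ M) h hd
    (fun i u hu => by
      rw [hdg, h1 i u hu, hM.dg_eq_zero (Finset.disjoint_left.1 (hDd i) hu)])
    (fun u hu => by
      rw [hdg]
      by_cases huD : u ∈ D
      · rw [h1' u huD, hM.2 u huD]
      · rw [h2 u hu huD, hM.dg_eq_zero huD])
    (by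
      rintro i j u hu v hv (hadj | hadj)
      · exact hno u v (h1 i u hu) (h1 j v hv) hadj
      · exact Finset.disjoint_left.1 (hDd i) hu (hM.1 u v hadj))
    (fun i j hj => (hw i j hj).mono le_sup_left)
  set R := S ⊔ M ⊔ modesG κ ga gb g univ μ with hR
  have hSR : S ≤ R := le_sup_left.trans le_sup_left
  have hgb : ∀ i, R.Reachable (ga i) (gb i) := fun i => hμ i (gb i) (mem_gadSet.2 (.inr (.inl rfl)))
  have hga0 : ∀ n, R.Reachable (ga 0) (ga (Fin.ofNat q n)) := by
    intro n
    induction n with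
    | zero => exact .refl _
    | succ n ih =>
      have e : Fin.ofNat q (n + 1) = Fin.ofNat q n + 1 := by
        ext; simp [Fin.val_add]
      rw [e]
      exact (ih.trans (hgb _)).trans ((hchain _).mono hSR)
  have hgad : ∀ i, ∀ u ∈ gadSet κ (ga i) (gb i) (g i), R.Reachable (ga 0) u := by
    intro i u hu
    have := hga0 i
    rw [Fin.ofNat_val_eq_self] at this
    exact this.trans (hμ i u hu)
  -- Each component of the forest has an end, which lies in a gadget or is tied to one.
  have hall : ∀ u, R.Reachable (ga 0) u := by
    intro u
    obtain ⟨w, hw, hw1⟩ := exists_reachable_dg_le_one hS u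
    refine Reachable.trans ?_ (hw.mono hSR).symm
    by_cases hex : ∃ i, w ∈ gadSet κ (ga i) (gb i) (g i)
    · obtain ⟨i, hwi⟩ := hex
      exact hgad i w hwi
    · push Not at hex
      by_cases hwD : w ∈ D
      · obtain ⟨i, v, hv, hr⟩ := hD w hwD
        exact (hgad i v hv).trans (hr.mono hSR).symm
      · have := h2 w hex hwD; omega
  refine ⟨R, ?_, hμ2, fun u v => (hall u).symm.trans (hall v)⟩
  refine sup_le (sup_le hSG hMG) ?_
  rintro u v ⟨i, _, huv⟩
  exact (h i).gadMat_le _ huv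

end Modes

/-! ### Matching the columns together with the unused tops. -/

section Columns

variable {V : Type*} [Fintype V] {G : SimpleGraph V} {κ N : ℕ} {γ z : ℕ → V}

theorem IsMat.extend {M : SimpleGraph V} {D D' : Finset V} {f : ℕ → V} {t : ℕ} (hM : IsMat M D)
    (hMG : M ≤ G) (hf : ∀ i < 2 * t, ∀ j < 2 * t, f i = f j → i = j)
    (hadj : ∀ i < t, G.Adj (f (2 * i)) (f (2 * i + 1))) (hfD : ∀ i < 2 * t, f i ∉ D)
    (hD' : ∀ x, x ∈ D' ↔ x ∈ D ∨ ∃ i < 2 * t, f i = x) : ∃ M' ≤ G, IsMat M' D' := by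
  have : D' = D ∪ (range (2 * t)).image f := by
    ext x; rw [hD' x, mem_union, mem_image]; simp only [mem_range]
  refine ⟨M ⊔ pairG f t, sup_le hMG (pairG_le hadj), ?_⟩
  rw [this]
  refine hM.sup (isMat_pairG hf) ?_
  rw [Finset.disjoint_right]
  intro x hx
  obtain ⟨i, hi, rfl⟩ := mem_image.1 hx
  exact hfD i (mem_range.1 hi)

/-- The vertices of a path `γ` made of `N` columns, together with evenly many column tops `z c`,
can be perfectly matched. -/
theorem exists_column_matching (hκ : 0 < κ)
    (hinj : ∀ i < 4 * κ * N, ∀ j < 4 * κ * N, γ i = γ j → i = j)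
    (hzinj : ∀ i < N, ∀ j < N, z i = z j → i = j) (hγz : ∀ i < 4 * κ * N, ∀ c < N, γ i ≠ z c)
    (hadj : ∀ i, i + 1 < 4 * κ * N → G.Adj (γ i) (γ (i + 1)))
    (hz0 : ∀ c < N, G.Adj (z c) (γ (4 * κ * c)))
    (hz1 : ∀ c < N, G.Adj (z c) (γ (4 * κ * c + (2 * κ - 1)))) (U : ℕ → Prop)
    (heven : Even ((range N).filter U).card) :
    ∃ M ≤ G, IsMat M ((range (4 * κ * N)).image γ ∪ ((range N).filter U).image z) := by
  -- The invariant: after `c` columns the path is matched completely if the number of chosen tops so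
  -- far is even, and except for its last vertex if it is odd. A chosen top switches between the two
  -- states, because it closes an odd cycle with the first 2κ vertices of its column.
  have key : ∀ c ≤ N,
      (Even ((range c).filter U).card → ∃ M ≤ G,
        IsMat M ((range (4 * κ * c)).image γ ∪ ((range c).filter U).image z)) ∧
      (Odd ((range c).filter U).card → 0 < c ∧ ∃ M ≤ G,
        IsMat M ((range (4 * κ * c - 1)).image γ ∪ ((range c).filter U).image z)) := by
    intro c
    induction c with
    | zero =>
      intro _
      refine ⟨fun _ => ⟨⊥, bot_le, by intro u v h; simp at h, by simp⟩, fun h => ?_⟩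
      simp at h
    | succ c ih =>
      intro hc
      have hcN : 4 * κ * (c + 1) ≤ 4 * κ * N := Nat.mul_le_mul_left _ hc
      have e4 : 4 * κ * (c + 1) = 4 * κ * c + 4 * κ := by ring
      obtain ⟨ih1, ih2⟩ := ih (by omega)
      by_cases hU : U c
      · have hf : (range (c + 1)).filter U = insert c ((range c).filter U) := by
          rw [range_add_one, filter_insert, if_pos hU]
        have hcn : c ∉ (range c).filter U := by simp
        rw [hf, card_insert_of_notMem hcn, image_insert]
        constructor
        · intro he
          obtain ⟨hc0, M, hMG, hM⟩ := ih2 (by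
            rw [← Nat.not_even_iff_odd]; exact fun h => (Nat.even_add_one.1 he) h)
          have hbig : 4 * κ ≤ 4 * κ * c := Nat.le_mul_of_pos_right _ hc0
          -- The leftover vertex and the first half of the column make 2κ + 1 vertices, the last of
          -- which is matched with the top; the second half is matched within itself.
          let f : ℕ → V := fun j => if j ≤ 2 * κ then γ (4 * κ * c - 1 + j) else
            if j = 2 * κ + 1 then z c else γ (4 * κ * c + (j - 2))
          have f1 : ∀ j, j ≤ 2 * κ → f j = γ (4 * κ * c - 1 + j) := fun j hj => if_pos hj
          have f2 : f (2 * κ + 1) = z c := by simp [f]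
          have f3 : ∀ j, 2 * κ + 1 < j → f j = γ (4 * κ * c + (j - 2)) := fun j hj => by
            simp only [f]; rw [if_neg (by omega), if_neg (by omega)]
          have fcase : ∀ j < 2 * (2 * κ + 1), (j = 2 * κ + 1 ∧ f j = z c) ∨
              ∃ k, j ≠ 2 * κ + 1 ∧ f j = γ k ∧ 4 * κ * c - 1 ≤ k ∧ k < 4 * κ * (c + 1) ∧
                ((j ≤ 2 * κ ∧ k = 4 * κ * c - 1 + j) ∨ (2 * κ + 1 < j ∧ k = 4 * κ * c + (j - 2))) := by
            intro j hj
            rcases Nat.lt_trichotomy j (2 * κ + 1) with h | h | h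
            · exact .inr ⟨_, by omega, f1 j (by omega), by omega, by omega, .inl ⟨by omega, rfl⟩⟩
            · exact .inl ⟨h, h ▸ f2⟩
            · exact .inr ⟨_, by omega, f3 j h, by omega, by omega, .inr ⟨h, rfl⟩⟩
          refine hM.extend (f := f) (t := 2 * κ + 1) hMG ?_ ?_ ?_ ?_
          · intro i hi j hj heq
            rcases fcase i hi with ⟨a1, a2⟩ | ⟨k, a1, a2, a3, a4, a5⟩ <;>
              rcases fcase j hj with ⟨b1, b2⟩ | ⟨l, b1, b2, b3, b4, b5⟩
            · omega
            · rw [a2, b2] at heq; exact absurd heq.symm (hγz l (by omega) c (by omega))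
            · rw [a2, b2] at heq; exact absurd heq (hγz k (by omega) c (by omega))
            · rw [a2, b2] at heq
              have := hinj k (by omega) l (by omega) heq
              omega
          · intro i hi
            rcases Nat.lt_trichotomy i κ with h | h | h
            · rw [f1 _ (by omega), f1 _ (by omega)]; exact hadj _ (by omega)
            · subst h
              rw [f1 _ le_rfl, f2, show 4 * i * c - 1 + 2 * i = 4 * i * c + (2 * i - 1) by omega]
              exact (hz1 c (by omega)).symm
            · rw [f3 _ (by omega), f3 _ (by omega), show 2 * i + 1 - 2 = 2 * i - 2 + 1 by omega]
              exact hadj _ (by omega)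
          · intro i hi hmem
            rw [mem_union, mem_image, mem_image] at hmem
            rcases fcase i hi with ⟨a1, a2⟩ | ⟨k, a1, a2, a3, a4, a5⟩
            · rcases hmem with ⟨l, hl, he⟩ | ⟨l, hl, he⟩
              · rw [mem_range] at hl; rw [a2] at he
                exact hγz l (by omega) c (by omega) he
              · rw [mem_filter, mem_range] at hl; rw [a2] at he
                have := hzinj l (by omega) c (by omega) he; omega
            · rcases hmem with ⟨l, hl, he⟩ | ⟨l, hl, he⟩
              · rw [mem_range] at hl; rw [a2] at he
                have := hinj l (by omega) k (by omega) he; omega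
              · rw [mem_filter, mem_range] at hl; rw [a2] at he
                exact hγz k (by omega) l (by omega) he.symm
          · intro x
            simp only [mem_union, mem_image, mem_insert, mem_range]
            constructor
            · rintro (⟨l, hl, rfl⟩ | rfl | h)
              · by_cases h1 : l < 4 * κ * c - 1
                · exact .inl (.inl ⟨l, h1, rfl⟩)
                · by_cases h2 : l < 4 * κ * c + 2 * κ
                  · refine .inr ⟨l - (4 * κ * c - 1), by omega, ?_⟩
                    rw [f1 _ (by omega)]; congr 1; omega
                  · refine .inr ⟨l - 4 * κ * c + 2, by omega, ?_⟩
                    rw [f3 _ (by omega)]; congr 1; omega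
              · exact .inr ⟨2 * κ + 1, by omega, f2⟩
              · exact .inl (.inr h)
            · rintro ((⟨l, hl, rfl⟩ | h) | ⟨i, hi, rfl⟩)
              · exact .inl ⟨l, by omega, rfl⟩
              · exact .inr (.inr h)
              · rcases fcase i hi with ⟨a1, a2⟩ | ⟨k, a1, a2, a3, a4, a5⟩
                · exact .inr (.inl a2)
                · exact .inl ⟨k, by omega, a2.symm⟩
        · intro ho
          obtain ⟨M, hMG, hM⟩ := ih1 (by
            rw [← Nat.not_odd_iff_even]; exact fun h => (Nat.odd_add_one.1 ho) h)
          refine ⟨by omega, ?_⟩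
          -- The top takes the first vertex of the column, which leaves its last vertex over.
          let f : ℕ → V := fun j => if j = 0 then z c else γ (4 * κ * c + (j - 1))
          have f1 : f 0 = z c := if_pos rfl
          have f2 : ∀ j, 0 < j → f j = γ (4 * κ * c + (j - 1)) := fun j hj => if_neg (by omega)
          refine hM.extend (f := f) (t := 2 * κ) hMG ?_ ?_ ?_ ?_
          · intro i hi j hj heq
            rcases Nat.eq_zero_or_pos i with h | h <;> rcases Nat.eq_zero_or_pos j with h' | h'
            · omega
            · rw [h, f1, f2 j h'] at heq; exact absurd heq.symm (hγz _ (by omega) c (by omega))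
            · rw [h', f1, f2 i h] at heq; exact absurd heq (hγz _ (by omega) c (by omega))
            · rw [f2 i h, f2 j h'] at heq
              have := hinj _ (by omega) _ (by omega) heq; omega
          · intro i hi
            rcases Nat.eq_zero_or_pos i with h | h
            · subst h
              rw [mul_zero, f1, f2 _ (by omega)]; exact hz0 c (by omega)
            · rw [f2 _ (by omega), f2 _ (by omega),
                show 2 * i + 1 - 1 = 2 * i - 1 + 1 by omega]
              exact hadj _ (by omega)
          · intro i hi hmem
            rw [mem_union, mem_image, mem_image] at hmem
            rcases Nat.eq_zero_or_pos i with h | h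
            · rw [h, f1] at hmem
              rcases hmem with ⟨l, hl, he⟩ | ⟨l, hl, he⟩
              · rw [mem_range] at hl
                exact hγz l (by omega) c (by omega) he
              · rw [mem_filter, mem_range] at hl
                have := hzinj l (by omega) c (by omega) he; omega
            · rw [f2 i h] at hmem
              rcases hmem with ⟨l, hl, he⟩ | ⟨l, hl, he⟩
              · rw [mem_range] at hl
                have := hinj l (by omega) _ (by omega) he; omega
              · rw [mem_filter, mem_range] at hl
                exact hγz _ (by omega) l (by omega) he.symm
          · intro x
            simp only [mem_union, mem_image, mem_insert, mem_range]
            constructor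
            · rintro (⟨l, hl, rfl⟩ | rfl | h)
              · by_cases h1 : l < 4 * κ * c
                · exact .inl (.inl ⟨l, h1, rfl⟩)
                · refine .inr ⟨l - 4 * κ * c + 1, by omega, ?_⟩
                  rw [f2 _ (by omega)]; congr 1; omega
              · exact .inr ⟨0, by omega, f1⟩
              · exact .inl (.inr h)
            · rintro ((⟨l, hl, rfl⟩ | h) | ⟨i, hi, rfl⟩)
              · exact .inl ⟨l, by omega, rfl⟩
              · exact .inr (.inr h)
              · rcases Nat.eq_zero_or_pos i with h | h
                · rw [h, f1]; exact .inr (.inl rfl)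
                · rw [f2 i h]; exact .inl ⟨_, by omega, rfl⟩
      · have hf : (range (c + 1)).filter U = (range c).filter U := by
          rw [range_add_one, filter_insert, if_neg hU]
        rw [hf]
        have step : ∀ a, (a = 4 * κ * c ∨ a + 1 = 4 * κ * c) → (∃ M ≤ G,
            IsMat M ((range a).image γ ∪ ((range c).filter U).image z)) → ∃ M ≤ G,
            IsMat M ((range (a + 4 * κ)).image γ ∪ ((range c).filter U).image z) := by
          rintro a ha ⟨M, hMG, hM⟩
          refine hM.extend (f := fun j => γ (a + j)) (t := 2 * κ) hMG ?_ ?_ ?_ ?_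
          · intro i hi j hj heq
            have := hinj _ (by omega) _ (by omega) heq; omega
          · intro i hi
            exact hadj _ (by omega)
          · intro i hi hmem
            rw [mem_union, mem_image, mem_image] at hmem
            rcases hmem with ⟨l, hl, he⟩ | ⟨l, hl, he⟩
            · rw [mem_range] at hl
              have := hinj l (by omega) _ (by omega) he; omega
            · rw [mem_filter, mem_range] at hl
              exact hγz _ (by omega) l (by omega) he.symm
          · intro x
            simp only [mem_union, mem_image, mem_range]
            constructor
            · rintro (⟨l, hl, rfl⟩ | h)
              · by_cases h1 : l < a
                · exact .inl (.inl ⟨l, h1, rfl⟩)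
                · exact .inr ⟨l - a, by omega, by congr 1; omega⟩
              · exact .inl (.inr h)
            · rintro ((⟨l, hl, rfl⟩ | h) | ⟨i, hi, rfl⟩)
              · exact .inl ⟨l, by omega, rfl⟩
              · exact .inr h
              · exact .inl ⟨a + i, by omega, rfl⟩
        constructor
        · intro he
          rw [e4]; exact step _ (.inl rfl) (ih1 he)
        · intro ho
          obtain ⟨hc0, hM⟩ := ih2 ho
          have hbig : 4 * κ ≤ 4 * κ * c := Nat.le_mul_of_pos_right _ hc0
          refine ⟨by omega, ?_⟩
          rw [e4, show 4 * κ * c + 4 * κ - 1 = 4 * κ * c - 1 + 4 * κ by omega]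
          exact step _ (.inr (by omega)) hM
  exact (key N le_rfl).1 heven

end Columns

/-! ### The linear forest formed by pieces and wires. -/

section PathSystem

variable {V : Type*} [Fintype V]

/-- A system of disjoint pieces `p (k * ℓ), …, p (k * ℓ + ℓ - 1)` for `k < M` and wires
`f w 0, …, f w t` such that wires are disjoint from each other and meet pieces only in their last
vertex, which is then an end of the piece. -/
structure PathSystem (M ℓ t : ℕ) (p : ℕ → V) {W : Type*} (f : W → ℕ → V) : Prop where
  two_le : 2 ≤ ℓ
  pos : 2 ≤ t
  p_inj : ∀ i < M * ℓ, ∀ j < M * ℓ, p i = p j → i = j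
  f_inj : ∀ w, ∀ i ≤ t, ∀ w', ∀ j ≤ t, f w i = f w' j → w = w' ∧ i = j
  meet : ∀ w, ∀ j ≤ t, ∀ k < M * ℓ, f w j = p k → j = t ∧ (k % ℓ = 0 ∨ (k + 1) % ℓ = 0)
  ends : ∀ k < M * ℓ, (k % ℓ = 0 ∨ (k + 1) % ℓ = 0) → ∃ w, f w t = p k

/-- `v` is the predecessor of `u` on its piece or wire. -/
def Pred (M ℓ t : ℕ) (p : ℕ → V) {W : Type*} (f : W → ℕ → V) (u v : V) : Prop :=
  (∃ k, k + 1 < M * ℓ ∧ (k + 1) % ℓ ≠ 0 ∧ u = p (k + 1) ∧ v = p k) ∨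
    ∃ w j, j + 1 ≤ t ∧ u = f w j ∧ v = f w (j + 1)

variable {M ℓ t : ℕ} {p : ℕ → V} {W : Type*} {f : W → ℕ → V}

/-- The rank is the position on a piece, and `ℓ` plus the distance to the terminal on a wire. With
uniqueness of predecessors this yields acyclicity without a description of the components. -/
theorem PathSystem.exists_rank (h : PathSystem M ℓ t p f) :
    ∃ r : V → ℕ, ∀ u v, Pred M ℓ t p f u v → r v < r u := by
  have hex : ∀ x, ∃ ρ : ℕ, (∀ k < M * ℓ, x = p k → ρ = k % ℓ) ∧
      ((∀ k < M * ℓ, x ≠ p k) → ∀ w, ∀ j ≤ t, x = f w j → ρ = ℓ + (t - j)) := by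
    intro x
    by_cases h1 : ∃ k < M * ℓ, x = p k
    · obtain ⟨k, hk, rfl⟩ := h1
      refine ⟨k % ℓ, fun k' hk' he => by rw [h.p_inj k hk k' hk' he], fun hn => absurd rfl (hn k hk)⟩
    · push Not at h1
      by_cases h2 : ∃ w, ∃ j ≤ t, x = f w j
      · obtain ⟨w, j, hj, rfl⟩ := h2
        refine ⟨ℓ + (t - j), fun k hk he => absurd he (h1 k hk), fun _ w' j' hj' he => ?_⟩
        rw [(h.f_inj w j hj w' j' hj' he).2]
      · push Not at h2
        exact ⟨0, fun k hk he => absurd he (h1 k hk), fun _ w j hj he => absurd he (h2 w j hj)⟩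
  choose r hr using hex
  have hℓ := h.two_le
  refine ⟨r, ?_⟩
  rintro u v (⟨k, hk, hmod, rfl, rfl⟩ | ⟨w, j, hj, rfl, rfl⟩)
  · rw [(hr _).1 k (by omega) rfl, (hr _).1 (k + 1) hk rfl]
    have h1 := Nat.div_add_mod k ℓ
    have h2 := Nat.mod_lt k (show 0 < ℓ by omega)
    have h3 : (k + 1) % ℓ = (k % ℓ + 1) % ℓ := by simp [Nat.add_mod]
    rw [h3] at hmod ⊢
    rcases Nat.lt_or_ge (k % ℓ + 1) ℓ with h4 | h4
    · rw [Nat.mod_eq_of_lt h4]; omega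
    · rw [show k % ℓ + 1 = ℓ by omega, Nat.mod_self] at hmod
      exact absurd rfl hmod
  · have h1 : r (f w j) = ℓ + (t - j) := (hr _).2 (fun k hk he => by
      have := (h.meet w j (by omega) k hk he).1; omega) w j (by omega) rfl
    rw [h1]
    by_cases h2 : ∃ k < M * ℓ, f w (j + 1) = p k
    · obtain ⟨k, hk, he⟩ := h2
      rw [(hr _).1 k hk he]
      have := Nat.mod_lt k (show 0 < ℓ by omega)
      omega
    · push Not at h2
      rw [(hr _).2 h2 w (j + 1) hj rfl]; omega

theorem PathSystem.pred_unique (h : PathSystem M ℓ t p f) {u v v' : V}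
    (h1 : Pred M ℓ t p f u v) (h2 : Pred M ℓ t p f u v') : v = v' := by
  rcases h1 with ⟨k, hk, hmod, rfl, rfl⟩ | ⟨w, j, hj, rfl, rfl⟩ <;>
    rcases h2 with ⟨k', hk', hmod', he, rfl⟩ | ⟨w', j', hj', he, rfl⟩
  · have := h.p_inj _ hk _ hk' he
    rw [show k = k' by omega]
  · have := (h.meet w' j' (by omega) _ hk he.symm).1; omega
  · have := (h.meet w j (by omega) _ hk' he).1; omega
  · obtain ⟨rfl, rfl⟩ := h.f_inj w j (by omega) w' j' (by omega) he
    rfl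

/-- The graph formed by the pieces and the wires. -/
def pathSystemG (h : PathSystem M ℓ t p f) : SimpleGraph V where
  Adj u v := Pred M ℓ t p f u v ∨ Pred M ℓ t p f v u
  symm := ⟨fun _ _ h => h.symm⟩
  loopless := ⟨fun u hu => by
    obtain ⟨r, hr⟩ := h.exists_rank
    have := hr u u (hu.elim id id)
    omega⟩

/-- A graph with a rank function such that each vertex has at most one neighbour of no larger rank
has no cycle. -/
theorem isAcyclic_of_rank {S F : SimpleGraph V} {X : V → Prop} {r : V → ℕ} (hF : F.IsAcyclic)
    (hX : ∀ u v, S.Adj u v → X u → X v) (hSF : ∀ u v, S.Adj u v → ¬ X u → F.Adj u v)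
    (hr : ∀ u v v', X u → S.Adj u v → S.Adj u v' → r v ≤ r u → r v' ≤ r u → v = v') :
    S.IsAcyclic := by
  intro u c hc
  have hXr : ∀ a b, S.Reachable a b → X a → X b := by
    rintro a b ⟨q⟩
    induction q with
    | nil => exact id
    | cons h _ ih => exact fun ha => ih (hX _ _ h ha)
  by_cases hu : X u
  -- At a vertex of maximal rank on the cycle, both cycle neighbours have rank at most its own, so
  -- they would coincide.
  · obtain ⟨w, hw, hmax⟩ := exists_max_image c.support.toFinset r ⟨u, by simp⟩
    rw [List.mem_toFinset] at hw
    have hc' := hc.rotate hw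
    set d := c.rotate w hw with hd
    have hsup : ∀ x ∈ d.support, r x ≤ r w := by
      intro x hx
      refine hmax x ?_
      rw [List.mem_toFinset]
      exact (c.mem_support_rotate_iff w hw).1 hx
    have hXw : X w := hXr u w (c.takeUntil w hw).reachable hu
    refine hc'.snd_ne_penultimate (hr w _ _ hXw (d.adj_snd hc'.not_nil)
      (d.adj_penultimate hc'.not_nil).symm (hsup _ ?_) (hsup _ ?_))
    · exact d.getVert_mem_support _
    · exact d.getVert_mem_support _
  · have hedge : ∀ e ∈ c.edges, e ∈ F.edgeSet := by
      intro e he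
      induction e using Sym2.ind with
      | _ a b =>
        have hadj := c.adj_of_mem_edges he
        refine hSF a b hadj fun ha => hu ?_
        have hm := c.fst_mem_support_of_mem_edges he
        exact hXr a u (c.takeUntil a hm).reachable.symm ha
    exact hF _ (hc.transfer hedge)

variable (h : PathSystem M ℓ t p f)

theorem PathSystem.rank_aux {r : V → ℕ} (hr : ∀ u v, Pred M ℓ t p f u v → r v < r u) {u v v' : V}
    (h1 : (pathSystemG h).Adj u v) (h2 : (pathSystemG h).Adj u v') (hv : r v ≤ r u)
    (hv' : r v' ≤ r u) : v = v' := by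
  rcases h1 with h1 | h1
  · rcases h2 with h2 | h2
    · exact h.pred_unique h1 h2
    · have := hr _ _ h2; omega
  · have := hr _ _ h1; omega

theorem PathSystem.adj_wire_iff {w : W} {j : ℕ} (hj : j < t) (v : V) :
    (pathSystemG h).Adj (f w j) v ↔ v = f w (j + 1) ∨ (0 < j ∧ v = f w (j - 1)) := by
  constructor
  · rintro ((⟨k, hk, hmod, he, rfl⟩ | ⟨w', j', hj', he, rfl⟩) |
      (⟨k, hk, hmod, rfl, he⟩ | ⟨w', j', hj', rfl, he⟩))
    · have := (h.meet w j (by omega) _ hk he).1; omega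
    · obtain ⟨rfl, rfl⟩ := h.f_inj w j (by omega) w' j' (by omega) he
      exact .inl rfl
    · have := (h.meet w j (by omega) _ (by omega) he).1; omega
    · obtain ⟨rfl, rfl⟩ := h.f_inj w j (by omega) w' (j' + 1) (by omega) he
      exact .inr ⟨by omega, rfl⟩
  · rintro (rfl | ⟨h0, rfl⟩)
    · exact .inl (.inr ⟨w, j, by omega, rfl, rfl⟩)
    · exact .inr (.inr ⟨w, j - 1, by omega, rfl, by rw [Nat.sub_add_cancel h0]⟩)

theorem PathSystem.adj_last_iff {w : W} (hw : ∀ k < M * ℓ, f w t ≠ p k) (v : V) :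
    (pathSystemG h).Adj (f w t) v ↔ v = f w (t - 1) := by
  have hpos := h.pos
  constructor
  · rintro ((⟨k, hk, hmod, he, rfl⟩ | ⟨w', j', hj', he, rfl⟩) |
      (⟨k, hk, hmod, rfl, he⟩ | ⟨w', j', hj', rfl, he⟩))
    · exact absurd he (hw _ hk)
    · have := (h.f_inj w t le_rfl w' j' (by omega) he).2; omega
    · exact absurd he (hw _ (by omega))
    · obtain ⟨rfl, h2⟩ := h.f_inj w t le_rfl w' (j' + 1) (by omega) he
      rw [h2]; rfl
  · rintro rfl
    exact .inr (.inr ⟨w, t - 1, by omega, rfl, by rw [Nat.sub_add_cancel (by omega)]⟩)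

theorem PathSystem.adj_piece_iff {k : ℕ} (hk : k < M * ℓ) (v : V) :
    (pathSystemG h).Adj (p k) v ↔ (k + 1 < M * ℓ ∧ (k + 1) % ℓ ≠ 0 ∧ v = p (k + 1)) ∨
      (k % ℓ ≠ 0 ∧ v = p (k - 1)) ∨ ∃ w, f w t = p k ∧ v = f w (t - 1) := by
  have hpos := h.pos
  constructor
  · rintro ((⟨k', hk', hmod, he, rfl⟩ | ⟨w', j', hj', he, rfl⟩) |
      (⟨k', hk', hmod, rfl, he⟩ | ⟨w', j', hj', rfl, he⟩))
    · obtain rfl := h.p_inj k hk _ hk' he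
      exact .inr (.inl ⟨hmod, rfl⟩)
    · have := (h.meet w' j' (by omega) k hk he.symm).1; omega
    · obtain rfl := h.p_inj k hk _ (by omega) he
      exact .inl ⟨hk', hmod, rfl⟩
    · have := (h.meet w' (j' + 1) hj' k hk he.symm).1
      refine .inr (.inr ⟨w', ?_, ?_⟩)
      · rw [← this]; exact he.symm
      · rw [← this]; rfl
  · rintro (⟨h1, h2, rfl⟩ | ⟨h1, rfl⟩ | ⟨w, h1, rfl⟩)
    · exact .inr (.inl ⟨k, h1, h2, rfl, rfl⟩)
    · have : 0 < k := by rcases Nat.eq_zero_or_pos k with rfl | h0; · simp at h1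
                         · exact h0
      refine .inl (.inl ⟨k - 1, ?_, ?_, ?_, rfl⟩) <;> rw [Nat.sub_add_cancel this]
      exacts [hk, h1]
    · rw [← h1]
      exact .inr (.inr ⟨w, t - 1, by omega, rfl, by rw [Nat.sub_add_cancel (by omega)]⟩)

theorem PathSystem.dg_first (w : W) : (pathSystemG h).dg (f w 0) = 1 := by
  have hpos := h.pos
  unfold dg
  rw [card_eq_one]
  refine ⟨f w 1, ?_⟩
  ext v
  simp only [mem_filter, mem_univ, true_and, mem_singleton]
  rw [h.adj_wire_iff (by omega)]
  simp

theorem PathSystem.dg_last {w : W} (hw : ∀ k < M * ℓ, f w t ≠ p k) :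
    (pathSystemG h).dg (f w t) = 1 := by
  unfold dg
  rw [card_eq_one]
  refine ⟨f w (t - 1), ?_⟩
  ext v
  simp only [mem_filter, mem_univ, true_and, mem_singleton]
  exact h.adj_last_iff hw v

theorem PathSystem.dg_inner {w : W} {j : ℕ} (h0 : 0 < j) (hj : j < t) :
    (pathSystemG h).dg (f w j) = 2 := by
  unfold dg
  rw [card_eq_two]
  refine ⟨f w (j + 1), f w (j - 1), fun he => ?_, ?_⟩
  · have := (h.f_inj w _ (by omega) w _ (by omega) he).2; omega
  · ext v
    simp only [mem_filter, mem_univ, true_and, mem_singleton, mem_insert]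
    rw [h.adj_wire_iff hj]; simp [h0]

theorem PathSystem.dg_piece {k : ℕ} (hk : k < M * ℓ) : (pathSystemG h).dg (p k) = 2 := by
  have hpos := h.pos
  have hℓ := h.two_le
  have hnext : (k + 1) % ℓ ≠ 0 → k + 1 < M * ℓ := by
    intro hne
    by_contra hge
    have : k + 1 = M * ℓ := by omega
    exact hne (by rw [this]; simp)
  have hw1 : ∀ w, ∀ i < M * ℓ, f w (t - 1) ≠ p i := fun w i hi he => by
    have := (h.meet w (t - 1) (by omega) i hi he).1; omega
  unfold dg
  rw [card_eq_two]
  by_cases h1 : k % ℓ = 0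
  · have h2 : (k + 1) % ℓ ≠ 0 := by
      rw [Nat.add_mod, h1, zero_add, Nat.mod_mod, Nat.mod_eq_of_lt (by omega)]; omega
    obtain ⟨w, hw⟩ := h.ends k hk (.inl h1)
    refine ⟨p (k + 1), f w (t - 1), (hw1 w _ (hnext h2)).symm, ?_⟩
    ext v
    simp only [mem_filter, mem_univ, true_and, mem_singleton, mem_insert]
    rw [h.adj_piece_iff hk]
    constructor
    · rintro (h3 | h3 | ⟨w', h3, rfl⟩)
      · exact .inl h3.2.2
      · exact absurd h1 h3.1
      · rw [(h.f_inj w' t le_rfl w t le_rfl (h3.trans hw.symm)).1]; exact .inr rfl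
    · rintro (rfl | rfl)
      · exact .inl ⟨hnext h2, h2, rfl⟩
      · exact .inr (.inr ⟨w, hw, rfl⟩)
  · have hk0 : 0 < k := by
      rcases Nat.eq_zero_or_pos k with rfl | h0
      · simp at h1
      · exact h0
    by_cases h2 : (k + 1) % ℓ = 0
    · obtain ⟨w, hw⟩ := h.ends k hk (.inr h2)
      refine ⟨p (k - 1), f w (t - 1), (hw1 w _ (by omega)).symm, ?_⟩
      ext v
      simp only [mem_filter, mem_univ, true_and, mem_singleton, mem_insert]
      rw [h.adj_piece_iff hk]
      constructor
      · rintro (h3 | h3 | ⟨w', h3, rfl⟩)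
        · exact absurd h2 h3.2.1
        · exact .inl h3.2
        · rw [(h.f_inj w' t le_rfl w t le_rfl (h3.trans hw.symm)).1]; exact .inr rfl
      · rintro (rfl | rfl)
        · exact .inr (.inl ⟨h1, rfl⟩)
        · exact .inr (.inr ⟨w, hw, rfl⟩)
    · refine ⟨p (k + 1), p (k - 1), fun he => ?_, ?_⟩
      · have := h.p_inj _ (hnext h2) _ (by omega) he; omega
      · ext v
        simp only [mem_filter, mem_univ, true_and, mem_singleton, mem_insert]
        rw [h.adj_piece_iff hk]
        constructor
        · rintro (h3 | h3 | ⟨w', h3, rfl⟩)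
          · exact .inl h3.2.2
          · exact .inr h3.2
          · rcases (h.meet w' t le_rfl k hk h3).2 with h4 | h4
            exacts [absurd h4 h1, absurd h4 h2]
        · rintro (rfl | rfl)
          · exact .inl ⟨hnext h2, h2, rfl⟩
          · exact .inr (.inl ⟨h1, rfl⟩)

/-- A labelling of the components of the path system. -/
theorem PathSystem.exists_label (v₀ : V) : ∃ cp : V → V,
    (∀ u v, (pathSystemG h).Adj u v → cp u = cp v) ∧
    (∀ k < M * ℓ, cp (p k) = p (k / ℓ * ℓ)) ∧
    (∀ w, (∀ k < M * ℓ, f w t ≠ p k) → cp (f w t) = f w t) ∧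
    ∀ x, (∀ k < M * ℓ, x ≠ p k) → (∀ w, ∀ j ≤ t, x ≠ f w j) → cp x = v₀ := by
  have hbase : ∀ x, ∃ y, (∀ k < M * ℓ, x = p k → y = p (k / ℓ * ℓ)) ∧
      ((∀ k < M * ℓ, x ≠ p k) → y = x) := by
    intro x
    by_cases h1 : ∃ k < M * ℓ, x = p k
    · obtain ⟨k, hk, rfl⟩ := h1
      exact ⟨p (k / ℓ * ℓ), fun k' hk' he => by rw [h.p_inj k hk k' hk' he],
        fun hn => absurd rfl (hn k hk)⟩
    · push Not at h1
      exact ⟨x, fun k hk he => absurd he (h1 k hk), fun _ => rfl⟩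
  choose base hb using hbase
  have hex : ∀ x, ∃ y, (∀ w, ∀ j ≤ t, x = f w j → y = base (f w t)) ∧
      ((∀ w, ∀ j ≤ t, x ≠ f w j) → (∀ k < M * ℓ, x = p k → y = base x) ∧
        ((∀ k < M * ℓ, x ≠ p k) → y = v₀)) := by
    intro x
    by_cases h1 : ∃ w, ∃ j ≤ t, x = f w j
    · obtain ⟨w, j, hj, rfl⟩ := h1
      refine ⟨base (f w t), fun w' j' hj' he => ?_, fun hn => absurd rfl (hn w j hj)⟩
      rw [(h.f_inj w j hj w' j' hj' he).1]
    · push Not at h1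
      by_cases h2 : ∃ k < M * ℓ, x = p k
      · obtain ⟨k, hk, he⟩ := h2
        exact ⟨base x, fun w j hj he => absurd he (h1 w j hj), fun _ => ⟨fun _ _ _ => rfl,
          fun hn => absurd he (hn k hk)⟩⟩
      · push Not at h2
        exact ⟨v₀, fun w j hj he => absurd he (h1 w j hj), fun _ =>
          ⟨fun k hk he => absurd he (h2 k hk), fun _ => rfl⟩⟩
  choose cp hcp using hex
  have hw : ∀ w, ∀ j ≤ t, cp (f w j) = base (f w t) := fun w j hj => (hcp _).1 w j hj rfl
  have hp : ∀ k < M * ℓ, cp (p k) = p (k / ℓ * ℓ) := by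
    intro k hk
    by_cases h1 : ∃ w, ∃ j ≤ t, p k = f w j
    · obtain ⟨w, j, hj, he⟩ := h1
      have hjt := (h.meet w j hj k hk he.symm).1
      subst hjt
      rw [he, hw w j le_rfl]
      exact (hb _).1 k hk he.symm
    · push Not at h1
      rw [((hcp _).2 h1).1 k hk rfl]
      exact (hb _).1 k hk rfl
  have hpred : ∀ u v, Pred M ℓ t p f u v → cp u = cp v := by
    rintro u v (⟨k, hk, hmod, rfl, rfl⟩ | ⟨w, j, hj, rfl, rfl⟩)
    · rw [hp _ hk, hp k (by omega), Nat.succ_div_of_not_dvd fun hd => hmod (Nat.mod_eq_zero_of_dvd hd)]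
    · rw [hw w j (by omega), hw w (j + 1) hj]
  refine ⟨cp, ?_, hp, ?_, ?_⟩
  · rintro u v (huv | huv)
    exacts [hpred u v huv, (hpred v u huv).symm]
  · intro w hn
    rw [hw w t le_rfl]; exact (hb _).2 hn
  · intro x h1 h2
    exact ((hcp x).2 h2).2 h1

end PathSystem

/-! ### Exceptional sets and rounds of simultaneous routing. -/

section Rounds

variable {V : Type*} [Fintype V] {G : SimpleGraph V} {m : ℕ}

/-- Outside a small exceptional set `B`, sets expand into the part of `A` that is `H`-far
from `B`. -/
theorem Joined.exists_exceptional (hj : Joined G m) {H : SimpleGraph V} (hH : ∀ v, H.dg v ≤ 2)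
    {A : Finset V} (hA : 49 * m < A.card) :
    ∃ B : Finset V, B.card < m ∧ ∀ U : Finset V, Disjoint U B → U.card ≤ m → U.Nonempty →
      20 * U.card < (nbr G U ∩ (A \ nearS H B)).card := by
  -- A largest set with few neighbours in its own allowed region: any disjoint set with too few
  -- neighbours could be added to it.
  obtain ⟨B, hB, hmax⟩ := exists_max_image
    (univ.filter fun B : Finset V => B.card ≤ 2 * m ∧
      (nbr G B ∩ (A \ nearS H B)).card ≤ 20 * B.card) card
    ⟨∅, by rw [mem_filter]; simp [nbr]⟩
  simp only [mem_filter, mem_univ, true_and] at hB hmax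
  -- With m ≤ |B| ≤ 2m, the set `A` would have at most 20|B| + 3|B| + (|B| + m) ≤ 49m vertices.
  have hBm : B.card < m := by
    by_contra! hge
    have h1 := hj.card_le hge
    have h2 := card_nearS_le hH B
    have h3 : A ⊆ (nbr G B ∩ (A \ nearS H B)) ∪ nearS H B ∪ (univ \ nbr G B) := by
      intro x hx
      simp only [mem_union, mem_inter, mem_sdiff, mem_univ, true_and]
      tauto
    have h4 := card_le_card h3
    have h5 := card_union_le (nbr G B ∩ (A \ nearS H B) ∪ nearS H B) (univ \ nbr G B)
    have h6 := card_union_le (nbr G B ∩ (A \ nearS H B)) (nearS H B)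
    have h7 : (univ \ nbr G B).card + (nbr G B).card = Fintype.card V := by
      rw [card_sdiff_add_card_eq_card (subset_univ _), card_univ]
    omega
  refine ⟨B, hBm, fun U hU hUm hne => ?_⟩
  by_contra! hcon
  have hc : (B ∪ U).card = B.card + U.card := card_union_of_disjoint hU.symm
  have h1 := hmax (B ∪ U) ⟨by omega, ?_⟩
  · have := hne.card_pos; omega
  · have hsub : nbr G (B ∪ U) ∩ (A \ nearS H (B ∪ U)) ⊆
        (nbr G B ∩ (A \ nearS H B)) ∪ (nbr G U ∩ (A \ nearS H B)) := by
      intro x hx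
      simp only [mem_inter, mem_sdiff, mem_union, nearS, mem_filter, mem_univ, true_and, mem_nbr] at hx ⊢
      obtain ⟨⟨u, hu, hux⟩, hxA, hn⟩ := hx
      have hn' : ¬ (x ∈ B ∨ ∃ t ∈ B, H.Adj t x) := by
        rintro (h | ⟨t, ht, h⟩)
        exacts [hn (.inl (.inl h)), hn (.inr ⟨t, .inl ht, h⟩)]
      rcases hu with hu | hu
      exacts [.inl ⟨⟨u, hu, hux⟩, hxA, hn'⟩, .inr ⟨⟨u, hu, hux⟩, hxA, hn'⟩]
    have := card_le_card hsub
    have := card_union_le (nbr G B ∩ (A \ nearS H B)) (nbr G U ∩ (A \ nearS H B))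
    omega

/-- Extends an embedding `ν` by disjoint paths joining prescribed pairs of embedded points, each
point being used at most twice. -/
theorem Extendable.exists_round {T ι : Type*} [Fintype T] [Fintype ι] {ν : T → V}
    (hν : Function.Injective ν) {C : ℤ} (h : Extendable G m (univ.image ν) fun _ => C) (hC : C ≤ 20)
    (hC2 : 2 ≤ C) (hj : Joined G m) (hm : 0 < m) (a b : ι → T)
    (hcnt : ∀ t, (univ.filter fun i => a i = t).card + (univ.filter fun i => b i = t).card ≤ 2)
    {κ : ℕ} (hκ : m ≤ 2 ^ κ)
    (hX : Fintype.card T + Fintype.card ι * (2 * (κ + 1)) + 2 * 2 ^ (κ + 1) + 44 * m ≤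
      Fintype.card V) :
    ∃ P : ι → ℕ → V,
      Function.Injective (Sum.elim ν fun x : ι × Fin (2 * (κ + 1)) => P x.1 x.2) ∧
      (∀ i, G.Adj (ν (a i)) (P i 0)) ∧
      (∀ i j, j + 1 < 2 * (κ + 1) → G.Adj (P i j) (P i (j + 1))) ∧
      (∀ i, G.Adj (P i (2 * (κ + 1) - 1)) (ν (b i))) ∧
      Extendable G m (univ.image (Sum.elim ν fun x : ι × Fin (2 * (κ + 1)) => P x.1 x.2))
        fun _ => C - 2 := by
  have hf : ∀ (g : ι → T) t, (univ.filter fun i => ν (g i) = ν t) = univ.filter fun i => g i = t :=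
    fun g t => by simp only [hν.eq_iff]
  have himg : (univ.image ν).card = Fintype.card T := by
    rw [card_image_of_injective _ hν, card_univ]
  obtain ⟨P, N, hP, hinj, hN, -, hext⟩ := h.exists_links hj hm (fun _ => hC) (univ : Finset ι)
    (a := fun i => ν (a i)) (b := fun i => ν (b i)) (fun i => mem_image_of_mem _ (mem_univ _))
    (fun i => mem_image_of_mem _ (mem_univ _)) (fun _ _ => hC2) (by
      intro u hu
      obtain ⟨t, -, rfl⟩ := mem_image.1 hu
      rw [hf, hf]
      have := hcnt t
      omega) hκ (by rw [himg, card_univ]; exact hX)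
  refine ⟨P, ?_, fun i => (hP i (mem_univ _)).first, fun i => (hP i (mem_univ _)).adj,
    fun i => (hP i (mem_univ _)).last, ?_⟩
  · refine hν.sumElim ?_ ?_
    · rintro ⟨i, j⟩ ⟨i', j'⟩ he
      obtain ⟨h1, h2⟩ := hinj i (mem_univ _) j j.2 i' (mem_univ _) j' j'.2 he
      exact Prod.ext h1 (Fin.ext h2)
    · rintro t ⟨i, j⟩ he
      exact (hP i (mem_univ _)).notMem j j.2 (he ▸ mem_image_of_mem _ (mem_univ _))
  · refine hext.anti ?_ fun u => ?_
    · intro x hx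
      obtain ⟨t | ⟨i, j⟩, -, rfl⟩ := mem_image.1 hx
      · exact mem_union_left _ (mem_image_of_mem _ (mem_univ _))
      · exact mem_union_right _ ((hN _).2 ⟨i, mem_univ _, j, j.2, rfl⟩)
    · by_cases hu : u ∈ univ.image ν
      · obtain ⟨t, -, rfl⟩ := mem_image.1 hu
        have hn : ν t ∉ N := by
          intro hn
          obtain ⟨i, -, j, hj, he⟩ := (hN _).1 hn
          exact (hP i (mem_univ _)).notMem j hj (he ▸ hu)
        rw [hf, hf, if_neg hn]
        have := hcnt t
        omega
      · have h0 : ∀ g : ι → T, (univ.filter fun i => ν (g i) = u).card = 0 := by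
          intro g
          rw [card_eq_zero, filter_eq_empty_iff]
          intro i _ hi
          exact hu (hi ▸ mem_image_of_mem _ (mem_univ _))
        rw [h0, h0]
        split_ifs <;> omega

/-- The path `ν a, P 0, …, P (L - 1), ν b` as a sequence. -/
def wire (L : ℕ) (a b : V) (P : ℕ → V) (j : ℕ) : V :=
  if j = 0 then a else if j = L + 1 then b else P (j - 1)

theorem wire_zero {L : ℕ} {a b : V} {P : ℕ → V} : wire L a b P 0 = a := by simp [wire]

theorem wire_last {L : ℕ} {a b : V} {P : ℕ → V} : wire L a b P (L + 1) = b := by simp [wire]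

theorem wire_inner {L : ℕ} {a b : V} {P : ℕ → V} {j : ℕ} (hj : j < L) :
    wire L a b P (j + 1) = P j := by
  simp [wire]; omega

theorem wire_cases {L : ℕ} (a b : V) (P : ℕ → V) {j : ℕ} (hj : j ≤ L + 1) :
    (j = 0 ∧ wire L a b P j = a) ∨ (j = L + 1 ∧ wire L a b P j = b) ∨
      ∃ i < L, j = i + 1 ∧ wire L a b P j = P i := by
  rcases Nat.eq_zero_or_pos j with rfl | h0
  · exact .inl ⟨rfl, wire_zero⟩
  · rcases Nat.eq_or_lt_of_le hj with rfl | h1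
    · exact .inr (.inl ⟨rfl, wire_last⟩)
    · obtain ⟨i, rfl⟩ := Nat.exists_eq_add_of_lt h0
      rw [zero_add] at *
      exact .inr (.inr ⟨i, by omega, rfl, wire_inner (by omega)⟩)

theorem wire_adj {L : ℕ} {a b : V} {P : ℕ → V} (hL : 0 < L) (h0 : G.Adj a (P 0))
    (h1 : ∀ j, j + 1 < L → G.Adj (P j) (P (j + 1))) (h2 : G.Adj (P (L - 1)) b) {j : ℕ}
    (hj : j < L + 1) : G.Adj (wire L a b P j) (wire L a b P (j + 1)) := by
  rcases Nat.eq_zero_or_pos j with rfl | hj0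
  · rw [wire_zero, wire_inner hL]; exact h0
  · obtain ⟨i, rfl⟩ := Nat.exists_eq_add_of_lt hj0
    rw [zero_add] at *
    rw [wire_inner (by omega)]
    rcases Nat.lt_or_ge (i + 1) L with h3 | h3
    · rw [wire_inner h3]; exact h1 i h3
    · obtain rfl : i = L - 1 := by omega
      rw [show L - 1 + 1 = L by omega, wire_last]; exact h2

end Rounds

/-! ### Combinatorial description of the frame. -/

section Sites

/-- The residue of `k` as an element of `Fin n`. -/
def toFin {n : ℕ} (h : 0 < n) (k : ℕ) : Fin n := ⟨k % n, Nat.mod_lt _ h⟩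

theorem toFin_val {n : ℕ} (h : 0 < n) {k : ℕ} (hk : k < n) : (toFin h k : ℕ) = k :=
  Nat.mod_eq_of_lt hk

theorem toFin_coe {n : ℕ} (h : 0 < n) (k : Fin n) : toFin h k = k :=
  Fin.ext (Nat.mod_eq_of_lt k.2)

theorem toFin_inj {n : ℕ} (h : 0 < n) {i j : ℕ} (hi : i < n) (hj : j < n)
    (he : toFin h i = toFin h j) : i = j := by
  have := congrArg Fin.val he
  rwa [toFin_val h hi, toFin_val h hj] at this

theorem add_one_eq_toFin {n : ℕ} [NeZero n] (h : 0 < n) (i : Fin n) : i + 1 = toFin h (i + 1) := by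
  apply Fin.ext
  simp [toFin, Fin.val_add]

/-- Pairs to be joined in the first round: ears at the `z`-vertices and the two sides of each
gadget. -/
abbrev FirstJob (M q : ℕ) : Type := Fin (2 * M) ⊕ Fin q × Bool

/-- Vertices of the pieces, the `z`-vertices and the poles of the gadgets. -/
abbrev BaseSite (M ℓ q : ℕ) : Type := Fin (M * ℓ) ⊕ (Fin (2 * M) ⊕ Fin q × Bool)

/-- All vertices of the frame that do not lie inside a wire. -/
abbrev Site (M ℓ q K : ℕ) : Type :=
  (BaseSite M ℓ q ⊕ FirstJob M q × Fin (2 * K)) ⊕ Fin (2 * M) × Fin (2 * K)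

/-- The wires: across a gadget, from a gadget to the next one, and from a gadget to a terminal. -/
abbrev WireIx (q K : ℕ) : Type := Fin q × Fin (2 * K - 1) ⊕ (Fin q ⊕ Fin q × Bool)

/-- The terminals: ears, links, ends of pieces, and `z`-vertices. -/
abbrev Term (M K : ℕ) : Type :=
  (Fin (2 * M) × Fin (2 * K) ⊕ Fin (2 * M) × Fin (2 * K)) ⊕ (Fin M × Bool ⊕ Fin (2 * M))

variable {M ℓ q K : ℕ}

abbrev siteP (k : Fin (M * ℓ)) : Site M ℓ q K := .inl (.inl (.inl k))
abbrev siteZ (c : Fin (2 * M)) : Site M ℓ q K := .inl (.inl (.inr (.inl c)))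
abbrev sitePole (i : Fin q) (b : Bool) : Site M ℓ q K := .inl (.inl (.inr (.inr (i, b))))
abbrev siteEar (c : Fin (2 * M)) (j : Fin (2 * K)) : Site M ℓ q K := .inl (.inr (.inl c, j))
abbrev siteG (i : Fin q) (b : Bool) (j : Fin (2 * K)) : Site M ℓ q K := .inl (.inr (.inr (i, b), j))
abbrev siteLk (c : Fin (2 * M)) (j : Fin (2 * K)) : Site M ℓ q K := .inr (c, j)

theorem pieceEnd_lt (hℓ : 2 ≤ ℓ) (k : Fin M) (b : Bool) :
    (if b then k.1 * ℓ else k.1 * ℓ + (ℓ - 1)) < M * ℓ := by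
  have h1 : (k.1 + 1) * ℓ ≤ M * ℓ := Nat.mul_le_mul_right _ k.2
  rw [add_mul, one_mul] at h1
  split_ifs <;> omega

/-- The position of an end of a piece. -/
def pieceEnd (hℓ : 2 ≤ ℓ) (k : Fin M) (b : Bool) : Fin (M * ℓ) := ⟨_, pieceEnd_lt hℓ k b⟩

theorem pieceEnd_inj (hℓ : 2 ≤ ℓ) {k k' : Fin M} {b b' : Bool}
    (h : pieceEnd hℓ k b = pieceEnd hℓ k' b') : k = k' ∧ b = b' := by
  have h1 := congrArg Fin.val h
  simp only [pieceEnd] at h1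
  have hd : ∀ (k : Fin M) (b : Bool), (if b then k.1 * ℓ else k.1 * ℓ + (ℓ - 1)) / ℓ = k.1 := by
    intro k b
    split_ifs
    · exact Nat.mul_div_cancel _ (by omega)
    · rw [mul_comm, Nat.mul_add_div (by omega), Nat.div_eq_of_lt (by omega), add_zero]
  have h2 := congrArg (· / ℓ) h1
  simp only [hd] at h2
  obtain rfl := Fin.ext h2
  refine ⟨rfl, ?_⟩
  cases b <;> cases b' <;> simp at h1 ⊢ <;> omega

theorem pieceEnd_mod (hℓ : 2 ≤ ℓ) (k : Fin M) (b : Bool) :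
    (pieceEnd hℓ k b : ℕ) % ℓ = 0 ∨ ((pieceEnd hℓ k b : ℕ) + 1) % ℓ = 0 := by
  cases b
  · right
    simp only [pieceEnd, Bool.false_eq_true, if_false]
    rw [show k.1 * ℓ + (ℓ - 1) + 1 = (k.1 + 1) * ℓ by rw [add_mul]; omega]
    simp
  · left; simp [pieceEnd]

theorem exists_pieceEnd (hℓ : 2 ≤ ℓ) {k : ℕ} (hk : k < M * ℓ) (h : k % ℓ = 0 ∨ (k + 1) % ℓ = 0) :
    ∃ i b, (pieceEnd hℓ i b : Fin (M * ℓ)) = ⟨k, hk⟩ := by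
  have hd := Nat.div_add_mod k ℓ
  have hlt := Nat.mod_lt k (show 0 < ℓ by omega)
  have hM : k / ℓ < M := Nat.div_lt_of_lt_mul (by rwa [mul_comm])
  rw [mul_comm] at hd
  rcases h with h | h
  · refine ⟨⟨k / ℓ, hM⟩, true, Fin.ext ?_⟩
    simp only [pieceEnd, if_true]
    omega
  · refine ⟨⟨k / ℓ, hM⟩, false, Fin.ext ?_⟩
    simp only [pieceEnd, Bool.false_eq_true, if_false]
    have h3 : (k + 1) % ℓ = (k % ℓ + 1) % ℓ := by simp [Nat.add_mod]
    rw [h3] at h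
    rcases Nat.lt_or_ge (k % ℓ + 1) ℓ with h4 | h4
    · rw [Nat.mod_eq_of_lt h4] at h; omega
    · omega

/-- The site of a terminal. -/
def termSite (hℓ : 2 ≤ ℓ) : Term M K → Site M ℓ q K
  | .inl (.inl x) => siteEar x.1 x.2
  | .inl (.inr x) => siteLk x.1 x.2
  | .inr (.inl x) => siteP (pieceEnd hℓ x.1 x.2)
  | .inr (.inr c) => siteZ c

theorem termSite_injective (hℓ : 2 ≤ ℓ) :
    Function.Injective (termSite hℓ : Term M K → Site M ℓ q K) := by
  rintro ((⟨c, j⟩ | ⟨c, j⟩) | (⟨k, b⟩ | c)) ((⟨c', j'⟩ | ⟨c', j'⟩) | (⟨k', b'⟩ | c')) h <;>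
    simp [termSite] at h ⊢
  · exact h
  · exact h
  · exact pieceEnd_inj hℓ h
  · exact h

/-- The last index on a side of a gadget. -/
def lastFin (hK : 0 < K) : Fin (2 * K) := ⟨2 * K - 1, by omega⟩

/-- An index on a side of a gadget other than the last one. -/
def innerFin (j : Fin (2 * K - 1)) : Fin (2 * K) := ⟨j, by omega⟩

/-- The starting site of a wire. -/
def wireA (hK : 0 < K) : WireIx q K → Site M ℓ q K
  | .inl (i, j) => siteG i true (innerFin j)
  | .inr (.inl i) => sitePole i false
  | .inr (.inr (i, b)) => siteG i b (lastFin hK)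

/-- The final site of a wire. -/
def wireB [NeZero q] (hℓ : 2 ≤ ℓ) (σ : Fin q × Bool ≃ Term M K) : WireIx q K → Site M ℓ q K
  | .inl (i, j) => siteG i false (innerFin j)
  | .inr (.inl i) => sitePole (i + 1) true
  | .inr (.inr x) => termSite hℓ (σ x)

theorem innerFin_ne_lastFin (hK : 0 < K) (j : Fin (2 * K - 1)) : innerFin j ≠ lastFin hK := by
  intro h
  have := congrArg Fin.val h
  have h2 := j.2
  simp only [innerFin, lastFin] at this
  omega

theorem innerFin_inj {j j' : Fin (2 * K - 1)} : innerFin j = innerFin j' ↔ j = j' := by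
  simp [innerFin, Fin.ext_iff]

theorem innerFin_or_lastFin (hK : 0 < K) (j : Fin (2 * K)) :
    (∃ i, innerFin i = j) ∨ j = lastFin hK := by
  rcases Nat.lt_or_ge j (2 * K - 1) with h | h
  · exact .inl ⟨⟨j, h⟩, rfl⟩
  · exact .inr (Fin.ext (by simp only [lastFin]; omega))

theorem wireA_injective (hK : 0 < K) :
    Function.Injective (wireA hK : WireIx q K → Site M ℓ q K) := by
  rintro (⟨i, j⟩ | (i | ⟨i, b⟩)) (⟨i', j'⟩ | (i' | ⟨i', b'⟩)) h <;>
    simp [wireA, innerFin_inj, innerFin_ne_lastFin, (innerFin_ne_lastFin hK _).symm] at h ⊢ <;>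
    exact h

theorem termSite_cases (hℓ : 2 ≤ ℓ) (x : Term M K) {P : Site M ℓ q K → Prop}
    (h1 : ∀ c j, P (siteEar c j)) (h2 : ∀ c j, P (siteLk c j)) (h3 : ∀ k b, P (siteP (pieceEnd hℓ k b)))
    (h4 : ∀ c, P (siteZ c)) : P (termSite hℓ x) := by
  rcases x with (⟨c, j⟩ | ⟨c, j⟩) | (⟨k, b⟩ | c)
  exacts [h1 _ _, h2 _ _, h3 _ _, h4 _]

theorem wireB_injective [NeZero q] (hℓ : 2 ≤ ℓ) (σ : Fin q × Bool ≃ Term M K) :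
    Function.Injective (wireB hℓ σ : WireIx q K → Site M ℓ q K) := by
  have hG : ∀ x i b j, (termSite hℓ x : Site M ℓ q K) ≠ siteG i b j := fun x i b j =>
    termSite_cases hℓ x (P := fun s => s ≠ siteG i b j) (by simp) (by simp) (by simp) (by simp)
  have hE : ∀ x i b, (termSite hℓ x : Site M ℓ q K) ≠ sitePole i b := fun x i b =>
    termSite_cases hℓ x (P := fun s => s ≠ sitePole i b) (by simp) (by simp) (by simp) (by simp)
  rintro (⟨i, j⟩ | (i | x)) (⟨i', j'⟩ | (i' | x')) h
  · simpa [wireB, innerFin_inj] using h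
  · simp [wireB] at h
  · exact absurd h.symm (hG _ _ _ _)
  · simp [wireB] at h
  · simpa [wireB] using h
  · exact absurd h.symm (hE _ _ _)
  · exact absurd h (hG _ _ _ _)
  · exact absurd h (hE _ _ _)
  · rw [σ.injective (termSite_injective hℓ h)]

theorem wireA_ne_wireB [NeZero q] (hK : 0 < K) (hℓ : 2 ≤ ℓ) (σ : Fin q × Bool ≃ Term M K)
    (w w' : WireIx q K) : (wireA hK w : Site M ℓ q K) ≠ wireB hℓ σ w' := by
  rcases w' with ⟨i', j'⟩ | (i' | x')
  · rcases w with ⟨i, j⟩ | (i | ⟨i, b⟩) <;>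
      simp [wireA, wireB, (innerFin_ne_lastFin hK _).symm]
  · rcases w with ⟨i, j⟩ | (i | ⟨i, b⟩) <;> simp [wireA, wireB]
  · refine termSite_cases hℓ (σ x') (P := fun s => wireA hK w ≠ s) ?_ ?_ ?_ ?_ <;>
      rcases w with ⟨i, j⟩ | (i | ⟨i, b⟩) <;> simp [wireA]

/-- The sites of the columns, listed in order. -/
def columnSite (hM : 0 < 2 * M) (hK : 0 < 2 * K) (k : ℕ) : Site M ℓ q K :=
  if k % (4 * K) < 2 * K then siteEar (toFin hM (k / (4 * K))) (toFin hK (k % (4 * K)))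
  else siteLk (toFin hM (k / (4 * K))) (toFin hK (k % (4 * K) - 2 * K))

theorem columnSite_ear (hM : 0 < 2 * M) (hK : 0 < 2 * K) (c : ℕ) {r : ℕ} (hr : r < 2 * K) :
    (columnSite hM hK (4 * K * c + r) : Site M ℓ q K) = siteEar (toFin hM c) (toFin hK r) := by
  have h1 : (4 * K * c + r) % (4 * K) = r := by
    rw [Nat.mul_add_mod, Nat.mod_eq_of_lt (by omega)]
  have h2 : (4 * K * c + r) / (4 * K) = c := by
    rw [Nat.mul_add_div (by omega), Nat.div_eq_of_lt (by omega), add_zero]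
  rw [columnSite, h1, h2, if_pos hr]

theorem columnSite_lk (hM : 0 < 2 * M) (hK : 0 < 2 * K) (c : ℕ) {r : ℕ} (hr : r < 2 * K) :
    (columnSite hM hK (4 * K * c + (2 * K + r)) : Site M ℓ q K) =
      siteLk (toFin hM c) (toFin hK r) := by
  have h1 : (4 * K * c + (2 * K + r)) % (4 * K) = 2 * K + r := by
    rw [Nat.mul_add_mod, Nat.mod_eq_of_lt (by omega)]
  have h2 : (4 * K * c + (2 * K + r)) / (4 * K) = c := by
    rw [Nat.mul_add_div (by omega), Nat.div_eq_of_lt (by omega), add_zero]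
  rw [columnSite, h1, h2, if_neg (by omega), Nat.add_sub_cancel_left]

theorem column_cases (hK : 0 < 2 * K) {N k : ℕ} (hk : k < 4 * K * N) : ∃ c < N, ∃ r < 2 * K,
    k = 4 * K * c + r ∨ k = 4 * K * c + (2 * K + r) := by
  have hd := Nat.div_add_mod k (4 * K)
  have hlt := Nat.mod_lt k (show 0 < 4 * K by omega)
  refine ⟨k / (4 * K), Nat.div_lt_of_lt_mul hk, ?_⟩
  rcases Nat.lt_or_ge (k % (4 * K)) (2 * K) with h | h
  · exact ⟨k % (4 * K), h, .inl hd.symm⟩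
  · exact ⟨k % (4 * K) - 2 * K, by omega, .inr (by omega)⟩

theorem columnSite_inj (hM : 0 < 2 * M) (hK : 0 < 2 * K) {i j : ℕ} (hi : i < 4 * K * (2 * M))
    (hj : j < 4 * K * (2 * M))
    (h : (columnSite hM hK i : Site M ℓ q K) = columnSite hM hK j) : i = j := by
  obtain ⟨c, hc, r, hr, rfl | rfl⟩ := column_cases hK hi <;>
    obtain ⟨c', hc', r', hr', rfl | rfl⟩ := column_cases hK hj
  · rw [columnSite_ear _ _ _ hr, columnSite_ear _ _ _ hr'] at h
    simp only [Sum.inl.injEq, Sum.inr.injEq, Prod.mk.injEq] at h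
    rw [toFin_inj hM hc hc' h.1, toFin_inj hK hr hr' h.2]
  · rw [columnSite_ear _ _ _ hr, columnSite_lk _ _ _ hr'] at h
    simp at h
  · rw [columnSite_lk _ _ _ hr, columnSite_ear _ _ _ hr'] at h
    simp at h
  · rw [columnSite_lk _ _ _ hr, columnSite_lk _ _ _ hr'] at h
    simp only [Sum.inr.injEq, Prod.mk.injEq] at h
    rw [toFin_inj hM hc hc' h.1, toFin_inj hK hr hr' h.2]

theorem columnSite_cases (hM : 0 < 2 * M) (hK : 0 < 2 * K) (k : ℕ) {P : Site M ℓ q K → Prop}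
    (h1 : ∀ c j, P (siteEar c j)) (h2 : ∀ c j, P (siteLk c j)) : P (columnSite hM hK k) := by
  unfold columnSite
  split_ifs
  exacts [h1 _ _, h2 _ _]

end Sites

/-! ### Embedding the frame. -/

section Layout

variable {V : Type*} [Fintype V] {G : SimpleGraph V} {m : ℕ}

/-- The path on `p 0, …, p (n - 1)`. -/
def seqGraph (n : ℕ) (p : ℕ → V) (hp : ∀ i < n, ∀ j < n, p i = p j → i = j) : SimpleGraph V where
  Adj u v := ∃ k, k + 1 < n ∧ ((u = p k ∧ v = p (k + 1)) ∨ (v = p k ∧ u = p (k + 1)))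
  symm := ⟨fun _ _ ⟨k, hk, h⟩ => ⟨k, hk, h.symm⟩⟩
  loopless := ⟨by
    rintro u ⟨k, hk, ⟨rfl, h⟩ | ⟨rfl, h⟩⟩ <;>
    · have := hp _ (by omega) _ (by omega) h; omega⟩

theorem dg_seqGraph_le {n : ℕ} {p : ℕ → V} (hp : ∀ i < n, ∀ j < n, p i = p j → i = j) (v : V) :
    (seqGraph n p hp).dg v ≤ 2 := by
  by_cases hv : ∃ k < n, v = p k
  · obtain ⟨k, hk, rfl⟩ := hv
    refine (card_le_card (t := {p (k - 1), p (k + 1)}) fun u hu => ?_).trans card_le_two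
    simp only [mem_filter, mem_univ, true_and] at hu
    rw [mem_insert, mem_singleton]
    obtain ⟨i, hi, ⟨h, rfl⟩ | ⟨rfl, h⟩⟩ := hu
    · exact .inr (by rw [hp k hk i (by omega) h])
    · exact .inl (by rw [hp k hk _ hi h, Nat.add_sub_cancel])
  · have : (seqGraph n p hp).dg v = 0 := by
      unfold dg
      rw [card_eq_zero, filter_eq_empty_iff]
      rintro u - ⟨i, hi, ⟨rfl, -⟩ | ⟨-, rfl⟩⟩
      exacts [hv ⟨i, by omega, rfl⟩, hv ⟨_, hi, rfl⟩]
    omega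

/-- Inner vertices of the pieces that are far from an exceptional set `B`, into which sets
disjoint from `B` expand. -/
theorem Joined.exists_inner (hj : Joined G m) {M ℓ : ℕ} (hℓ : 2 ≤ ℓ) {p : ℕ → V}
    (hp : ∀ i < M * ℓ, ∀ j < M * ℓ, p i = p j → i = j) (hm : 49 * m < M * ℓ) :
    ∃ B A' : Finset V, B.card < m ∧
      (∀ x ∈ A', ∃ k < M * ℓ, x = p k ∧ k % ℓ ≠ 0 ∧ (k + 1) % ℓ ≠ 0 ∧ p k ∉ B ∧ p (k - 1) ∉ B ∧
        (k + 1 < M * ℓ → p (k + 1) ∉ B)) ∧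
      ∀ U : Finset V, Disjoint U B → U.card ≤ m → U.Nonempty →
        20 * U.card ≤ (nbr G U ∩ A').card + 2 * M := by
  have hA : ((range (M * ℓ)).image p).card = M * ℓ := by
    rw [card_image_of_injOn, card_range]
    intro i hi j hj he
    exact hp i (by simpa using hi) j (by simpa using hj) he
  obtain ⟨B, hB, hBU⟩ := hj.exists_exceptional (dg_seqGraph_le hp) (A := (range (M * ℓ)).image p)
    (by omega)
  set H := seqGraph (M * ℓ) p hp with hH
  have hnear : ∀ x y, x ∉ nearS H B → H.Adj x y → y ∉ B := by
    intro x y hx hxy hy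
    exact hx (mem_union_right _ (mem_filter.2 ⟨mem_univ _, y, hy, hxy.symm⟩))
  refine ⟨B, ((range (M * ℓ)).filter fun k => k % ℓ ≠ 0 ∧ (k + 1) % ℓ ≠ 0 ∧
    p k ∉ nearS H B).image p, hB, ?_, ?_⟩
  · intro x hx
    obtain ⟨k, hk, rfl⟩ := mem_image.1 hx
    rw [mem_filter, mem_range] at hk
    obtain ⟨hk, h1, h2, h3⟩ := hk
    refine ⟨k, hk, rfl, h1, h2, fun h => h3 (mem_union_left _ h), ?_, fun h4 => ?_⟩
    · have h0 : k ≠ 0 := by rintro rfl; simp at h1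
      exact hnear _ _ h3 ⟨k - 1, by omega, .inr ⟨rfl, by rw [Nat.sub_add_cancel (by omega)]⟩⟩
    · exact hnear _ _ h3 ⟨k, h4, .inl ⟨rfl, rfl⟩⟩
  · intro U h1 h2 h3
    have h4 := hBU U h1 h2 h3
    set A' := ((range (M * ℓ)).filter fun k => k % ℓ ≠ 0 ∧ (k + 1) % ℓ ≠ 0 ∧
      p k ∉ nearS H B).image p with hA'
    -- Only the ends of pieces are lost, which accounts for the additive term 2M.
    have h5 : nbr G U ∩ ((range (M * ℓ)).image p \ nearS H B) ⊆ (nbr G U ∩ A') ∪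
        univ.image fun x : Fin M × Bool => p (pieceEnd hℓ x.1 x.2) := by
      intro x hx
      simp only [mem_inter, mem_sdiff, mem_image, mem_range] at hx
      obtain ⟨hx, ⟨k, hk, rfl⟩, hn⟩ := hx
      by_cases he : k % ℓ = 0 ∨ (k + 1) % ℓ = 0
      · obtain ⟨i, b, hib⟩ := exists_pieceEnd hℓ hk he
        exact mem_union_right _ (mem_image.2 ⟨(i, b), mem_univ _, by simp only [hib]⟩)
      · rw [not_or] at he
        exact mem_union_left _ (mem_inter.2 ⟨hx, mem_image.2 ⟨k, by
          rw [mem_filter, mem_range]; exact ⟨hk, he.1, he.2, hn⟩, rfl⟩⟩)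
    have h6 := card_le_card h5
    have h7 := card_union_le (nbr G U ∩ A') (univ.image fun x : Fin M × Bool => p (pieceEnd hℓ x.1 x.2))
    have h8 : (univ.image fun x : Fin M × Bool => p (pieceEnd hℓ x.1 x.2)).card ≤ 2 * M := by
      refine card_image_le.trans ?_
      simp [mul_comm]
    omega

theorem count_le_two {T ι : Type*} [Fintype ι] {a b : ι → T} (ha : Function.Injective a)
    (hb : Function.Injective b) (t : T) :
    (univ.filter fun i => a i = t).card + (univ.filter fun i => b i = t).card ≤ 2 := by
  have h : ∀ {g : ι → T}, Function.Injective g → (univ.filter fun i => g i = t).card ≤ 1 := by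
    intro g hg
    rw [card_le_one]
    intro i hi j hj
    simp only [mem_filter, mem_univ, true_and] at hi hj
    exact hg (hi.trans hj.symm)
  have := h ha
  have := h hb
  omega

/-- The first point joined by a job of the first round. -/
def jobA {M ℓ q : ℕ} : FirstJob M q → BaseSite M ℓ q
  | .inl c => .inr (.inl c)
  | .inr (i, _) => .inr (.inr (i, true))

/-- The second point joined by a job of the first round. -/
def jobB {M ℓ q : ℕ} : FirstJob M q → BaseSite M ℓ q
  | .inl c => .inr (.inl c)
  | .inr (i, _) => .inr (.inr (i, false))

/-- A `z`-vertex is both ends of its ear, and a pole belongs to the two sides of its gadget. -/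
theorem count_job_le_two {M ℓ q : ℕ} (t : BaseSite M ℓ q) :
    (univ.filter fun i : FirstJob M q => jobA i = t).card +
      (univ.filter fun i : FirstJob M q => jobB i = t).card ≤ 2 := by
  have key : ∀ (s s' : Finset (FirstJob M q)), (∀ i, jobA i = t → i ∈ s) →
      (∀ i, jobB i = t → i ∈ s') → s.card + s'.card ≤ 2 →
      (univ.filter fun i : FirstJob M q => jobA i = t).card +
      (univ.filter fun i : FirstJob M q => jobB i = t).card ≤ 2 := by
    intro s s' h1 h2 h3
    refine le_trans (Nat.add_le_add (card_le_card ?_) (card_le_card ?_)) h3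
    · intro i hi; exact h1 i (mem_filter.1 hi).2
    · intro i hi; exact h2 i (mem_filter.1 hi).2
  rcases t with k | c | ⟨i, b⟩
  · refine key ∅ ∅ ?_ ?_ (by simp) <;> rintro (c | ⟨i, b⟩) h <;> simp [jobA, jobB] at h
  · refine key {.inl c} {.inl c} ?_ ?_ (by simp) <;> rintro (c' | ⟨i, b⟩) h <;>
      simp [jobA, jobB] at h ⊢ <;> exact h
  · cases b
    · refine key ∅ {.inr (i, true), .inr (i, false)} ?_ ?_ (by simp) <;>
        rintro (c' | ⟨i', b'⟩) h <;> simp [jobA, jobB] at h ⊢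
      cases b' <;> simp [h]
    · refine key {.inr (i, true), .inr (i, false)} ∅ ?_ ?_ (by simp) <;>
        rintro (c' | ⟨i', b'⟩) h <;> simp [jobA, jobB] at h ⊢
      cases b' <;> simp [h]

/-- An embedding of all sites and wires into `G`. -/
structure Layout (G : SimpleGraph V) (m K M ℓ q : ℕ) [NeZero q] [NeZero (2 * M)] (hK : 0 < K)
    (hℓ : 2 ≤ ℓ) (σ : Fin q × Bool ≃ Term M K) (ν : Site M ℓ q K → V) (P : WireIx q K → ℕ → V)
    (B A' : Finset V) : Prop where
  inj : Function.Injective (Sum.elim ν fun x : WireIx q K × Fin (2 * K) => P x.1 x.2)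
  p_adj : ∀ k (h : k + 1 < M * ℓ),
    G.Adj (ν (siteP ⟨k, Nat.lt_of_succ_lt h⟩)) (ν (siteP ⟨k + 1, h⟩))
  ear_first : ∀ c, G.Adj (ν (siteZ c)) (ν (siteEar c ⟨0, by omega⟩))
  ear_adj : ∀ c j (h : j + 1 < 2 * K),
    G.Adj (ν (siteEar c ⟨j, Nat.lt_of_succ_lt h⟩)) (ν (siteEar c ⟨j + 1, h⟩))
  ear_last : ∀ c, G.Adj (ν (siteEar c (lastFin hK))) (ν (siteZ c))
  g_first : ∀ i b, G.Adj (ν (sitePole i true)) (ν (siteG i b ⟨0, by omega⟩))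
  g_adj : ∀ i b j (h : j + 1 < 2 * K),
    G.Adj (ν (siteG i b ⟨j, Nat.lt_of_succ_lt h⟩)) (ν (siteG i b ⟨j + 1, h⟩))
  g_last : ∀ i b, G.Adj (ν (siteG i b (lastFin hK))) (ν (sitePole i false))
  lk_first : ∀ c, G.Adj (ν (siteEar c (lastFin hK))) (ν (siteLk c ⟨0, by omega⟩))
  lk_adj : ∀ c j (h : j + 1 < 2 * K),
    G.Adj (ν (siteLk c ⟨j, Nat.lt_of_succ_lt h⟩)) (ν (siteLk c ⟨j + 1, h⟩))
  lk_last : ∀ c, G.Adj (ν (siteLk c (lastFin hK))) (ν (siteEar (c + 1) ⟨0, by omega⟩))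
  w_first : ∀ w, G.Adj (ν (wireA hK w)) (P w 0)
  w_adj : ∀ w j, j + 1 < 2 * K → G.Adj (P w j) (P w (j + 1))
  w_last : ∀ w, G.Adj (P w (2 * K - 1)) (ν (wireB hℓ σ w))
  ext : Extendable G m (univ.image (Sum.elim ν fun x : WireIx q K × Fin (2 * K) => P x.1 x.2))
    fun _ => 12
  z_B : ∀ c, ν (siteZ c) ∉ B
  A'_mem : ∀ x ∈ A', ∃ k : Fin (M * ℓ), x = ν (siteP k) ∧ k.1 % ℓ ≠ 0 ∧ (k.1 + 1) % ℓ ≠ 0 ∧ x ∉ B ∧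
    ∀ k' : Fin (M * ℓ), k'.1 + 1 = k.1 ∨ k'.1 = k.1 + 1 → ν (siteP k') ∉ B
  expandA : ∀ U : Finset V, Disjoint U B → U.card ≤ m → U.Nonempty →
    20 * U.card ≤ (nbr G U ∩ A').card + 2 * M

/-- The budget of 20 per vertex is spent as follows: 2 on the initial path, and 2 on each of three
rounds, namely ears with gadget sides, links between consecutive ears, and wires. This leaves 12. -/
theorem Extendable.exists_layout (h : Extendable G m ∅ fun _ => 20) (hj : Joined G m) (hm : 0 < m)
    {κ M ℓ q : ℕ} [NeZero q] [NeZero (2 * M)] (hℓ : 2 ≤ ℓ)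
    (σ : Fin q × Bool ≃ Term M (κ + 1)) (hκ : m ≤ 2 ^ κ) (hmM : 49 * m < M * ℓ)
    (hX : Fintype.card (Site M ℓ q (κ + 1)) + Fintype.card (WireIx q (κ + 1)) * (2 * (κ + 1)) + m +
      2 * 2 ^ (κ + 1) + 44 * m ≤ Fintype.card V) :
    ∃ ν P B A', Layout G m (κ + 1) M ℓ q κ.succ_pos hℓ σ ν P B A' := by
  have hs : Fintype.card (Site M ℓ q (κ + 1)) = Fintype.card (BaseSite M ℓ q) +
      Fintype.card (FirstJob M q) * (2 * (κ + 1)) + 2 * M * (2 * (κ + 1)) := by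
    simp only [Fintype.card_sum, Fintype.card_prod, Fintype.card_fin]
  have hs0 : Fintype.card (BaseSite M ℓ q) = M * ℓ + Fintype.card (FirstJob M q) := by
    simp only [Fintype.card_sum, Fintype.card_prod, Fintype.card_fin]
  set J := Fintype.card (FirstJob M q) with hJ
  have hpos : 0 < M * ℓ := by omega
  -- The first Mℓ vertices are cut into pieces. The `z`-vertices and poles come from the next `J +
  -- m`, where the `m` spare ones make it possible to avoid `B`.
  obtain ⟨p, hp, hpadj, hext⟩ := h.exists_path hj hm (M * ℓ + J + m - 1) (by omega)
  rw [show M * ℓ + J + m - 1 + 1 = M * ℓ + J + m by omega] at hext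
  obtain ⟨B, A', hB, hA', hexp⟩ := hj.exists_inner hℓ (p := p)
    (fun i hi j hj => hp i (by omega) j (by omega)) hmM
  set Q := (Ico (M * ℓ) (M * ℓ + J + m)).image p \ B with hQ
  have hQc : J ≤ Q.card := by
    have h1 : ((Ico (M * ℓ) (M * ℓ + J + m)).image p).card = J + m := by
      rw [card_image_of_injOn, Nat.card_Ico]
      · omega
      · intro i hi j hj he
        rw [coe_Ico, Set.mem_Ico] at hi hj
        exact hp i (by omega) j (by omega) he
    have : _ ≤ Q.card := le_card_sdiff B ((Ico (M * ℓ) (M * ℓ + J + m)).image p)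
    omega
  obtain ⟨e⟩ : Nonempty (FirstJob M q ↪ Q) := Function.Embedding.nonempty_of_card_le (by
    rw [Fintype.card_coe]; exact hQc)
  have heQ : ∀ x, ∃ k, M * ℓ ≤ k ∧ k < M * ℓ + J + m ∧ (e x : V) = p k ∧ (e x : V) ∉ B := by
    intro x
    have := (e x).2
    rw [show ((e x : V) ∈ Q) = ((e x : V) ∈ (Ico (M * ℓ) (M * ℓ + J + m)).image p \ B) from rfl,
      mem_sdiff, mem_image] at this
    obtain ⟨⟨k, hk, he⟩, hn⟩ := this
    rw [mem_Ico] at hk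
    exact ⟨k, hk.1, hk.2, he.symm, hn⟩
  let ν₀ : BaseSite M ℓ q → V := Sum.elim (fun k => p k) fun x => e x
  have hν₀ : Function.Injective ν₀ := by
    refine Function.Injective.sumElim ?_ ?_ ?_
    · intro i j he
      exact Fin.ext (hp i (by omega) j (by omega) he)
    · intro x y he
      exact e.injective (Subtype.ext he)
    · intro i x he
      obtain ⟨k, h1, h2, h3, -⟩ := heQ x
      have := hp i (by omega) k (by omega) (he.trans h3)
      omega
  have hext₀ : Extendable G m (univ.image ν₀) fun _ => 18 := by
    refine hext.anti ?_ fun _ => le_rfl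
    intro x hx
    obtain ⟨k | y, -, rfl⟩ := mem_image.1 hx
    · exact mem_image.2 ⟨k, by rw [mem_range]; omega, rfl⟩
    · obtain ⟨k, h1, h2, h3, -⟩ := heQ y
      exact mem_image.2 ⟨k, by rwa [mem_range], h3.symm⟩
  obtain ⟨P₁, hi₁, hf₁, ha₁, hl₁, hext₁⟩ := hext₀.exists_round hν₀ (by norm_num) (by norm_num) hj hm
    (jobA : FirstJob M q → _) jobB
    (fun t => by convert count_job_le_two t) hκ (by rw [← hJ]; omega)
  obtain ⟨P₂, hi₂, hf₂, ha₂, hl₂, hext₂⟩ := hext₁.exists_round hi₁ (by norm_num) (by norm_num) hj hm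
    (ι := Fin (2 * M)) (fun c => .inr (.inl c, lastFin κ.succ_pos))
    (fun c => .inr (.inl (c + 1), ⟨0, by omega⟩))
    (count_le_two (fun c c' he => by simpa using he) (fun c c' he => by simpa using he)) hκ (by
      rw [Fintype.card_sum, Fintype.card_prod, Fintype.card_fin, Fintype.card_fin, ← hJ]; omega)
  obtain ⟨P₃, hi₃, hf₃, ha₃, hl₃, hext₃⟩ := hext₂.exists_round hi₂ (by norm_num) (by norm_num) hj hm
    (wireA κ.succ_pos) (wireB hℓ σ)
    (count_le_two (wireA_injective _) (wireB_injective hℓ σ)) hκ (by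
      have hs' : Fintype.card ((BaseSite M ℓ q ⊕ FirstJob M q × Fin (2 * (κ + 1))) ⊕
        Fin (2 * M) × Fin (2 * (κ + 1))) = _ := hs
      omega)
  refine ⟨_, P₃, B, A', hi₃, ?_, fun c => hf₁ (.inl c), fun c j hj => ha₁ (.inl c) j hj,
    fun c => hl₁ (.inl c), fun i b => hf₁ (.inr (i, b)), fun i b j hj => ha₁ (.inr (i, b)) j hj,
    fun i b => hl₁ (.inr (i, b)), hf₂, ha₂, hl₂, hf₃, ha₃, hl₃, hext₃, ?_, ?_, hexp⟩
  · intro k hk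
    exact hpadj k (by omega)
  · intro c
    obtain ⟨k, -, -, -, hn⟩ := heQ (.inl c)
    exact hn
  · intro x hx
    obtain ⟨k, hk, rfl, h1, h2, h3, h4, h5⟩ := hA' x hx
    refine ⟨⟨k, hk⟩, rfl, h1, h2, h3, ?_⟩
    rintro ⟨k', hk'⟩ (h6 | h6)
    · simp only at h6
      rw [show k - 1 = k' by omega] at h4
      exact h4
    · simp only at h6
      subst h6
      exact h5 hk'

end Layout

/-! ### Pieces, wires, gadgets and columns of a layout. -/

section LayoutFacts

variable {V : Type*} [Fintype V] {G : SimpleGraph V} {m K M ℓ q : ℕ} [NeZero q] [NeZero (2 * M)]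
  {hK : 0 < K} {hℓ : 2 ≤ ℓ} {σ : Fin q × Bool ≃ Term M K} {ν : Site M ℓ q K → V}
  {P : WireIx q K → ℕ → V} {B A' : Finset V}

/-- The vertices of the pieces of a layout as a sequence. -/
def pieceSeq (ν : Site M ℓ q K → V) (hp : 0 < M * ℓ) (k : ℕ) : V := ν (siteP (toFin hp k))

/-- The wires of a layout as sequences. -/
def wireSeq (hK : 0 < K) (hℓ : 2 ≤ ℓ) (σ : Fin q × Bool ≃ Term M K) (ν : Site M ℓ q K → V)
    (P : WireIx q K → ℕ → V) (w : WireIx q K) : ℕ → V :=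
  wire (2 * K) (ν (wireA hK w)) (ν (wireB hℓ σ w)) (P w)

/-- The vertices of a layout. -/
noncomputable def layoutSet (ν : Site M ℓ q K → V) (P : WireIx q K → ℕ → V) : Finset V :=
  univ.image (Sum.elim ν fun x : WireIx q K × Fin (2 * K) => P x.1 x.2)

/-- Surjectivity of `σ` puts a wire at every terminal. As wires have distinct endpoints, all sites
off the pieces have degree one in the path system. -/
theorem site_cases (hK : 0 < K) (hℓ : 2 ≤ ℓ) (σ : Fin q × Bool ≃ Term M K) (s : Site M ℓ q K) :
    (∃ k, s = siteP k) ∨ ∃ w, s = wireA hK w ∨ s = wireB hℓ σ w := by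
  have ht : ∀ x : Term M K, ∃ w, (termSite hℓ x : Site M ℓ q K) = wireA hK w ∨
      termSite hℓ x = wireB hℓ σ w := fun x =>
    ⟨.inr (.inr (σ.symm x)), .inr (by simp [wireB])⟩
  rcases s with ((k | c | ⟨i, b⟩) | ⟨c | ⟨i, b⟩, j⟩) | ⟨c, j⟩
  · exact .inl ⟨k, rfl⟩
  · exact .inr (ht (.inr (.inr c)))
  · cases b
    · exact .inr ⟨.inr (.inl i), .inl rfl⟩
    · exact .inr ⟨.inr (.inl (i - 1)), .inr (by simp [wireB])⟩
  · exact .inr (ht (.inl (.inl (c, j))))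
  · rcases innerFin_or_lastFin hK j with ⟨j, rfl⟩ | rfl
    · cases b
      · exact .inr ⟨.inl (i, j), .inr rfl⟩
      · exact .inr ⟨.inl (i, j), .inl rfl⟩
    · exact .inr ⟨.inr (.inr (i, b)), .inl rfl⟩
  · exact .inr (ht (.inl (.inr (c, j))))

theorem wireA_ne_siteP (w : WireIx q K) (k : Fin (M * ℓ)) : wireA hK w ≠ siteP k := by
  rcases w with ⟨i, j⟩ | (i | ⟨i, b⟩) <;> simp [wireA]

theorem wireB_eq_siteP {w : WireIx q K} {k : Fin (M * ℓ)} (h : wireB hℓ σ w = siteP k) :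
    k.1 % ℓ = 0 ∨ (k.1 + 1) % ℓ = 0 := by
  rcases w with ⟨i, j⟩ | (i | x)
  · simp [wireB] at h
  · simp [wireB] at h
  · revert h
    refine termSite_cases hℓ (σ x) (P := fun s => s = siteP k → k.1 % ℓ = 0 ∨ (k.1 + 1) % ℓ = 0)
      (by simp) (by simp) ?_ (by simp)
    intro k' b h
    simp only [Sum.inl.injEq] at h
    rw [← h]
    exact pieceEnd_mod hℓ k' b

namespace Layout


theorem ν_inj (hL : Layout G m K M ℓ q hK hℓ σ ν P B A')
    : Function.Injective ν := fun a b h =>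
  Sum.inl_injective (hL.inj (show Sum.elim ν _ (.inl a) = Sum.elim ν _ (.inl b) from h))

theorem P_ne (hL : Layout G m K M ℓ q hK hℓ σ ν P B A')
    (s : Site M ℓ q K) (w : WireIx q K) {j : ℕ} (hj : j < 2 * K) : ν s ≠ P w j := fun h =>
  Sum.inl_ne_inr (hL.inj (show Sum.elim ν (fun x : WireIx q K × Fin (2 * K) => P x.1 x.2) (.inl s) =
    Sum.elim ν (fun x : WireIx q K × Fin (2 * K) => P x.1 x.2) (.inr (w, ⟨j, hj⟩)) from h))

theorem P_inj (hL : Layout G m K M ℓ q hK hℓ σ ν P B A')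
    {w w' : WireIx q K} {j j' : ℕ} (hj : j < 2 * K) (hj' : j' < 2 * K)
    (h : P w j = P w' j') : w = w' ∧ j = j' := by
  have := Sum.inr_injective (hL.inj
    (show Sum.elim ν (fun x : WireIx q K × Fin (2 * K) => P x.1 x.2) (.inr (w, ⟨j, hj⟩)) =
      Sum.elim ν (fun x : WireIx q K × Fin (2 * K) => P x.1 x.2) (.inr (w', ⟨j', hj'⟩)) from h))
  simpa using this

theorem pathSystem (hL : Layout G m K M ℓ q hK hℓ σ ν P B A')
    (hp : 0 < M * ℓ) :
    PathSystem M ℓ (2 * K + 1) (pieceSeq ν hp) (wireSeq hK hℓ σ ν P) where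
  two_le := hℓ
  pos := by omega
  p_inj := fun i hi j hj h => by
    have := hL.ν_inj h
    simp only [Sum.inl.injEq] at this
    exact toFin_inj hp hi hj this
  f_inj := fun w i hi w' j hj h => by
    unfold wireSeq at h
    rcases wire_cases (ν (wireA hK w)) (ν (wireB hℓ σ w)) (P w) hi with ⟨h1, h2⟩ | ⟨h1, h2⟩ | ⟨i', hi', h1, h2⟩ <;>
      rcases wire_cases (ν (wireA hK w')) (ν (wireB hℓ σ w')) (P w') hj with
        ⟨h3, h4⟩ | ⟨h3, h4⟩ | ⟨j', hj', h3, h4⟩ <;> rw [h2, h4] at h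
    · exact ⟨wireA_injective hK (hL.ν_inj h), by omega⟩
    · exact absurd (hL.ν_inj h) (wireA_ne_wireB _ _ _ _ _)
    · exact absurd h (hL.P_ne _ _ hj')
    · exact absurd (hL.ν_inj h).symm (wireA_ne_wireB _ _ _ _ _)
    · exact ⟨wireB_injective hℓ σ (hL.ν_inj h), by omega⟩
    · exact absurd h (hL.P_ne _ _ hj')
    · exact absurd h.symm (hL.P_ne _ _ hi')
    · exact absurd h.symm (hL.P_ne _ _ hi')
    · obtain ⟨h5, h6⟩ := hL.P_inj hi' hj' h
      exact ⟨h5, by omega⟩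
  meet := fun w j hj k hk h => by
    unfold wireSeq pieceSeq at h
    rcases wire_cases (ν (wireA hK w)) (ν (wireB hℓ σ w)) (P w) hj with ⟨h1, h2⟩ | ⟨h1, h2⟩ | ⟨i', hi', h1, h2⟩ <;>
      rw [h2] at h
    · exact absurd (hL.ν_inj h) (wireA_ne_siteP _ _)
    · have := wireB_eq_siteP (hL.ν_inj h)
      rw [toFin_val hp hk] at this
      exact ⟨h1, this⟩
    · exact absurd h.symm (hL.P_ne _ _ hi')
  ends := fun k hk h => by
    obtain ⟨i, b, hib⟩ := exists_pieceEnd hℓ hk h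
    refine ⟨.inr (.inr (σ.symm (.inr (.inl (i, b))))), ?_⟩
    rw [wireSeq, wire_last, pieceSeq]
    simp only [wireB, Equiv.apply_symm_apply, termSite, hib]
    rw [show toFin hp k = ⟨k, hk⟩ from Fin.ext (toFin_val hp hk)]

theorem mem_layoutSet (hL : Layout G m K M ℓ q hK hℓ σ ν P B A')
    {x : V} (hp : 0 < M * ℓ) : x ∈ layoutSet ν P ↔
    (∃ k < M * ℓ, x = pieceSeq ν hp k) ∨ ∃ w, ∃ j ≤ 2 * K + 1, x = wireSeq hK hℓ σ ν P w j := by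
  have hν : ∀ s, ν s ∈ layoutSet ν P := fun s => mem_image.2 ⟨.inl s, mem_univ _, rfl⟩
  have hP : ∀ w j, j < 2 * K → P w j ∈ layoutSet ν P := fun w j hj =>
    mem_image.2 ⟨.inr (w, ⟨j, hj⟩), mem_univ _, rfl⟩
  constructor
  · intro hx
    obtain ⟨s | ⟨w, j⟩, -, rfl⟩ := mem_image.1 hx
    · rcases site_cases hK hℓ σ s with ⟨k, rfl⟩ | ⟨w, rfl | rfl⟩
      · exact .inl ⟨k, k.2, by rw [pieceSeq, toFin_coe]; rfl⟩
      · exact .inr ⟨w, 0, by omega, wire_zero.symm⟩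
      · exact .inr ⟨w, 2 * K + 1, le_rfl, wire_last.symm⟩
    · exact .inr ⟨w, j + 1, by omega, (wire_inner j.2).symm⟩
  · rintro (⟨k, hk, rfl⟩ | ⟨w, j, hj, rfl⟩)
    · exact hν _
    · unfold wireSeq
      rcases wire_cases (ν (wireA hK w)) (ν (wireB hℓ σ w)) (P w) hj with ⟨h1, h2⟩ | ⟨h1, h2⟩ | ⟨i', hi', h1, h2⟩ <;> rw [h2]
      exacts [hν _, hν _, hP _ _ hi']

theorem wireSeq_adj (hL : Layout G m K M ℓ q hK hℓ σ ν P B A')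
    (w : WireIx q K) {j : ℕ} (hj : j < 2 * K + 1) :
    G.Adj (wireSeq hK hℓ σ ν P w j) (wireSeq hK hℓ σ ν P w (j + 1)) :=
  wire_adj (by omega) (hL.w_first w) (hL.w_adj w) (hL.w_last w) hj

theorem pathSystemG_le (hL : Layout G m K M ℓ q hK hℓ σ ν P B A')
    (hp : 0 < M * ℓ) : pathSystemG (hL.pathSystem hp) ≤ G := by
  have key : ∀ u v, Pred M ℓ (2 * K + 1) (pieceSeq ν hp) (wireSeq hK hℓ σ ν P) u v → G.Adj u v := by
    rintro u v (⟨k, hk, -, rfl, rfl⟩ | ⟨w, j, hj, rfl, rfl⟩)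
    · have := (hL.p_adj k hk).symm
      simpa only [pieceSeq, show toFin hp (k + 1) = ⟨k + 1, hk⟩ from Fin.ext (toFin_val hp hk),
        show toFin hp k = ⟨k, Nat.lt_of_succ_lt hk⟩ from
          Fin.ext (toFin_val hp (Nat.lt_of_succ_lt hk))] using this
    · exact hL.wireSeq_adj w hj
  rintro u v (h | h)
  exacts [key u v h, (key v u h).symm]

theorem gadget (hL : Layout G m K M ℓ q hK hℓ σ ν P B A')
    (i : Fin q) : Gadget G K (ν (sitePole i true)) (ν (sitePole i false))
    fun b j => ν (siteG i b (toFin (by omega) j)) where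
  pos := hK
  first := fun b => by
    rw [show toFin _ 0 = (⟨0, by omega⟩ : Fin (2 * K)) from Fin.ext (toFin_val _ (by omega))]
    exact hL.g_first i b
  adj := fun b j hj => by
    rw [show toFin _ j = (⟨j, by omega⟩ : Fin (2 * K)) from Fin.ext (toFin_val _ (by omega)),
      show toFin _ (j + 1) = (⟨j + 1, by omega⟩ : Fin (2 * K)) from Fin.ext (toFin_val _ (by omega))]
    exact hL.g_adj i b j hj
  last := fun b => by
    rw [show toFin _ (2 * K - 1) = lastFin hK from Fin.ext (toFin_val _ (by omega))]
    exact hL.g_last i b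
  ne := fun h => by simpa using hL.ν_inj h
  ne_ga := fun b j hj h => by simpa using hL.ν_inj h
  ne_gb := fun b j hj h => by simpa using hL.ν_inj h
  inj := fun b j hj b' j' hj' h => by
    have := hL.ν_inj h
    simp only [Sum.inl.injEq, Sum.inr.injEq, Prod.mk.injEq, true_and] at this
    exact ⟨this.1, toFin_inj _ hj hj' this.2⟩

/-- A column is an ear followed by the link to the next ear. Its top is the `z`-vertex, adjacent to
the first and the last vertex of the ear. -/
theorem exists_matching (hL : Layout G m K M ℓ q hK hℓ σ ν P B A')
    (hM2 : 0 < 2 * M) (hK2 : 0 < 2 * K) (U : ℕ → Prop)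
    (heven : Even ((range (2 * M)).filter U).card) :
    ∃ R ≤ G, IsMat R ((range (4 * K * (2 * M))).image (fun k => ν (columnSite hM2 hK2 k)) ∪
      ((range (2 * M)).filter U).image fun c => ν (siteZ (toFin hM2 c))) := by
  have e0 : toFin hK2 0 = (⟨0, by omega⟩ : Fin (2 * K)) := Fin.ext (toFin_val _ (by omega))
  have el : toFin hK2 (2 * K - 1) = lastFin hK := Fin.ext (toFin_val _ (by omega))
  have ej : ∀ j (hj : j < 2 * K), toFin hK2 j = ⟨j, hj⟩ := fun j hj => Fin.ext (toFin_val _ hj)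
  refine exists_column_matching hK ?_ ?_ ?_ ?_ ?_ ?_ U heven
  · intro i hi j hj h
    exact columnSite_inj hM2 hK2 hi hj (hL.ν_inj h)
  · intro i hi j hj h
    have := hL.ν_inj h
    simp only [Sum.inl.injEq, Sum.inr.injEq] at this
    exact toFin_inj _ hi hj this
  · intro i hi c hc h
    have := hL.ν_inj h
    revert this
    exact columnSite_cases hM2 hK2 i (P := fun s => ¬ s = siteZ (toFin hM2 c)) (by simp) (by simp)
  · intro i hi
    obtain ⟨c, hc, r, hr, rfl | rfl⟩ := column_cases hK2 (Nat.lt_of_succ_lt hi)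
    · rcases Nat.lt_or_ge (r + 1) (2 * K) with h1 | h1
      · rw [add_assoc, columnSite_ear _ _ _ hr, columnSite_ear _ _ _ h1, ej r hr, ej _ h1]
        exact hL.ear_adj _ r h1
      · obtain rfl : r = 2 * K - 1 := by omega
        rw [columnSite_ear _ _ _ hr, show 4 * K * c + (2 * K - 1) + 1 = 4 * K * c + (2 * K + 0) by omega,
          columnSite_lk _ _ _ (by omega), el, e0]
        exact hL.lk_first _
    · rcases Nat.lt_or_ge (r + 1) (2 * K) with h1 | h1
      · rw [show 4 * K * c + (2 * K + r) + 1 = 4 * K * c + (2 * K + (r + 1)) by omega,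
          columnSite_lk _ _ _ hr, columnSite_lk _ _ _ h1, ej r hr, ej _ h1]
        exact hL.lk_adj _ r h1
      · obtain rfl : r = 2 * K - 1 := by omega
        have e4 : 4 * K * (c + 1) = 4 * K * c + 4 * K := by ring
        rw [show 4 * K * c + (2 * K + (2 * K - 1)) + 1 = 4 * K * (c + 1) + 0 by omega,
          columnSite_lk _ _ _ hr, columnSite_ear _ _ _ hK2, el, e0]
        have := hL.lk_last (toFin hM2 c)
        rwa [add_one_eq_toFin hM2, toFin_val _ hc] at this
  · intro c hc
    have := columnSite_ear (ℓ := ℓ) (q := q) hM2 hK2 c hK2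
    rw [add_zero] at this
    rw [this, e0]
    exact hL.ear_first _
  · intro c hc
    rw [columnSite_ear _ _ _ (by omega), el]
    exact (hL.ear_last _).symm

end Layout

end LayoutFacts

/-! ### The spanning linear forest obtained by absorption. -/

section LayoutForest

variable {V : Type*} [Fintype V] {G : SimpleGraph V} {m K M ℓ q : ℕ} [NeZero q] [NeZero (2 * M)]
  {hK : 0 < K} {hℓ : 2 ≤ ℓ} {σ : Fin q × Bool ≃ Term M K} {ν : Site M ℓ q K → V}
  {P : WireIx q K → ℕ → V} {B A' : Finset V}

theorem Layout.exists_wireB_siteZ (hL : Layout G m K M ℓ q hK hℓ σ ν P B A') (c : Fin (2 * M)) :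
    ∃ w, wireSeq hK hℓ σ ν P w (2 * K + 1) = ν (siteZ c) :=
  ⟨.inr (.inr (σ.symm (.inr (.inr c)))), by
    rw [wireSeq, wire_last]; simp [wireB, termSite]⟩

/-- The reservoir carried by a layout together with a linear forest on the remaining vertices. -/
theorem Layout.reservoir (hL : Layout G m K M ℓ q hK hℓ σ ν P B A') (hj : Joined G m)
    (hp : 0 < M * ℓ) {F : SimpleGraph V} (hFG : F ≤ G) (hFX : ∀ u v, F.Adj u v → u ∉ layoutSet ν P)
    (hF2 : ∀ v, F.dg v ≤ 2) (v₀ : V) :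
    ∃ cp, Reservoir G m ℓ (layoutSet ν P) (univ.image fun k => ν (siteP k)) A' B
      (univ.image fun c => ν (siteZ c)) (pathSystemG (hL.pathSystem hp) ⊔ F) cp := by
  set h := hL.pathSystem hp with hh
  set H := pathSystemG h with hH
  have hHX : ∀ u v, H.Adj u v → u ∈ layoutSet ν P := by
    have key : ∀ u v, Pred M ℓ (2 * K + 1) (pieceSeq ν hp) (wireSeq hK hℓ σ ν P) u v →
        u ∈ layoutSet ν P ∧ v ∈ layoutSet ν P := by
      rintro u v (⟨k, hk, -, rfl, rfl⟩ | ⟨w, j, hj, rfl, rfl⟩)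
      · exact ⟨(hL.mem_layoutSet hp).2 (.inl ⟨_, hk, rfl⟩),
          (hL.mem_layoutSet hp).2 (.inl ⟨k, by omega, rfl⟩)⟩
      · exact ⟨(hL.mem_layoutSet hp).2 (.inr ⟨w, j, by omega, rfl⟩),
          (hL.mem_layoutSet hp).2 (.inr ⟨w, j + 1, hj, rfl⟩)⟩
    rintro u v (h1 | h1)
    exacts [(key u v h1).1, (key v u h1).2]
  have hdisj : ∀ u v, H.Adj u v → ¬ F.Adj u v := fun u v h1 h2 => hFX u v h2 (hHX u v h1)
  have hdg := dg_sup hdisj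
  have hF0 : ∀ x ∈ layoutSet ν P, F.dg x = 0 := by
    intro x hx
    by_contra hn
    obtain ⟨y, hy⟩ := dg_pos.1 (Nat.pos_of_ne_zero hn)
    exact hFX x y hy hx
  have hH0 : ∀ x, x ∉ layoutSet ν P → H.dg x = 0 := by
    intro x hx
    by_contra hn
    obtain ⟨y, hy⟩ := dg_pos.1 (Nat.pos_of_ne_zero hn)
    exact hx (hHX x y hy)
  have hpk : ∀ k, ν (siteP k) = pieceSeq ν hp k := fun k => by rw [pieceSeq, toFin_coe]
  have hνX : ∀ s, ν s ∈ layoutSet ν P := fun s => mem_image.2 ⟨.inl s, mem_univ _, rfl⟩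
  have hzp : ∀ c, ∀ k < M * ℓ, ν (siteZ c) ≠ pieceSeq ν hp k := fun c k hk he => by
    simpa using hL.ν_inj he
  have hH2 : ∀ x, H.dg x ≤ 2 := by
    intro x
    by_cases hx : x ∈ layoutSet ν P
    · rcases (hL.mem_layoutSet hp).1 hx with ⟨k, hk, rfl⟩ | ⟨w, j, hj, rfl⟩
      · rw [h.dg_piece hk]
      · rcases Nat.eq_zero_or_pos j with rfl | h0
        · rw [h.dg_first]; norm_num
        · rcases Nat.eq_or_lt_of_le hj with rfl | hj
          · by_cases hw : ∀ k < M * ℓ, wireSeq hK hℓ σ ν P w (2 * K + 1) ≠ pieceSeq ν hp k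
            · rw [h.dg_last hw]; norm_num
            · push Not at hw
              obtain ⟨k, hk, he⟩ := hw
              rw [he, h.dg_piece hk]
          · rw [h.dg_inner h0 hj]
    · rw [hH0 x hx]; norm_num
  obtain ⟨cp, hcp, hcpp, hcpw, hcp0⟩ := h.exists_label v₀
  have hcpz : ∀ c, cp (ν (siteZ c)) = ν (siteZ c) := by
    intro c
    obtain ⟨w, hw⟩ := hL.exists_wireB_siteZ c
    rw [← hw]
    exact hcpw w fun k hk => by rw [hw]; exact hzp c k hk
  have hcpY : ∀ x, x ∉ layoutSet ν P → cp x = v₀ := fun x hx => by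
    rw [hL.mem_layoutSet hp, not_or] at hx
    push Not at hx
    exact hcp0 x hx.1 hx.2
  refine ⟨cp, hj, ?_, ?_, ?_, ?_, ?_, ?_, ?_, ?_, ?_, ?_, ?_, ?_, ?_, ?_, ?_, ?_⟩
  · intro U hU
    have := hL.ext U (by omega)
    rw [sum_const, nsmul_eq_mul] at this
    have h2 : (U.card * 12 : ℕ) ≤ (nbr G U \ layoutSet ν P).card := by exact_mod_cast this
    omega
  · exact sup_le (hL.pathSystemG_le hp) hFG
  · intro x
    rw [hdg]
    by_cases hx : x ∈ layoutSet ν P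
    · rw [hF0 x hx]; exact hH2 x
    · rw [hH0 x hx, zero_add]; exact hF2 x
  · rintro u v (h1 | h1) hu
    · exact hHX v u h1.symm
    · exact absurd hu (hFX u v h1)
  · intro x hx
    obtain ⟨k, -, rfl⟩ := mem_image.1 hx
    exact hνX _
  · intro x hx
    obtain ⟨k, -, rfl⟩ := mem_image.1 hx
    exact hνX _
  · rw [Finset.disjoint_left]
    intro x hx hx'
    obtain ⟨k, -, rfl⟩ := mem_image.1 hx
    obtain ⟨c, -, he⟩ := mem_image.1 hx'
    simpa using hL.ν_inj he
  · intro x hx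
    obtain ⟨k, -, rfl⟩ := mem_image.1 hx
    rw [hdg, hF0 _ (hνX _), hpk, h.dg_piece k.2]
  · intro x hx
    obtain ⟨c, -, rfl⟩ := mem_image.1 hx
    rw [hdg, hF0 _ (hνX _)]
    obtain ⟨w, hw⟩ := hL.exists_wireB_siteZ c
    rw [← hw, h.dg_last fun k hk => by rw [hw]; exact hzp c k hk]
  · intro x hx
    obtain ⟨k, rfl, -⟩ := hL.A'_mem x hx
    exact mem_image_of_mem _ (mem_univ _)
  · rw [Finset.disjoint_left]
    intro x hx
    obtain ⟨k, -, -, -, hn, -⟩ := hL.A'_mem x hx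
    exact hn
  · rw [Finset.disjoint_left]
    intro x hx
    obtain ⟨c, -, rfl⟩ := mem_image.1 hx
    exact hL.z_B c
  · intro x hx y hxy
    obtain ⟨k, rfl, h1, h2, -, h4⟩ := hL.A'_mem x hx
    rcases hxy with hxy | hxy
    · rw [hpk, h.adj_piece_iff k.2] at hxy
      have hy : ∃ k' : Fin (M * ℓ), (k'.1 + 1 = k.1 ∨ k'.1 = k.1 + 1) ∧ y = ν (siteP k') := by
        rcases hxy with ⟨h5, h6, rfl⟩ | ⟨h5, rfl⟩ | ⟨w, h5, rfl⟩
        · exact ⟨⟨k + 1, h5⟩, .inr rfl, by rw [hpk]⟩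
        · have h0 : k.1 ≠ 0 := by intro h0; rw [h0] at h5; simp at h5
          have := k.2
          exact ⟨⟨k - 1, by omega⟩, .inl (by simp only; omega), by rw [hpk]⟩
        · rcases (h.meet w _ le_rfl k k.2 h5).2 with h6 | h6
          exacts [absurd h6 h1, absurd h6 h2]
      obtain ⟨k', hk', rfl⟩ := hy
      exact ⟨mem_image_of_mem _ (mem_univ _), h4 k' hk'⟩
    · exact absurd (hνX _) (hFX _ _ hxy)
  · intro U h1 h2 h3
    have hc : (univ.image fun c => ν (siteZ c)).card = 2 * M := by
      rw [card_image_of_injective, card_univ, Fintype.card_fin]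
      intro c c' he
      simpa using hL.ν_inj he
    rw [hc]
    exact hL.expandA U h1 h2 h3
  · rintro u v (h1 | h1)
    · exact hcp u v h1
    · rw [hcpY u (hFX u v h1), hcpY v (hFX v u h1.symm)]
  -- Within pieces and pool, a label class is either contained in one piece or has at most one
  -- vertex.
  · intro i
    by_cases hi : ∃ k < M * ℓ, cp (pieceSeq ν hp k) = i
    · obtain ⟨k, hk, hki⟩ := hi
      have hdm : ∀ k', k' / ℓ * ℓ + k' % ℓ = k' := fun k' => by rw [mul_comm]; exact Nat.div_add_mod k' ℓ
      have hle : ∀ k' < M * ℓ, k' / ℓ * ℓ < M * ℓ := fun k' hk' => by have := hdm k'; omega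
      refine (card_le_card (t := (range ℓ).image fun j => pieceSeq ν hp (k / ℓ * ℓ + j)) ?_).trans
        (card_image_le.trans (by rw [card_range]))
      intro x hx
      rw [mem_filter, mem_union] at hx
      rw [hcpp k hk] at hki
      obtain ⟨hx | hx, hxi⟩ := hx
      · obtain ⟨k', -, rfl⟩ := mem_image.1 hx
        rw [hpk, hcpp k' k'.2, ← hki] at hxi
        have := h.p_inj _ (hle k' k'.2) _ (hle k hk) hxi
        refine mem_image.2 ⟨k' % ℓ, mem_range.2 (Nat.mod_lt _ (by omega)), ?_⟩
        rw [← this, hdm, hpk]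
      · obtain ⟨c, -, rfl⟩ := mem_image.1 hx
        rw [hcpz, ← hki] at hxi
        exact absurd hxi (hzp c _ (hle k hk))
    · push Not at hi
      refine (card_le_card (t := {i}) ?_).trans (by rw [card_singleton]; omega)
      intro x hx
      rw [mem_filter, mem_union] at hx
      obtain ⟨hx | hx, hxi⟩ := hx
      · obtain ⟨k', -, rfl⟩ := mem_image.1 hx
        rw [hpk] at hxi
        exact absurd hxi (hi k' k'.2)
      · obtain ⟨c, -, rfl⟩ := mem_image.1 hx
        rw [hcpz] at hxi
        exact mem_singleton.2 hxi

/-- A spanning linear forest whose ends lie in the layout and which contains all wires. -/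
theorem Layout.exists_forest (hL : Layout G m K M ℓ q hK hℓ σ ν P B A') (hj : Joined G m)
    (hp : 0 < M * ℓ) (hm : 0 < m) {κ : ℕ} (hκ : m ≤ 2 ^ κ) {k r : ℕ} (hk : 2 ≤ k)
    (hr : 2 * Fintype.card V ≤ r ^ 2)
    (hnum : ∀ d, 3 * k * d ≤ 30 * Fintype.card V + 8 * k * (2 * (k * k) + 1) * r →
      4 * (d * (2 * κ + 1) * ℓ) ≤ 2 * M) :
    ∃ S : SimpleGraph V, S ≤ G ∧ S.IsAcyclic ∧ (∀ v, S.dg v ≤ 2) ∧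
      (∀ u ∈ layoutSet ν P, (∀ k, u ≠ ν (siteP k)) → (∀ c, u ≠ ν (siteZ c)) → ∀ v,
        S.Adj u v ↔ (pathSystemG (hL.pathSystem hp)).Adj u v) ∧
      (∀ v, v ∉ layoutSet ν P → S.dg v = 2) ∧ (∀ k, S.dg (ν (siteP k)) = 2) ∧
      ∀ c, 1 ≤ S.dg (ν (siteZ c)) := by
  have hexp : ∀ U : Finset V, U.card ≤ m → 12 * U.card ≤ (nbr G U ∩ (layoutSet ν P)ᶜ).card := by
    intro U hU
    have := hL.ext U (by omega)
    rw [sum_const, nsmul_eq_mul] at this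
    have h2 : (U.card * 12 : ℕ) ≤ (nbr G U \ layoutSet ν P).card := by exact_mod_cast this
    rw [sdiff_eq_inter_compl] at h2
    omega
  obtain ⟨F, hFG, hFY, hF2, hFa, hFd⟩ := exists_linForest hk hexp hj hr
  have hFX : ∀ u v, F.Adj u v → u ∉ layoutSet ν P := fun u v huv => mem_compl.1 (hFY u v huv)
  -- The label of the vertices outside the layout is arbitrary, since classes are counted only
  -- inside pieces and pool.
  obtain ⟨cp, hR⟩ := hL.reservoir hj hp hFG hFX hF2 (ν (siteP (toFin hp 0)))
  set h := hL.pathSystem hp with hh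
  set H := pathSystemG h with hH
  have hFX' : ∀ u ∈ layoutSet ν P, ∀ v, ¬ F.Adj u v := fun u hu v huv => hFX u v huv hu
  have hacy : (H ⊔ F).IsAcyclic := by
    obtain ⟨rk, hrk⟩ := h.exists_rank
    have hX' : ∀ u ∈ layoutSet ν P, ∀ v, (H ⊔ F).Adj u v → H.Adj u v := fun u hu v huv =>
      huv.elim id fun h1 => absurd h1 (hFX' u hu v)
    refine isAcyclic_of_rank (X := fun u => u ∈ layoutSet ν P) (r := rk) hFa hR.closed ?_ ?_
    · rintro u v (h1 | h1) hu
      · refine absurd (hR.closed v u (.inl h1.symm) ?_) hu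
        by_contra hv
        rcases h1 with (⟨k, hk, -, rfl, rfl⟩ | ⟨w, j, hj, rfl, rfl⟩) |
          (⟨k, hk, -, rfl, rfl⟩ | ⟨w, j, hj, rfl, rfl⟩)
        · exact hv ((hL.mem_layoutSet hp).2 (.inl ⟨k, by omega, rfl⟩))
        · exact hv ((hL.mem_layoutSet hp).2 (.inr ⟨w, j + 1, hj, rfl⟩))
        · exact hv ((hL.mem_layoutSet hp).2 (.inl ⟨k + 1, hk, rfl⟩))
        · exact hv ((hL.mem_layoutSet hp).2 (.inr ⟨w, j, by omega, rfl⟩))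
      · exact h1
    · intro u v v' hu h1 h2 h3 h4
      exact h.rank_aux hrk (hX' u hu v h1) (hX' u hu v' h2) h3 h4
  have hpool : (univ.image fun c => ν (siteZ c)).card = 2 * M := by
    rw [card_image_of_injective, card_univ, Fintype.card_fin]
    intro c c' he
    simpa using hL.ν_inj he
  have hdef : deficiency (layoutSet ν P) (univ.image fun k => ν (siteP k)) (H ⊔ F) ≤
      ∑ v ∈ (layoutSet ν P)ᶜ, (2 - F.dg v) := by
    have h0 : ∀ v ∈ univ.image (fun k => ν (siteP k)), 2 - (H ⊔ F).dg v = 0 := fun v hv => by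
      rw [hR.dg_A v hv]
    unfold deficiency
    calc _ ≤ ∑ v ∈ (layoutSet ν P)ᶜ, (2 - (H ⊔ F).dg v) +
          ∑ v ∈ univ.image (fun k => ν (siteP k)), (2 - (H ⊔ F).dg v) := by
          rw [← sum_union_inter]; exact Nat.le_add_right _ _
      _ = ∑ v ∈ (layoutSet ν P)ᶜ, (2 - (H ⊔ F).dg v) := by rw [sum_eq_zero h0, add_zero]
      _ ≤ _ := sum_le_sum fun v _ => Nat.sub_le_sub_left (dg_mono le_sup_right v) 2
  obtain ⟨S, s1, s2, s3, s4, s5, s6⟩ := hR.absorb hacy hm hκ (by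
    rw [hpool]
    refine le_trans ?_ (hnum _ hFd)
    gcongr) (by rw [hpool]; exact Nat.pos_of_ne_zero (NeZero.ne _))
  refine ⟨S, s1, s2, s3, ?_, fun v hv => s5 v (.inl hv),
    fun k => s5 _ (.inr (mem_image_of_mem _ (mem_univ _))),
    fun c => s6 _ (mem_image_of_mem _ (mem_univ _))⟩
  intro u hu h1 h2 v
  rw [s4 u hu (by simpa using fun k => (h1 k).symm) (by simpa using fun k => (h2 k).symm)]
  exact ⟨fun h3 => h3.elim id fun h4 => absurd h4 (hFX' u hu v), .inl⟩

end LayoutForest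

/-! ### Closing the forest of a layout to a connected 2-regular graph. -/

section LayoutHamilton

variable {V : Type*} [Fintype V] {G : SimpleGraph V} {m K M ℓ q : ℕ} [NeZero q] [NeZero (2 * M)]
  {hK : 0 < K} {hℓ : 2 ≤ ℓ} {σ : Fin q × Bool ≃ Term M K} {ν : Site M ℓ q K → V}
  {P : WireIx q K → ℕ → V} {B A' : Finset V}

/-- The sites of the gadgets. -/
def gadgetSite : Fin q × (Bool ⊕ Bool × Fin (2 * K)) → Site M ℓ q K
  | (i, .inl b) => sitePole i b
  | (i, .inr (b, j)) => siteG i b j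

theorem gadgetSite_injective :
    Function.Injective (gadgetSite : Fin q × (Bool ⊕ Bool × Fin (2 * K)) → Site M ℓ q K) := by
  rintro ⟨i, b | ⟨b, j⟩⟩ ⟨i', b' | ⟨b', j'⟩⟩ h <;> simp [gadgetSite] at h ⊢ <;> tauto

theorem mem_gadSet_iff (hK2 : 0 < 2 * K) (i : Fin q) (u : V) :
    u ∈ gadSet K (ν (sitePole i true)) (ν (sitePole i false))
      (fun b j => ν (siteG i b (toFin hK2 j))) ↔ ∃ y, u = ν (gadgetSite (i, y)) := by
  rw [mem_gadSet]
  constructor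
  · rintro (rfl | rfl | ⟨b, j, hj, rfl⟩)
    exacts [⟨.inl true, rfl⟩, ⟨.inl false, rfl⟩, ⟨.inr (b, toFin hK2 j), rfl⟩]
  · rintro ⟨b | ⟨b, j⟩, rfl⟩
    · cases b
      exacts [.inr (.inl rfl), .inl rfl]
    · exact .inr (.inr ⟨b, j, j.2, by rw [toFin_coe]; rfl⟩)

theorem gadgetSite_ne_siteP (x : Fin q × (Bool ⊕ Bool × Fin (2 * K))) (k : Fin (M * ℓ)) :
    gadgetSite x ≠ siteP k := by
  obtain ⟨i, b | ⟨b, j⟩⟩ := x <;> simp [gadgetSite]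

theorem gadgetSite_ne_siteZ (x : Fin q × (Bool ⊕ Bool × Fin (2 * K))) (c : Fin (2 * M)) :
    (gadgetSite x : Site M ℓ q K) ≠ siteZ c := by
  obtain ⟨i, b | ⟨b, j⟩⟩ := x <;> simp [gadgetSite]

theorem columnSite_ne_siteP (hM2 : 0 < 2 * M) (hK2 : 0 < 2 * K) (i : ℕ) (k : Fin (M * ℓ)) :
    (columnSite hM2 hK2 i : Site M ℓ q K) ≠ siteP k :=
  columnSite_cases hM2 hK2 i (P := fun s => s ≠ siteP k) (by simp) (by simp)

theorem columnSite_ne_siteZ (hM2 : 0 < 2 * M) (hK2 : 0 < 2 * K) (i : ℕ) (c : Fin (2 * M)) :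
    (columnSite hM2 hK2 i : Site M ℓ q K) ≠ siteZ c :=
  columnSite_cases hM2 hK2 i (P := fun s => s ≠ siteZ c) (by simp) (by simp)

theorem columnSite_ne_gadgetSite (hM2 : 0 < 2 * M) (hK2 : 0 < 2 * K) (i : ℕ)
    (x : Fin q × (Bool ⊕ Bool × Fin (2 * K))) :
    (columnSite hM2 hK2 i : Site M ℓ q K) ≠ gadgetSite x := by
  obtain ⟨i', b | ⟨b, j⟩⟩ := x <;>
    exact columnSite_cases hM2 hK2 i (P := fun s => s ≠ _) (by simp [gadgetSite])
      (by simp [gadgetSite])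

theorem exists_columnSite_ear (hM2 : 0 < 2 * M) (hK2 : 0 < 2 * K) (c : Fin (2 * M))
    (j : Fin (2 * K)) :
    ∃ k < 4 * K * (2 * M), (columnSite hM2 hK2 k : Site M ℓ q K) = siteEar c j := by
  have h1 : 4 * K * (c + 1) ≤ 4 * K * (2 * M) := Nat.mul_le_mul_left _ c.2
  rw [mul_add] at h1
  exact ⟨4 * K * c + j, by omega, by rw [columnSite_ear _ _ _ j.2, toFin_coe, toFin_coe]⟩

theorem exists_columnSite_lk (hM2 : 0 < 2 * M) (hK2 : 0 < 2 * K) (c : Fin (2 * M))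
    (j : Fin (2 * K)) :
    ∃ k < 4 * K * (2 * M), (columnSite hM2 hK2 k : Site M ℓ q K) = siteLk c j := by
  have h1 : 4 * K * (c + 1) ≤ 4 * K * (2 * M) := Nat.mul_le_mul_left _ c.2
  rw [mul_add] at h1
  exact ⟨4 * K * c + (2 * K + j), by omega, by rw [columnSite_lk _ _ _ j.2, toFin_coe, toFin_coe]⟩

/-- Every site lies on a piece, is a `z`-vertex, or belongs to a gadget or a column. -/
theorem site_kinds (hM2 : 0 < 2 * M) (hK2 : 0 < 2 * K) (s : Site M ℓ q K) :
    (∃ k, s = siteP k) ∨ (∃ c, s = siteZ c) ∨ (∃ x, s = gadgetSite x) ∨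
      ∃ k < 4 * K * (2 * M), s = columnSite hM2 hK2 k := by
  rcases s with ((k | c | ⟨i, b⟩) | ⟨c | ⟨i, b⟩, j⟩) | ⟨c, j⟩
  · exact .inl ⟨k, rfl⟩
  · exact .inr (.inl ⟨c, rfl⟩)
  · exact .inr (.inr (.inl ⟨(i, .inl b), rfl⟩))
  · obtain ⟨k, hk, h⟩ := exists_columnSite_ear (ℓ := ℓ) (q := q) hM2 hK2 c j
    exact .inr (.inr (.inr ⟨k, hk, h.symm⟩))
  · exact .inr (.inr (.inl ⟨(i, .inr (b, j)), rfl⟩))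
  · obtain ⟨k, hk, h⟩ := exists_columnSite_lk (ℓ := ℓ) (q := q) hM2 hK2 c j
    exact .inr (.inr (.inr ⟨k, hk, h.symm⟩))

/-- After absorption the ends of `S` are the gadget sites, the column sites and the unused
`z`-vertices. The wires have survived, because their inner vertices are neither on pieces nor in the
pool. They supply the cross connections, the chain of gadgets and the ties from the remaining ends
to gadgets. -/
theorem Layout.exists_factor (hL : Layout G m K M ℓ q hK hℓ σ ν P B A') (hj : Joined G m)
    (hp : 0 < M * ℓ) (hm : 0 < m) {κ : ℕ} (hκ : m ≤ 2 ^ κ) {k r : ℕ} (hk : 2 ≤ k)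
    (hr : 2 * Fintype.card V ≤ r ^ 2)
    (hnum : ∀ d, 3 * k * d ≤ 30 * Fintype.card V + 8 * k * (2 * (k * k) + 1) * r →
      4 * (d * (2 * κ + 1) * ℓ) ≤ 2 * M) :
    ∃ R : SimpleGraph V, R ≤ G ∧ (∀ v, R.dg v = 2) ∧ ∀ u v, R.Reachable u v := by
  obtain ⟨S, hSG, hSa, hS2, hSX, hSY, hSP, hSZ⟩ := hL.exists_forest hj hp hm hκ hk hr hnum
  set h := hL.pathSystem hp with hh
  set f := wireSeq hK hℓ σ ν P with hf
  have hM2 : 0 < 2 * M := Nat.pos_of_ne_zero (NeZero.ne _)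
  have hK2 : 0 < 2 * K := by omega
  have hνX : ∀ s, ν s ∈ layoutSet ν P := fun s => mem_image.2 ⟨.inl s, mem_univ _, rfl⟩
  have hfi : ∀ w j, 0 < j → j < 2 * K + 1 → f w j ∈ layoutSet ν P ∧ ∀ s, f w j ≠ ν s := by
    intro w j h0 hj'
    obtain ⟨i, rfl⟩ := Nat.exists_eq_add_of_lt h0
    rw [zero_add] at *
    have e : f w (i + 1) = P w i := wire_inner (by omega)
    rw [e]
    exact ⟨mem_image.2 ⟨.inr (w, ⟨i, by omega⟩), mem_univ _, rfl⟩,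
      fun s he => hL.P_ne s w (by omega) he.symm⟩
  have hfadj : ∀ w j, 0 < j → j < 2 * K + 1 → ∀ v, S.Adj (f w j) v ↔ (pathSystemG h).Adj (f w j) v :=
    fun w j h0 hj' => hSX _ (hfi w j h0 hj').1 (fun _ => (hfi w j h0 hj').2 _)
      (fun _ => (hfi w j h0 hj').2 _)
  have hfdg : ∀ w j, 0 < j → j < 2 * K + 1 → S.dg (f w j) = 2 := fun w j h0 hj' => by
    rw [dg_congr (hfadj w j h0 hj'), h.dg_inner h0 hj']
  have hstep : ∀ w j, j < 2 * K + 1 → S.Adj (f w j) (f w (j + 1)) := by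
    intro w j hj'
    have hH : (pathSystemG h).Adj (f w j) (f w (j + 1)) := .inl (.inr ⟨w, j, hj', rfl, rfl⟩)
    rcases Nat.eq_zero_or_pos j with rfl | h0
    · exact ((hfadj w 1 one_pos (by omega) _).2 hH.symm).symm
    · exact (hfadj w j h0 hj' _).2 hH
  have hreach : ∀ w, S.Reachable (ν (wireA hK w)) (ν (wireB hℓ σ w)) := by
    intro w
    have : ∀ j ≤ 2 * K + 1, S.Reachable (f w 0) (f w j) := by
      intro j
      induction j with
      | zero => exact fun _ => .rfl
      | succ j ih => exact fun hj' => (ih (by omega)).trans (hstep w j hj').reachable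
    have h1 := this _ le_rfl
    have e0 : f w 0 = ν (wireA hK w) := wire_zero
    have el : f w (2 * K + 1) = ν (wireB hℓ σ w) := wire_last
    rwa [e0, el] at h1
  have hend : ∀ s, (∀ k, s ≠ siteP k) → ∃ y, S.Adj (ν s) y ∧ S.dg y = 2 := by
    intro s hs
    rcases site_cases hK hℓ σ s with ⟨k, rfl⟩ | ⟨w, rfl | rfl⟩
    · exact absurd rfl (hs k)
    · have h1 := hstep w 0 (by omega)
      have e0 : f w 0 = ν (wireA hK w) := wire_zero
      rw [e0] at h1
      exact ⟨_, h1, hfdg w 1 one_pos (by omega)⟩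
    · have h1 := hstep w (2 * K) (by omega)
      have e0 : f w (2 * K + 1) = ν (wireB hℓ σ w) := wire_last
      rw [e0] at h1
      exact ⟨_, h1.symm, hfdg w (2 * K) (by omega) (by omega)⟩
  have hdg1 : ∀ s, (∀ k, s ≠ siteP k) → (∀ c, s ≠ siteZ c) → S.dg (ν s) = 1 := by
    intro s hs hz
    rw [dg_congr (hSX _ (hνX s) (fun k he => hs k (hL.ν_inj he)) fun c he => hz c (hL.ν_inj he))]
    rcases site_cases hK hℓ σ s with ⟨k, rfl⟩ | ⟨w, rfl | rfl⟩
    · exact absurd rfl (hs k)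
    · have e0 : f w 0 = ν (wireA hK w) := wire_zero
      rw [← e0]
      exact h.dg_first w
    · have e0 : f w (2 * K + 1) = ν (wireB hℓ σ w) := wire_last
      rw [← e0]
      exact h.dg_last fun k hk he => hs _ (hL.ν_inj (e0.symm.trans he))
  have hkind : ∀ u, S.dg u ≠ 2 → (∃ c, u = ν (siteZ c) ∧ S.dg u = 1) ∨
      (∃ x, u = ν (gadgetSite x)) ∨ ∃ k < 4 * K * (2 * M), u = ν (columnSite hM2 hK2 k) := by
    intro u hu
    have huX : u ∈ layoutSet ν P := by
      by_contra hn
      exact hu (hSY u hn)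
    obtain ⟨s | ⟨w, j⟩, -, rfl⟩ := mem_image.1 huX
    · rcases site_kinds hM2 hK2 s with ⟨k, rfl⟩ | ⟨c, rfl⟩ | ⟨x, rfl⟩ | ⟨k, hk, rfl⟩
      · exact absurd (hSP k) hu
      · refine .inl ⟨c, rfl, ?_⟩
        have := hSZ c
        have := hS2 (ν (siteZ c))
        simp only [Sum.elim_inl] at hu ⊢
        omega
      · exact .inr (.inl ⟨x, rfl⟩)
      · exact .inr (.inr ⟨k, hk, rfl⟩)
    · refine absurd ?_ hu
      have e : f w (j + 1) = P w j := wire_inner j.2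
      have := hfdg w (j + 1) (by omega) (by omega)
      rw [e] at this
      exact this
  have hgad1 : ∀ x, S.dg (ν (gadgetSite x)) = 1 := fun x =>
    hdg1 _ (gadgetSite_ne_siteP x) (gadgetSite_ne_siteZ x)
  have hcol1 : ∀ k, S.dg (ν (columnSite hM2 hK2 k)) = 1 := fun k =>
    hdg1 _ (columnSite_ne_siteP hM2 hK2 k) (columnSite_ne_siteZ hM2 hK2 k)
  -- `U` marks the `z`-vertices that absorption has not used up.
  obtain ⟨U, hU⟩ : ∃ U : ℕ → Prop, ∀ c, U c ↔ S.dg (ν (siteZ (toFin hM2 c))) = 1 :=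
    ⟨_, fun _ => Iff.rfl⟩
  set D₁ := (range (4 * K * (2 * M))).image (fun k => ν (columnSite hM2 hK2 k)) with hD₁
  set D₂ := ((range (2 * M)).filter U).image (fun c => ν (siteZ (toFin hM2 c))) with hD₂
  set Γ := univ.image (fun x => ν (gadgetSite x)) with hΓ
  have hD2mem : ∀ u, u ∈ D₂ ↔ ∃ c, u = ν (siteZ c) ∧ S.dg u = 1 := by
    intro u
    rw [hD₂, mem_image]
    constructor
    · rintro ⟨c, hc, rfl⟩
      exact ⟨_, rfl, (hU c).1 (mem_filter.1 hc).2⟩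
    · rintro ⟨c, rfl, hc⟩
      refine ⟨c, mem_filter.2 ⟨mem_range.2 c.2, ?_⟩, by rw [toFin_coe]⟩
      rw [hU, toFin_coe]; exact hc
  have hD1mem : ∀ u, u ∈ D₁ ↔ ∃ k < 4 * K * (2 * M), u = ν (columnSite hM2 hK2 k) := by
    intro u
    rw [hD₁, mem_image]
    exact ⟨fun ⟨k, hk, he⟩ => ⟨k, mem_range.1 hk, he.symm⟩,
      fun ⟨k, hk, he⟩ => ⟨k, mem_range.2 hk, he.symm⟩⟩
  have hΓmem : ∀ u, u ∈ Γ ↔ ∃ x, u = ν (gadgetSite x) := by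
    intro u
    rw [hΓ, mem_image]
    exact ⟨fun ⟨x, _, he⟩ => ⟨x, he.symm⟩, fun ⟨x, he⟩ => ⟨x, mem_univ _, he.symm⟩⟩
  have hd1 : Disjoint Γ (D₁ ∪ D₂) := by
    rw [Finset.disjoint_left]
    intro u hu hu'
    obtain ⟨x, rfl⟩ := (hΓmem u).1 hu
    rcases mem_union.1 hu' with hu' | hu'
    · obtain ⟨k, hk, he⟩ := (hD1mem _).1 hu'
      exact columnSite_ne_gadgetSite hM2 hK2 k x (hL.ν_inj he).symm
    · obtain ⟨c, he, -⟩ := (hD2mem _).1 hu'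
      exact gadgetSite_ne_siteZ x c (hL.ν_inj he)
  have hd2 : Disjoint D₁ D₂ := by
    rw [Finset.disjoint_left]
    intro u hu hu'
    obtain ⟨k, hk, rfl⟩ := (hD1mem u).1 hu
    obtain ⟨c, he, -⟩ := (hD2mem _).1 hu'
    exact columnSite_ne_siteZ hM2 hK2 k c (hL.ν_inj he)
  have hodd : (univ.filter fun v => Odd (S.dg v)) = Γ ∪ (D₁ ∪ D₂) := by
    ext u
    simp only [mem_filter, mem_univ, true_and, mem_union, hΓmem, hD1mem, hD2mem]
    constructor
    · intro ho
      rcases hkind u (fun he => by rw [he] at ho; exact absurd ho (by decide)) with h1 | h1 | h1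
      exacts [.inr (.inr h1), .inl h1, .inr (.inl h1)]
    · rintro (⟨x, rfl⟩ | ⟨k, hk, rfl⟩ | ⟨c, -, h1⟩)
      · rw [hgad1]; exact odd_one
      · rw [hcol1]; exact odd_one
      · rw [h1]; exact odd_one
  have hcard := even_card_odd_dg S
  have hΓc : Γ.card = 2 * (q * (2 * K + 1)) := by
    rw [hΓ, card_image_of_injective _ fun x y he => gadgetSite_injective (hL.ν_inj he), card_univ]
    simp only [Fintype.card_prod, Fintype.card_sum, Fintype.card_fin, Fintype.card_bool]
    ring
  have hD1c : D₁.card = 2 * (4 * K * M) := by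
    rw [hD₁, card_image_of_injOn, card_range]
    · ring
    · intro i hi j hj' he
      rw [coe_range, Set.mem_Iio] at hi hj'
      exact columnSite_inj hM2 hK2 hi hj' (hL.ν_inj he)
  have hD2c : D₂.card = ((range (2 * M)).filter U).card := by
    rw [hD₂, card_image_of_injOn]
    intro i hi j hj' he
    rw [mem_coe, mem_filter, mem_range] at hi hj'
    have := hL.ν_inj he
    simp only [Sum.inl.injEq, Sum.inr.injEq] at this
    exact toFin_inj hM2 hi.1 hj'.1 this
  -- The number of vertices of odd degree is even, and so are the numbers of gadget sites and of
  -- column sites.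
  have heven : Even ((range (2 * M)).filter U).card := by
    rw [hodd, card_union_of_disjoint hd1, card_union_of_disjoint hd2, hΓc, hD1c, hD2c] at hcard
    rw [Nat.even_iff] at hcard ⊢
    omega
  obtain ⟨R, hRG, hR⟩ := hL.exists_matching hM2 hK2 U heven
  have hmem : ∀ i u, u ∈ gadSet K (ν (sitePole i true)) (ν (sitePole i false))
      (fun b j => ν (siteG i b (toFin hK2 j))) → u ∈ Γ := by
    intro i u hu
    obtain ⟨y, rfl⟩ := (mem_gadSet_iff hK2 i u).1 hu
    exact (hΓmem _).2 ⟨_, rfl⟩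
  have hterm : ∀ x : Term M K, ∃ i, ∃ v ∈ gadSet K (ν (sitePole i true)) (ν (sitePole i false))
      (fun b j => ν (siteG i b (toFin hK2 j))), S.Reachable (ν (termSite hℓ x)) v := by
    intro x
    rcases hib : σ.symm x with ⟨i, b⟩
    have h1 := hreach (.inr (.inr (i, b)))
    rw [← hib] at h1
    simp only [wireB, Equiv.apply_symm_apply] at h1
    refine ⟨i, ν (gadgetSite (i, .inr (b, lastFin hK))), (mem_gadSet_iff hK2 i _).2 ⟨_, rfl⟩, ?_⟩
    rw [hib] at h1
    exact h1.symm
  refine exists_factor_of_gadgets (κ := K) (ga := fun i => ν (sitePole i true))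
    (gb := fun i => ν (sitePole i false)) (g := fun i b j => ν (siteG i b (toFin hK2 j)))
    hL.gadget ?_ hSG hRG hSa hR ?_ ?_ ?_ ?_ ?_ ?_ ?_ ?_
  · intro i j hij
    rw [Finset.disjoint_left]
    intro u hu hu'
    obtain ⟨y, rfl⟩ := (mem_gadSet_iff hK2 i u).1 hu
    obtain ⟨y', he⟩ := (mem_gadSet_iff hK2 j _).1 hu'
    exact hij (Prod.ext_iff.1 (gadgetSite_injective (hL.ν_inj he))).1
  · intro i
    exact disjoint_of_subset_left (hmem i) hd1
  · intro i u hu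
    obtain ⟨y, rfl⟩ := (mem_gadSet_iff hK2 i u).1 hu
    exact hgad1 _
  · intro u hu
    rcases mem_union.1 hu with hu | hu
    · obtain ⟨k, hk, rfl⟩ := (hD1mem u).1 hu
      exact hcol1 k
    · exact ((hD2mem u).1 hu).choose_spec.2
  · intro u hu hu'
    by_contra hn
    rcases hkind u hn with h1 | ⟨⟨i, y⟩, rfl⟩ | h1
    · exact hu' (mem_union_right _ ((hD2mem u).2 h1))
    · exact hu i ((mem_gadSet_iff hK2 i _).2 ⟨y, rfl⟩)
    · exact hu' (mem_union_left _ ((hD1mem u).2 h1))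
  -- The only neighbour of an end is an inner vertex of a wire, which has degree two.
  · intro u v hu hv huv
    have hs : ∃ s, u = ν s ∧ ∀ k, s ≠ siteP k := by
      rcases hkind u (by omega) with ⟨c, rfl, -⟩ | ⟨x, rfl⟩ | ⟨k, hk, rfl⟩
      exacts [⟨_, rfl, by simp⟩, ⟨_, rfl, gadgetSite_ne_siteP x⟩,
        ⟨_, rfl, columnSite_ne_siteP hM2 hK2 k⟩]
    obtain ⟨s, rfl, hs⟩ := hs
    obtain ⟨y, hy, hy2⟩ := hend s hs
    obtain ⟨y', hy'⟩ := card_eq_one.1 hu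
    have h1 : v ∈ univ.filter (S.Adj (ν s)) := mem_filter.2 ⟨mem_univ _, huv⟩
    have h2 : y ∈ univ.filter (S.Adj (ν s)) := mem_filter.2 ⟨mem_univ _, hy⟩
    rw [hy', mem_singleton] at h1 h2
    rw [h1, ← h2] at hv
    omega
  · intro i j hj'
    have h1 := hreach (.inl (i, ⟨j, by omega⟩))
    have e : (toFin hK2 j : Fin (2 * K)) = innerFin ⟨j, by omega⟩ := Fin.ext (toFin_val _ (by omega))
    simp only [e]
    exact h1
  · intro i
    exact hreach (.inr (.inl i))
  · intro u hu
    rcases mem_union.1 hu with hu | hu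
    · obtain ⟨k, hk, rfl⟩ := (hD1mem u).1 hu
      exact columnSite_cases hM2 hK2 k (P := fun s => ∃ i, ∃ v ∈ gadSet K (ν (sitePole i true))
        (ν (sitePole i false)) (fun b j => ν (siteG i b (toFin hK2 j))), S.Reachable (ν s) v)
        (fun c j => hterm (.inl (.inl (c, j)))) fun c j => hterm (.inl (.inr (c, j)))
    · obtain ⟨c, rfl, -⟩ := (hD2mem u).1 hu
      exact hterm (.inr (.inr c))

end LayoutHamilton

/-! ### Choice of parameters. -/

section Parameters

variable {V : Type*} [Fintype V] {G : SimpleGraph V} {m : ℕ}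

theorem card_layout (κ M ℓ : ℕ) :
    Fintype.card (Site M ℓ (M * (4 * (κ + 1) + 2)) (κ + 1)) +
      Fintype.card (WireIx (M * (4 * (κ + 1) + 2)) (κ + 1)) * (2 * (κ + 1)) =
      M * ℓ + (6 * M + 32 * ((κ + 1) * M) + 40 * ((κ + 1) ^ 2 * M) + 16 * ((κ + 1) ^ 3 * M)) := by
  simp only [Fintype.card_sum, Fintype.card_prod, Fintype.card_fin, Fintype.card_bool]
  rw [show 2 * (κ + 1) - 1 = 2 * κ + 1 by omega]
  ring

theorem card_layout_le (κ M ℓ : ℕ) :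
    Fintype.card (Site M ℓ (M * (4 * (κ + 1) + 2)) (κ + 1)) +
      Fintype.card (WireIx (M * (4 * (κ + 1) + 2)) (κ + 1)) * (2 * (κ + 1)) ≤
      M * ℓ + 94 * ((κ + 1) ^ 3 * M) := by
  rw [card_layout]
  have h1 : M ≤ (κ + 1) ^ 3 * M := Nat.le_mul_of_pos_left _ (by positivity)
  have h2 : (κ + 1) * M ≤ (κ + 1) ^ 3 * M :=
    Nat.mul_le_mul_right _ (Nat.le_self_pow (by norm_num) _)
  have h3 : (κ + 1) ^ 2 * M ≤ (κ + 1) ^ 3 * M :=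
    Nat.mul_le_mul_right _ (Nat.pow_le_pow_right (by omega) (by norm_num))
  omega

/-- With K = κ + 1 there are 8KM terminals on ears and links, 2M ends of pieces and 2M `z`-vertices.
This is two for each of M(4K + 2) gadgets. -/
theorem terminal_equiv (κ M : ℕ) :
    Nonempty (Fin (M * (4 * (κ + 1) + 2)) × Bool ≃ Term M (κ + 1)) := by
  refine ⟨Fintype.equivOfCardEq ?_⟩
  simp only [Fintype.card_sum, Fintype.card_prod, Fintype.card_fin, Fintype.card_bool]
  ring

/-- By `hbig` the term with `r` is at most 24n, so kd ≤ 18n. If the conclusion failed, the value of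
`k` would give kd ≥ 160ℓM ≥ 20n. -/
theorem deficiency_bound {n K ℓ M k r d : ℕ} (hk : k = 640 * K * ℓ ^ 2) (hk0 : 0 < k)
    (hM : n ≤ 8 * (ℓ * M)) (hr : r ^ 2 ≤ 8 * n) (hbig : 8 * k ^ 6 ≤ n)
    (hd : 3 * k * d ≤ 30 * n + 8 * k * (2 * (k * k) + 1) * r) :
    4 * (d * (2 * K) * ℓ) ≤ 2 * M := by
  have hkr : k ^ 3 * r ≤ n := by
    have : (k ^ 3 * r) ^ 2 ≤ n ^ 2 := by
      calc (k ^ 3 * r) ^ 2 = k ^ 6 * r ^ 2 := by ring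
        _ ≤ k ^ 6 * (8 * n) := Nat.mul_le_mul_left _ hr
        _ = 8 * k ^ 6 * n := by ring
        _ ≤ n * n := Nat.mul_le_mul_right _ hbig
        _ = n ^ 2 := by ring
    exact (Nat.pow_le_pow_iff_left (by norm_num)).1 this
  have h1 : 8 * k * (2 * (k * k) + 1) * r ≤ 24 * (k ^ 3 * r) := by
    have h2 : 2 * (k * k) + 1 ≤ 3 * (k * k) := by nlinarith
    calc 8 * k * (2 * (k * k) + 1) * r ≤ 8 * k * (3 * (k * k)) * r := by gcongr
      _ = 24 * (k ^ 3 * r) := by ring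
  have h3 : k * d ≤ 18 * n := by nlinarith
  have hn : 0 < n := lt_of_lt_of_le (by positivity) hbig
  by_contra! hcon
  have h4 : 0 < ℓ := by
    rcases Nat.eq_zero_or_pos ℓ with rfl | h
    · simp at hk; omega
    · exact h
  have h5 : k * d = 80 * ℓ * (4 * (d * (2 * K) * ℓ)) := by rw [hk]; ring
  have h6 : 80 * ℓ * (2 * M) ≤ k * d := by rw [h5]; exact Nat.mul_le_mul_left _ hcon.le
  have h7 : 80 * ℓ * (2 * M) = 160 * (ℓ * M) := by ring
  omega

/-- With ℓ = 400K³ the frame apart from the pieces is less than a quarter of the size of the pieces,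
and M = ⌊n/(4ℓ)⌋ gives the pieces about n/4 vertices. The cycle length `k` is large enough for the
deficiency to be absorbed by a pool of 2M vertices. -/
theorem exists_factor_of_large (hext : Extendable G m ∅ fun _ => 20) (hj : Joined G m) (hm : 0 < m)
    {κ : ℕ} (hκ : m ≤ 2 ^ κ) (hκ' : 2 ^ κ ≤ 2 * m) (hmn : 500 * m ≤ Fintype.card V)
    (hbig : 8 * (640 * (κ + 1) * (400 * (κ + 1) ^ 3) ^ 2) ^ 6 ≤ Fintype.card V) :
    ∃ R : SimpleGraph V, R ≤ G ∧ (∀ v, R.dg v = 2) ∧ ∀ u v, R.Reachable u v := by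
  set n := Fintype.card V with hn
  obtain ⟨ℓ, hℓ⟩ : ∃ ℓ, ℓ = 400 * (κ + 1) ^ 3 := ⟨_, rfl⟩
  obtain ⟨k, hk⟩ : ∃ k, k = 640 * (κ + 1) * ℓ ^ 2 := ⟨_, rfl⟩
  rw [← hℓ, ← hk] at hbig
  have hK3 : 1 ≤ (κ + 1) ^ 3 := Nat.one_le_pow _ _ (by omega)
  have hℓ400 : 400 ≤ ℓ := by omega
  have hkℓ : 640 * ℓ ≤ k := by
    rw [hk]
    calc 640 * ℓ ≤ 640 * ℓ ^ 2 := Nat.mul_le_mul_left _ (Nat.le_self_pow (by norm_num) _)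
      _ = 640 * 1 * ℓ ^ 2 := by ring
      _ ≤ _ := by gcongr; omega
  have hk6 : k ≤ k ^ 6 := Nat.le_self_pow (by norm_num) _
  obtain ⟨M, hM⟩ : ∃ M, M = n / (4 * ℓ) := ⟨_, rfl⟩
  have hM1 : 4 * (ℓ * M) ≤ n := by
    have := Nat.mul_div_le n (4 * ℓ)
    rw [← hM, mul_assoc] at this
    exact this
  have hM2 : n < 4 * (ℓ * M) + 4 * ℓ := by
    have := Nat.lt_mul_div_succ n (show 0 < 4 * ℓ by omega)
    rw [← hM] at this
    linarith
  have hM0 : 0 < M := by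
    rcases Nat.eq_zero_or_pos M with h | h
    · rw [h] at hM2; omega
    · exact h
  have : NeZero (M * (4 * (κ + 1) + 2)) := ⟨by positivity⟩
  have : NeZero (2 * M) := ⟨by omega⟩
  obtain ⟨σ⟩ := terminal_equiv κ M
  have hc := card_layout_le κ M ℓ
  have hTM : 400 * ((κ + 1) ^ 3 * M) = ℓ * M := by rw [hℓ]; ring
  have hcomm : M * ℓ = ℓ * M := mul_comm _ _
  have hpow : 2 ^ (κ + 1) = 2 * 2 ^ κ := by ring
  obtain ⟨ν, P, B, A', hL⟩ := hext.exists_layout hj hm (κ := κ) (M := M) (ℓ := ℓ) (by omega) σ hκ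
    (by omega) (by omega)
  have hs := Nat.sqrt_le' (2 * n)
  have hs1 : 1 ≤ Nat.sqrt (2 * n) := by
    rw [Nat.le_sqrt]; omega
  refine hL.exists_factor hj (by omega) hm hκ (k := k) (r := Nat.sqrt (2 * n) + 1) (by omega)
    (by have := Nat.lt_succ_sqrt' (2 * n); exact this.le) fun d hd => ?_
  refine le_trans ?_ (deficiency_bound hk (by omega) (n := n) (by omega) (by nlinarith) hbig hd)
  gcongr
  omega

/-- The left side is a constant times (κ + 1)^42. -/
theorem exists_pow_le : ∃ K₀ : ℕ, ∀ κ ≥ K₀,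
    32 * (640 * (κ + 1) * (400 * (κ + 1) ^ 3) ^ 2) ^ 6 ≤ 2 ^ κ := by
  have h := tendsto_pow_const_div_const_pow_of_one_lt 42 (show (1 : ℝ) < 2 by norm_num)
  have h' := (Filter.tendsto_add_atTop_iff_nat 1).2 h
  obtain ⟨K₀, hK₀⟩ := Filter.eventually_atTop.1
    (h'.eventually (gt_mem_nhds (show (0 : ℝ) < 1 / (64 * (640 * 400 ^ 2) ^ 6) by positivity)))
  refine ⟨K₀, fun κ hκ => ?_⟩
  have h1 := hK₀ κ hκ
  rw [div_lt_div_iff₀ (by positivity) (by positivity), one_mul] at h1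
  have h2 : ((64 * (640 * (κ + 1) * (400 * (κ + 1) ^ 3) ^ 2) ^ 6 : ℕ) : ℝ) ≤ ((2 ^ (κ + 1) : ℕ) : ℝ) := by
    push_cast at h1 ⊢
    refine le_trans (le_of_eq ?_) h1.le
    ring
  have h3 : 64 * (640 * (κ + 1) * (400 * (κ + 1) ^ 3) ^ 2) ^ 6 ≤ 2 ^ (κ + 1) := by exact_mod_cast h2
  rw [pow_succ 2 κ] at h3
  omega

end Parameters

/-! ### From the definition of an expander to the theorem. -/

section Main

variable {V : Type*} [Fintype V]

theorem isHamiltonian_of_complete [DecidableEq V] {G : SimpleGraph V} (hV : 3 ≤ Fintype.card V)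
    (hG : ∀ u v, u ≠ v → G.Adj u v) : G.IsHamiltonian := by
  obtain ⟨n, hn⟩ := Nat.exists_eq_add_of_le' hV
  let e : V ≃ Fin (n + 3) := Fintype.equivFinOfCardEq hn
  have : Nonempty V := Fintype.card_pos_iff.1 (by omega)
  refine isHamiltonian_of_dg_eq_two (R := (cycleGraph (n + 3)).comap e) (fun u v h => hG u v h.ne) ?_ ?_
  · intro v
    have h1 := cycleGraph_degree_three_le (v := e v)
    rw [← h1, ← card_neighborFinset_eq_degree]
    unfold dg
    refine card_bij (fun x _ => e x) ?_ ?_ ?_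
    · intro x hx
      simpa using hx
    · intro x _ y _ h
      exact e.injective h
    · intro y hy
      exact ⟨e.symm y, by simpa using hy, by simp⟩
  · intro u v
    have h1 := cycleGraph_preconnected (e u) (e v)
    exact (Iso.reachable_iff (φ := Iso.comap e (cycleGraph (n + 3)))).1 h1

theorem outerNbhd_subset_nbr (G : SimpleGraph V) (U : Finset V) : G.outerNbhd U ⊆ nbr G U := by
  intro x hx
  simp only [outerNbhd, mem_filter, mem_univ, true_and] at hx
  exact mem_nbr.2 hx.2

variable {G : SimpleGraph V} {C : ℝ}

theorem IsExpander.joined' (hG : G.IsExpander C) {m : ℕ}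
    (hm : (Fintype.card V : ℝ) / (2 * C) ≤ m) : Joined G m := by
  intro U W hUW hU hW
  exact hG.joined U W hUW (hm.trans (by exact_mod_cast hU)) (hm.trans (by exact_mod_cast hW))

/-- Below the threshold this is expansion. Above it, a set with too few neighbours would, together
with them, occupy at most 42m vertices, and so leave `m` vertices to which it sends no edge. -/
theorem IsExpander.extendable (hG : G.IsExpander C) (hC : 20 ≤ C) {m : ℕ}
    (hm : (Fintype.card V : ℝ) / (2 * C) ≤ m) (hn : 43 * m ≤ Fintype.card V) :
    Extendable G m ∅ fun _ => 20 := by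
  intro U hU
  rw [sum_const, nsmul_eq_mul, sdiff_empty]
  suffices h : U.card * 20 ≤ (nbr G U).card by exact_mod_cast h
  rcases lt_or_ge (U.card : ℝ) ((Fintype.card V : ℝ) / (2 * C)) with h1 | h1
  · have h2 := hG.expand U h1
    have h3 : ((G.outerNbhd U).card : ℝ) ≤ (nbr G U).card := by
      exact_mod_cast card_le_card (outerNbhd_subset_nbr G U)
    have h4 : (20 : ℝ) * U.card ≤ C * U.card := by gcongr
    have h5 : ((U.card * 20 : ℕ) : ℝ) ≤ ((nbr G U).card : ℕ) := by push_cast; linarith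
    exact_mod_cast h5
  · by_contra! hcon
    have h2 : (univ \ (U ∪ nbr G U)).card + (U ∪ nbr G U).card = Fintype.card V := by
      rw [card_sdiff_add_card_eq_card (subset_univ _), card_univ]
    have h3 := card_union_le U (nbr G U)
    have h4 : m ≤ (univ \ (U ∪ nbr G U)).card := by omega
    obtain ⟨u, hu, w, hw, huw⟩ := hG.joined U (univ \ (U ∪ nbr G U))
      (Finset.disjoint_left.2 fun x hx hx' => by simp [hx] at hx') h1
      (hm.trans (by exact_mod_cast h4))
    simp only [mem_sdiff, mem_univ, true_and, mem_union, not_or, mem_nbr] at hw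
    exact hw.2 ⟨u, hu, huw⟩

/-- Expanders of small order relative to `C` are complete. -/
theorem IsExpander.adj_of_card_le (hG : G.IsExpander C) (hC : 0 < C)
    (hn : (Fintype.card V : ℝ) ≤ 2 * C) {u v : V} (huv : u ≠ v) : G.Adj u v := by
  have h1 : (Fintype.card V : ℝ) / (2 * C) ≤ 1 := by rw [div_le_one (by positivity)]; exact hn
  obtain ⟨x, hx, y, hy, hxy⟩ := hG.joined {u} {v} (by simpa using huv) (by simpa using h1)
    (by simpa using h1)
  rw [mem_singleton] at hx hy
  rwa [hx, hy] at hxy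

/-- If n ≤ 2C, single vertices already meet the threshold and the graph is complete. Otherwise n is
large because C is, so m = ⌊n/1000⌋ + 1 exceeds 2^K₀ and the numerical conditions hold. -/
theorem IsExpander.isHamiltonian [DecidableEq V] (hG : G.IsExpander C) {K₀ : ℕ}
    (hK₀ : ∀ κ ≥ K₀, 32 * (640 * (κ + 1) * (400 * (κ + 1) ^ 3) ^ 2) ^ 6 ≤ 2 ^ κ)
    (hC : ((1000 * 2 ^ K₀ + 1000 : ℕ) : ℝ) ≤ C) : G.IsHamiltonian := by
  have hC1 : (1000 : ℝ) ≤ C := le_trans (by push_cast; linarith [pow_pos (show (0 : ℝ) < 2 by norm_num) K₀]) hC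
  have hC0 : 0 < C := by linarith
  rcases le_or_gt (Fintype.card V : ℝ) (2 * C) with hn | hn
  · exact isHamiltonian_of_complete hG.three_le_card fun u v huv => hG.adj_of_card_le hC0 hn huv
  · have hn' : 1000 * 2 ^ K₀ + 1000 < Fintype.card V := by
      have : ((1000 * 2 ^ K₀ + 1000 : ℕ) : ℝ) < Fintype.card V := by linarith
      exact_mod_cast this
    obtain ⟨m, hm⟩ : ∃ m, m = Fintype.card V / 1000 + 1 := ⟨_, rfl⟩
    have hmC : (Fintype.card V : ℝ) / (2 * C) ≤ m := by
      have h1 : Fintype.card V ≤ 1000 * m := by omega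
      have h2 : (Fintype.card V : ℝ) ≤ 1000 * m := by exact_mod_cast h1
      rw [div_le_iff₀ (by positivity)]
      have h3 : (0 : ℝ) ≤ m := by positivity
      nlinarith
    have hκ := Nat.le_pow_clog one_lt_two m
    have hκ' := Nat.pow_pred_clog_lt_self one_lt_two (show 1 < m by omega)
    set κ := Nat.clog 2 m with hκdef
    have hK : K₀ ≤ κ := by
      by_contra! hlt
      have h1 : 2 ^ κ ≤ 2 ^ K₀ := Nat.pow_le_pow_right (by norm_num) hlt.le
      omega
    have hκ0 : 0 < κ := Nat.clog_pos one_lt_two (by omega)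
    have hκ2 : 2 ^ κ ≤ 2 * m := by
      obtain ⟨j, hj⟩ := Nat.exists_eq_add_of_lt hκ0
      rw [zero_add] at hj
      rw [hj, Nat.pred_succ] at hκ'
      rw [hj, pow_succ]
      omega
    have h32 := hK₀ κ hK
    obtain ⟨R, hRG, h2, hc⟩ := exists_factor_of_large (hG.extendable (by linarith) hmC (by omega))
      (hG.joined' hmC) (by omega) hκ hκ2 (by omega) (by omega)
    have : Nonempty V := Fintype.card_pos_iff.1 (by omega)
    exact isHamiltonian_of_dg_eq_two hRG h2 hc

end Main

end SimpleGraph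

theorem mainTheorem1 :
    ∃ C₀ : ℝ, 0 < C₀ ∧ ∀ C : ℝ, C₀ ≤ C →
      ∀ (V : Type*) [Fintype V] [DecidableEq V] (G : SimpleGraph V),
        G.IsExpander C → G.IsHamiltonian := by
  obtain ⟨K₀, hK₀⟩ := SimpleGraph.exists_pow_le
  exact ⟨(1000 * 2 ^ K₀ + 1000 : ℕ), by positivity,
    fun C hC V _ _ G hG => hG.isHamiltonian hK₀ hC⟩
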